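/- Let $M^6$ be a smooth $6$-manifold with an $\mathrm{SU}(3)$-structure $(\omega,\psi_+,\psi_-)$, i.e. a Riemannian metric $g_6$, a $2$-form $\omega$ and $3$-forms $\psi_\pm$ such that near each point there is a $g_6$-orthonormal coframe $e^1,\dots,e^6$ with $$\omega=e^{12}+e^{34}+e^{56},\quad \psi_+=e^{135}-e^{146}-e^{236}-e^{245},\quad \psi_-=-e^{246}+e^{235}+e^{145}+e^{136}.$$ Let $J$ be the almost complex structure with $\omega=g_6(J\cdot,\cdot)$, let $\ast_6$ be the Hodge star of $g_6$ and $vol_6=\frac1{3!}\omega^3$, and let $\pi_0,\sigma_0\in C^\infty(M^6)$, $\pi_1,\nu_1\in\Omega^1(M^6)$, $\pi_2,\sigma_2\in\Omega^2_8(M^6)$, $\nu_3\in\Omega^3_{12}(M^6)$ be the torsion forms, defined by $$d\omega=-\tfrac32\sigma_0\psi_++\tfrac32\pi_0\psi_-+\nu_1\wedge\omega+\nu_3,\quad d\psi_+=\pi_0\,\omega^2+\pi_1\wedge\psi_+-\pi_2\wedge\omega,\quad d\psi_-=\sigma_0\,\omega^2+\pi_1\wedge\psi_--\sigma_2\wedge\omega,$$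 where $\Omega^2_8=\{\sigma : \sigma\wedge\psi_+=0,\ \ast_6J\sigma=-\sigma\wedge\omega\}$ and $\Omega^3_{12}=\{\gamma : \gamma\wedge\omega=0,\ \gamma\wedge\psi_\pm=0\}$. Let $f$ be a nowhere vanishing smooth function on $M^6$, let $\alpha,\beta\in\mathbb R$ with $\alpha^2+\beta^2=1$, let $s$ be the angular coordinate on $S^1$, and consider on $M^6\times S^1$ the warped $\mathrm G_2$-structure $$\varphi=f\,\omega\wedge ds+(\alpha\psi_+-\beta\psi_-).$$ Let $\ast_7$ be the Hodge star of the metric and the volume form determined by $\varphi$ (those for which every local coframe with $\varphi=e^{127}+e^{347}+e^{567}+e^{135}-e^{146}-e^{236}-e^{245}$ is orthonormal and positively oriented), and let $\Delta_7=\ast_7d_7\ast_7d_7-d_7\ast_7d_7\ast_7$ be the Hodge Laplacian on $3$-forms. Suppose that $d_7\varphi=0$. Then $\alpha\pi_2-\beta\sigma_2=0$ and $$\Delta_7\varphi=-d_6(\alpha\sigma_2+\beta\pi_2)+d_6\ast_6\big(\nu_1\wedge(\alpha\psi_-+\beta\psi_+)\big)+f\big[\nu_1\wedge\ast_6(\nu_1\wedge\omega^2)-d_6\ast_6(\nu_1\wedge\omega^2)\big]\wedge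 ds .$$ If moreover $d_6f=0$ (for instance, if $f$ is constant), then $\Delta_7\varphi=-d_6(\alpha\sigma_2+\beta\pi_2)$. -/

import Mathlib

open scoped Manifold ContDiff Topology

noncomputable section

namespace WarpedG2

section Pointwise

variable {V : Type*} [AddCommGroup V] [Module ℝ V] [TopologicalSpace V]

/-- The multilinear map `(v₁, …, v_{k+l}) ↦ a (v₁, …, v_k) * b (v_{k+1}, …, v_{k+l})`. -/
def prodMultilinear {k l : ℕ} (a : V [⋀^Fin k]→L[ℝ] ℝ) (b : V [⋀^Fin l]→L[ℝ] ℝ) :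
    ContinuousMultilinearMap ℝ (fun _ : Fin (k + l) => V) ℝ where
  toFun v := a (fun i => v (Fin.castAdd l i)) * b (fun j => v (Fin.natAdd k j))
  map_update_add' := by
    intro inst v i x y
    obtain rfl : inst = instDecidableEqFin (k + l) := Subsingleton.elim _ _
    induction i using Fin.addCases with
    | left i =>
      have h1 : ∀ z, (fun j => Function.update v (Fin.castAdd l i) z (Fin.castAdd l j)) =
          Function.update (fun j => v (Fin.castAdd l j)) i z := fun z =>
        Function.update_comp_eq_of_injective v (Fin.castAdd_injective k l) i z
      have h2 : ∀ z, (fun j => Function.update v (Fin.castAdd l i) z (Fin.natAdd k j)) =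
          fun j => v (Fin.natAdd k j) := fun z => by
        funext j
        exact Function.update_of_ne (by simp [Fin.ext_iff]; omega) _ _
      simp only [h1, h2, a.map_update_add, add_mul]
    | right i =>
      have h1 : ∀ z, (fun j => Function.update v (Fin.natAdd k i) z (Fin.natAdd k j)) =
          Function.update (fun j => v (Fin.natAdd k j)) i z := fun z =>
        Function.update_comp_eq_of_injective v (Fin.natAdd_injective l k) i z
      have h2 : ∀ z, (fun j => Function.update v (Fin.natAdd k i) z (Fin.castAdd l j)) =
          fun j => v (Fin.castAdd l j) := fun z => by
        funext j
        exact Function.update_of_ne (by simp [Fin.ext_iff]; omega) _ _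
      simp only [h1, h2, b.map_update_add, mul_add]
  map_update_smul' := by
    intro inst v i c x
    obtain rfl : inst = instDecidableEqFin (k + l) := Subsingleton.elim _ _
    induction i using Fin.addCases with
    | left i =>
      have h1 : ∀ z, (fun j => Function.update v (Fin.castAdd l i) z (Fin.castAdd l j)) =
          Function.update (fun j => v (Fin.castAdd l j)) i z := fun z =>
        Function.update_comp_eq_of_injective v (Fin.castAdd_injective k l) i z
      have h2 : ∀ z, (fun j => Function.update v (Fin.castAdd l i) z (Fin.natAdd k j)) =
          fun j => v (Fin.natAdd k j) := fun z => by
        funext j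
        exact Function.update_of_ne (by simp [Fin.ext_iff]; omega) _ _
      simp only [h1, h2, a.map_update_smul, smul_eq_mul, mul_assoc]
    | right i =>
      have h1 : ∀ z, (fun j => Function.update v (Fin.natAdd k i) z (Fin.natAdd k j)) =
          Function.update (fun j => v (Fin.natAdd k j)) i z := fun z =>
        Function.update_comp_eq_of_injective v (Fin.natAdd_injective l k) i z
      have h2 : ∀ z, (fun j => Function.update v (Fin.natAdd k i) z (Fin.castAdd l j)) =
          fun j => v (Fin.castAdd l j) := fun z => by
        funext j
        exact Function.update_of_ne (by simp [Fin.ext_iff]; omega) _ _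
      simp only [h1, h2, b.map_update_smul, smul_eq_mul, mul_left_comm]
  cont := (a.cont.comp (by fun_prop)).mul (b.cont.comp (by fun_prop))

/-- Wedge product of alternating forms on one vector space,
`(a ∧ b)(v) = 1 / (k! l!) ∑_σ sign σ · a (v_σ(1), …, v_σ(k)) · b (v_σ(k+1), …, v_σ(k+l))`,
so that `(e¹ ∧ e²)(e₁, e₂) = 1`. -/
def wedgeAt {k l : ℕ} (a : V [⋀^Fin k]→L[ℝ] ℝ) (b : V [⋀^Fin l]→L[ℝ] ℝ) :
    V [⋀^Fin (k + l)]→L[ℝ] ℝ :=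
  ((k.factorial : ℝ) * (l.factorial : ℝ))⁻¹ •
    ContinuousMultilinearMap.alternatization (prodMultilinear a b)

/-- A covector as a `1`-form. -/
def covector (e : V →L[ℝ] ℝ) : V [⋀^Fin 1]→L[ℝ] ℝ :=
  ContinuousAlternatingMap.ofSubsingleton ℝ V ℝ (0 : Fin 1) e

/-- `e^{ij} = e^i ∧ e^j`. -/
def mono₂ {n : ℕ} (e : Fin n → V →L[ℝ] ℝ) (i j : Fin n) : V [⋀^Fin 2]→L[ℝ] ℝ :=
  wedgeAt (covector (e i)) (covector (e j))

/-- `e^{ijk} = e^i ∧ e^j ∧ e^k`. -/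
def mono₃ {n : ℕ} (e : Fin n → V →L[ℝ] ℝ) (i j k : Fin n) : V [⋀^Fin 3]→L[ℝ] ℝ :=
  wedgeAt (mono₂ e i j) (covector (e k))

/-- The form `v ↦ ν (w₁, …, w_k, v₁, …, v_m)` obtained from a `(k + m)`-form `ν` by inserting
`w₁, …, w_k` in the first `k` slots. -/
def insertFirst {k m : ℕ} (ν : V [⋀^Fin (k + m)]→L[ℝ] ℝ) (w : Fin k → V) :
    V [⋀^Fin m]→L[ℝ] ℝ where
  toFun v := ν (Fin.append w v)
  map_update_add' := by
    intro inst v i x y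
    obtain rfl : inst = instDecidableEqFin m := Subsingleton.elim _ _
    have h : ∀ z, Fin.append w (Function.update v i z) =
        Function.update (Fin.append w v) (Fin.natAdd k i) z := fun z => by
      funext j
      induction j using Fin.addCases with
      | left j =>
        rw [Fin.append_left, Function.update_of_ne (by simp [Fin.ext_iff]; omega),
          Fin.append_left]
      | right j =>
        by_cases hj : j = i
        · subst hj; simp
        · rw [Fin.append_right, Function.update_of_ne hj,
            Function.update_of_ne (by simpa [Fin.ext_iff] using hj), Fin.append_right]
    simp only [h, ν.map_update_add]
  map_update_smul' := by
    intro inst v i c x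
    obtain rfl : inst = instDecidableEqFin m := Subsingleton.elim _ _
    have h : ∀ z, Fin.append w (Function.update v i z) =
        Function.update (Fin.append w v) (Fin.natAdd k i) z := fun z => by
      funext j
      induction j using Fin.addCases with
      | left j =>
        rw [Fin.append_left, Function.update_of_ne (by simp [Fin.ext_iff]; omega),
          Fin.append_left]
      | right j =>
        by_cases hj : j = i
        · subst hj; simp
        · rw [Fin.append_right, Function.update_of_ne hj,
            Function.update_of_ne (by simpa [Fin.ext_iff] using hj), Fin.append_right]
    simp only [h, ν.map_update_smul]
  map_eq_zero_of_eq' := by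
    intro v i j hv hij
    refine ν.map_eq_zero_of_eq (Fin.append w v) (i := Fin.natAdd k i) (j := Fin.natAdd k j)
      (by simpa using hv) (by simpa [Fin.ext_iff] using hij)
  cont := by
    refine ν.cont.comp (continuous_pi fun j => ?_)
    induction j using Fin.addCases with
    | left j => simpa using continuous_const
    | right j => simpa using continuous_apply j

/-- The vectors `b¹, …, bⁿ` with `g (bⁱ, b_j) = δ_ij`, for the reference basis `b` of `V`:
`bⁱ = ∑_j g^{ij} b_j`, with `(g^{ij})` the inverse of the Gram matrix `(g (b_i, b_j))`. -/
def metricDual [Module.Finite ℝ V] (g : V →L[ℝ] V →L[ℝ] ℝ)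
    (i : Fin (Module.finrank ℝ V)) : V :=
  let b := Module.finBasis ℝ V
  ∑ j, (Matrix.of fun p q => g (b p) (b q))⁻¹ i j • b j

/-- Hodge star from `k`-forms to `m`-forms on an inner product space `(V, g)` of dimension `k + m`
with volume form `vol`: `⋆a = 1 / k! ∑_{i₁, …, i_k} a (b_{i₁}, …, b_{i_k}) · vol (b^{i₁}, …, b^{i_k}, ·)`.
It does not depend on the basis `b`; in a `g`-orthonormal basis with `vol = e^{1…n}` it sends
`e^{1…k}` to `e^{k+1…n}`, which is the convention `a ∧ ⋆c = g(a, c) vol`. -/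
def hodgeStarAt [Module.Finite ℝ V] {k : ℕ} (m : ℕ) (g : V →L[ℝ] V →L[ℝ] ℝ)
    (vol : V [⋀^Fin (k + m)]→L[ℝ] ℝ) (a : V [⋀^Fin k]→L[ℝ] ℝ) : V [⋀^Fin m]→L[ℝ] ℝ :=
  (k.factorial : ℝ)⁻¹ • ∑ i : Fin k → Fin (Module.finrank ℝ V),
    a (fun p => Module.finBasis ℝ V (i p)) • insertFirst vol (fun p => metricDual g (i p))

/-- `e` is an adapted coframe for `(g, ω, ψ₊, ψ₋)`: it is `g`-orthonormal and
`ω = e¹² + e³⁴ + e⁵⁶`, `ψ₊ = e¹³⁵ - e¹⁴⁶ - e²³⁶ - e²⁴⁵`, `ψ₋ = -e²⁴⁶ + e²³⁵ + e¹⁴⁵ + e¹³⁶`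
(indices start at `0` in the code). -/
structure IsSU3Coframe (g : V →L[ℝ] V →L[ℝ] ℝ) (ω₀ : V [⋀^Fin 2]→L[ℝ] ℝ)
    (ψp ψm : V [⋀^Fin 3]→L[ℝ] ℝ) (e : Fin 6 → V →L[ℝ] ℝ) : Prop where
  indep : LinearIndependent ℝ e
  metric : ∀ v w, g v w = ∑ i, e i v * e i w
  omega : ω₀ = mono₂ e 0 1 + mono₂ e 2 3 + mono₂ e 4 5
  psi_plus : ψp = mono₃ e 0 2 4 - mono₃ e 0 3 5 - mono₃ e 1 2 5 - mono₃ e 1 3 4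
  psi_minus : ψm = -mono₃ e 1 3 5 + mono₃ e 1 2 4 + mono₃ e 0 3 4 + mono₃ e 0 2 5

/-- `e` is an adapted coframe for the `G₂` form `φ` with metric `g` and volume form `vol`:
`φ = e¹²⁷ + e³⁴⁷ + e⁵⁶⁷ + e¹³⁵ - e¹⁴⁶ - e²³⁶ - e²⁴⁵`, `e` is `g`-orthonormal, `vol = e¹²³⁴⁵⁶⁷`. -/
structure IsG2Coframe (g : V →L[ℝ] V →L[ℝ] ℝ) (vol : V [⋀^Fin 7]→L[ℝ] ℝ)
    (φ : V [⋀^Fin 3]→L[ℝ] ℝ) (e : Fin 7 → V →L[ℝ] ℝ) : Prop where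
  indep : LinearIndependent ℝ e
  metric : ∀ v w, g v w = ∑ i, e i v * e i w
  volume : vol = wedgeAt (wedgeAt (mono₃ e 0 1 2) (mono₃ e 3 4 5)) (covector (e 6))
  form : φ = mono₃ e 0 1 6 + mono₃ e 2 3 6 + mono₃ e 4 5 6
    + mono₃ e 0 2 4 - mono₃ e 0 3 5 - mono₃ e 1 2 5 - mono₃ e 1 3 4

end Pointwise

section Forms

variable {E : Type*} [NormedAddCommGroup E] [NormedSpace ℝ E]
  {H : Type*} [TopologicalSpace H]

/-- (Not necessarily smooth) differential `k`-forms on `M`. -/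
abbrev DForm (I : ModelWithCorners ℝ E H) (M : Type*) [TopologicalSpace M] [ChartedSpace H M]
    (k : ℕ) : Type _ :=
  (x : M) → TangentSpace I x [⋀^Fin k]→L[ℝ] ℝ

variable {I : ModelWithCorners ℝ E H} {M : Type*} [TopologicalSpace M] [ChartedSpace H M]
  {E' : Type*} [NormedAddCommGroup E'] [NormedSpace ℝ E'] {H' : Type*} [TopologicalSpace H']
  {I' : ModelWithCorners ℝ E' H'} {M' : Type*} [TopologicalSpace M'] [ChartedSpace H' M']

/-- The expression of a form in the preferred chart at `x₀`: its pullback by the inverse chart. -/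
def inChart {k : ℕ} (x₀ : M) (η : DForm I M k) (y : E) : E [⋀^Fin k]→L[ℝ] ℝ :=
  (η ((extChartAt I x₀).symm y)).compContinuousLinearMap
    (mfderivWithin 𝓘(ℝ, E) I (extChartAt I x₀).symm (Set.range I) y)

/-- A form is smooth if its expressions in the charts are. -/
def IsSmooth {k : ℕ} (η : DForm I M k) : Prop :=
  ∀ x₀ : M, ContDiffOn ℝ ∞ (inChart x₀ η) (extChartAt I x₀).target

/-- Exterior derivative: at `x`, the exterior derivative of the expression of the form in the
chart at `x`, pulled back to the manifold. -/
def extD {k : ℕ} (η : DForm I M k) : DForm I M (k + 1) := fun x =>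
  (extDerivWithin (inChart x η) (Set.range I) (extChartAt I x x)).compContinuousLinearMap
    (mfderiv I 𝓘(ℝ, E) (extChartAt I x) x)

/-- Wedge product of differential forms. -/
def wedge {k l : ℕ} (η : DForm I M k) (θ : DForm I M l) : DForm I M (k + l) := fun x =>
  wedgeAt (η x) (θ x)

/-- Product of a function and a form. -/
def fsmul {k : ℕ} (f : M → ℝ) (η : DForm I M k) : DForm I M k := fun x => f x • η x

/-- Pullback of a form by a map. -/
def pullback {k : ℕ} (F : M' → M) (η : DForm I M k) : DForm I' M' k := fun p =>
  (η (F p)).compContinuousLinearMap (mfderiv I' I F p)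

/-- Hodge star operator from `k`-forms to `m`-forms, for a family of inner products `g` and a
volume form `vol` on a manifold of dimension `k + m`. -/
def hodgeStar [FiniteDimensional ℝ E] {k : ℕ} (m : ℕ)
    (g : (x : M) → TangentSpace I x →L[ℝ] TangentSpace I x →L[ℝ] ℝ)
    (vol : DForm I M (k + m)) (η : DForm I M k) : DForm I M m := fun x =>
  haveI : Module.Finite ℝ (TangentSpace I x) := inferInstanceAs (Module.Finite ℝ E)
  hodgeStarAt m (g x) (vol x) (η x)

end Forms

/-- wedge product of differential forms -/
infixl:70 " ⋏ " => wedge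

/-- product of a function and a form -/
infixr:73 " •ᶠ " => fsmul

/-- The type of smooth Riemannian metrics on `M`. -/
abbrev Metric {E : Type*} [NormedAddCommGroup E] [NormedSpace ℝ E] {H : Type*}
    [TopologicalSpace H] (I : ModelWithCorners ℝ E H) (M : Type*) [TopologicalSpace M]
    [ChartedSpace H M] [IsManifold I ∞ M] :=
  haveI : IsManifold I 1 M := IsManifold.of_le (n := ∞) (by norm_cast)
  Bundle.ContMDiffRiemannianMetric I ∞ E (fun x : M => TangentSpace I x)

/-- An `SU(3)`-structure on a smooth `6`-manifold: a metric `g`, an almost complex structure `J`,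
the Kähler form `ω = g(J·, ·)` and the real and imaginary parts `ψ₊`, `ψ₋` of the complex volume
form, which have the standard expression in suitable coframes. -/
structure SU3Structure (M : Type*) [TopologicalSpace M] [ChartedSpace (EuclideanSpace ℝ (Fin 6)) M]
    [IsManifold (𝓡 6) ∞ M] where
  g : Metric (𝓡 6) M
  J : (x : M) → TangentSpace (𝓡 6) x →L[ℝ] TangentSpace (𝓡 6) x
  omega : DForm (𝓡 6) M 2
  ψp : DForm (𝓡 6) M 3
  ψm : DForm (𝓡 6) M 3
  smooth_omega : IsSmooth omega
  smooth_ψp : IsSmooth ψp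
  smooth_ψm : IsSmooth ψm
  kaehler : ∀ x (v w : TangentSpace (𝓡 6) x), omega x ![v, w] = g.inner x (J x v) w
  exists_coframe : ∀ x, ∃ e : Fin 6 → TangentSpace (𝓡 6) x →L[ℝ] ℝ,
    IsSU3Coframe (g.inner x) (omega x) (ψp x) (ψm x) e

namespace SU3Structure

variable {M : Type*} [TopologicalSpace M] [ChartedSpace (EuclideanSpace ℝ (Fin 6)) M]
    [IsManifold (𝓡 6) ∞ M] (S : SU3Structure M)

/-- `vol₆ = ω³ / 3!`. -/
def vol : DForm (𝓡 6) M 6 := (1 / 6 : ℝ) • (S.omega ⋏ S.omega ⋏ S.omega)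

/-- The Hodge star `∗₆` from `4`-forms to `2`-forms. -/
def star₄ (η : DForm (𝓡 6) M 4) : DForm (𝓡 6) M 2 :=
  hodgeStar (k := 4) 2 (fun x => S.g.inner x) S.vol η

/-- The Hodge star `∗₆` from `5`-forms to `1`-forms. -/
def star₅ (η : DForm (𝓡 6) M 5) : DForm (𝓡 6) M 1 :=
  hodgeStar (k := 5) 1 (fun x => S.g.inner x) S.vol η

/-- The Hodge star `∗₆` from `2`-forms to `4`-forms. -/
def star₂ (η : DForm (𝓡 6) M 2) : DForm (𝓡 6) M 4 :=
  hodgeStar (k := 2) 4 (fun x => S.g.inner x) S.vol η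

/-- `(J η)(v₁, …, v_k) = η (J v₁, …, J v_k)`. -/
def actJ {k : ℕ} (η : DForm (𝓡 6) M k) : DForm (𝓡 6) M k := fun x =>
  (η x).compContinuousLinearMap (S.J x)

/-- `Ω²₈ = {σ | σ ∧ ψ₊ = 0, ∗₆ J σ = -σ ∧ ω}` (smooth primitive `(1,1)`-forms). -/
def MemΩ28 (σ : DForm (𝓡 6) M 2) : Prop :=
  IsSmooth σ ∧ σ ⋏ S.ψp = 0 ∧ S.star₂ (S.actJ σ) = -(σ ⋏ S.omega)

/-- `Ω³₁₂ = {γ | γ ∧ ω = 0, γ ∧ ψ₊ = 0, γ ∧ ψ₋ = 0}`. -/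
def MemΩ312 (γ : DForm (𝓡 6) M 3) : Prop :=
  IsSmooth γ ∧ γ ⋏ S.omega = 0 ∧ γ ⋏ S.ψp = 0 ∧ γ ⋏ S.ψm = 0

/-- The torsion forms of an `SU(3)`-structure, i.e. the components of `dω`, `dψ₊`, `dψ₋`. -/
structure TorsionForms where
  σ₀ : M → ℝ
  π₀ : M → ℝ
  π₁ : DForm (𝓡 6) M 1
  ν₁ : DForm (𝓡 6) M 1
  π₂ : DForm (𝓡 6) M 2
  σ₂ : DForm (𝓡 6) M 2
  ν₃ : DForm (𝓡 6) M 3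
  smooth_σ₀ : ContMDiff (𝓡 6) 𝓘(ℝ) ∞ σ₀
  smooth_π₀ : ContMDiff (𝓡 6) 𝓘(ℝ) ∞ π₀
  smooth_π₁ : IsSmooth π₁
  smooth_ν₁ : IsSmooth ν₁
  mem_π₂ : S.MemΩ28 π₂
  mem_σ₂ : S.MemΩ28 σ₂
  mem_ν₃ : S.MemΩ312 ν₃
  d_omega : extD S.omega = (-3 / 2 : ℝ) • (σ₀ •ᶠ S.ψp) + (3 / 2 : ℝ) • (π₀ •ᶠ S.ψm) + ν₁ ⋏ S.omega + ν₃
  d_ψp : extD S.ψp = π₀ •ᶠ (S.omega ⋏ S.omega) + π₁ ⋏ S.ψp - π₂ ⋏ S.omega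
  d_ψm : extD S.ψm = σ₀ •ᶠ (S.omega ⋏ S.omega) + π₁ ⋏ S.ψm - σ₂ ⋏ S.omega

end SU3Structure

/-- A `G₂`-structure on a smooth manifold (necessarily of dimension `7`): a smooth `3`-form `φ`
with the standard expression in suitable coframes, together with the metric and the volume form
that `φ` determines, namely those for which the adapted coframes are orthonormal and positive. -/
structure G2Structure {E : Type*} [NormedAddCommGroup E] [NormedSpace ℝ E] {H : Type*}
    [TopologicalSpace H] (I : ModelWithCorners ℝ E H) (N : Type*) [TopologicalSpace N]
    [ChartedSpace H N] [IsManifold I ∞ N] where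
  φ : DForm I N 3
  g : Metric I N
  vol : DForm I N 7
  smooth_φ : IsSmooth φ
  exists_coframe : ∀ x, ∃ e : Fin 7 → TangentSpace I x →L[ℝ] ℝ,
    IsG2Coframe (g.inner x) (vol x) (φ x) e

namespace G2Structure

variable {E : Type*} [NormedAddCommGroup E] [NormedSpace ℝ E] [FiniteDimensional ℝ E]
  {H : Type*} [TopologicalSpace H] {I : ModelWithCorners ℝ E H} {N : Type*} [TopologicalSpace N]
  [ChartedSpace H N] [IsManifold I ∞ N] (G : G2Structure I N)

/-- The Hodge star `∗₇` of the `G₂`-structure from `3`-forms to `4`-forms. -/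
def star₃ (η : DForm I N 3) : DForm I N 4 :=
  hodgeStar (k := 3) 4 (fun x => G.g.inner x) G.vol η

/-- The Hodge star `∗₇` of the `G₂`-structure from `4`-forms to `3`-forms. -/
def star₄ (η : DForm I N 4) : DForm I N 3 :=
  hodgeStar (k := 4) 3 (fun x => G.g.inner x) G.vol η

/-- The Hodge star `∗₇` of the `G₂`-structure from `5`-forms to `2`-forms. -/
def star₅ (η : DForm I N 5) : DForm I N 2 :=
  hodgeStar (k := 5) 2 (fun x => G.g.inner x) G.vol η

/-- The Hodge Laplacian `Δ₇ = ∗₇ d₇ ∗₇ d₇ - d₇ ∗₇ d₇ ∗₇` on `3`-forms. -/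
def laplacian (η : DForm I N 3) : DForm I N 3 :=
  G.star₄ (extD (G.star₄ (extD η))) - extD (G.star₅ (extD (G.star₃ η)))

end G2Structure

/-- The `1`-form `ds` on the unit circle, `s` the angular coordinate `z = e^{is}`:
`ds = Im (z̄ dz)`. -/
def dθ : DForm (𝓡 1) Circle 1 := fun z =>
  covector ((Complex.imCLM ∘L ContinuousLinearMap.mul ℝ ℂ (starRingEnd ℂ (z : ℂ))) ∘L
    (mfderiv (𝓡 1) 𝓘(ℝ, ℂ) (fun w : Circle => (w : ℂ)) z))

section Product

variable {M : Type*} [TopologicalSpace M] [ChartedSpace (EuclideanSpace ℝ (Fin 6)) M]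

/-- Pullback of a form on `M` to `M × S¹`. -/
def lift {k : ℕ} (η : DForm (𝓡 6) M k) : DForm ((𝓡 6).prod (𝓡 1)) (M × Circle) k :=
  pullback (Prod.fst : M × Circle → M) η

variable (M) in
/-- The `1`-form `ds` on `M × S¹`. -/
def ds : DForm ((𝓡 6).prod (𝓡 1)) (M × Circle) 1 :=
  pullback (Prod.snd : M × Circle → Circle) dθ

/-- `φ = f ω ∧ ds + (α ψ₊ - β ψ₋)`. -/
def warpedForm [IsManifold (𝓡 6) ∞ M] (S : SU3Structure M) (f : M → ℝ) (α β : ℝ) :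
    DForm ((𝓡 6).prod (𝓡 1)) (M × Circle) 3 :=
  lift (f •ᶠ S.omega) ⋏ ds M + lift (α • S.ψp - β • S.ψm)

end Product

end WarpedG2

end

noncomputable section

namespace WarpedG2

open Equiv in
theorem sum_perm_fin_succ {n : ℕ} {A : Type*} [AddCommMonoid A] (F : Perm (Fin (n + 1)) → A) :
    ∑ σ, F σ = ∑ p : Fin (n + 1), ∑ e : Perm (Fin n),
      F (Perm.decomposeFin.symm (0, e) * Fin.cycleRange p) := by
  rw [← Fintype.sum_prod_type' (f := fun (p : Fin (n + 1)) (e : Perm (Fin n)) =>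
    F (Perm.decomposeFin.symm (0, e) * Fin.cycleRange p))]
  symm
  refine Fintype.sum_bijective (fun x : Fin (n + 1) × Perm (Fin n) =>
    Perm.decomposeFin.symm (0, x.2) * Fin.cycleRange x.1) ?_ _ _ (fun x => rfl)
  rw [Fintype.bijective_iff_injective_and_card]
  refine ⟨?_, by simp [Fintype.card_perm, Nat.factorial_succ]⟩
  rintro ⟨p, e⟩ ⟨q, d⟩ h
  have key : ∀ (p : Fin (n + 1)) (e : Perm (Fin n)),
      (Perm.decomposeFin.symm (0, e) * Fin.cycleRange p)⁻¹ 0 = p := by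
    intro p e
    rw [Perm.inv_eq_iff_eq, Perm.mul_apply, Fin.cycleRange_self, Perm.decomposeFin_symm_apply_zero]
  have hpq : p = q := by
    have := congrArg (fun σ : Perm (Fin (n + 1)) => σ⁻¹ 0) h
    simpa only [key] using this
  subst hpq
  have := mul_right_cancel h
  simpa using this

open Equiv in
theorem cons_comp_perm {n : ℕ} {V : Type*} (u : V) (w : Fin n → V) (p : Fin (n + 1))
    (e : Perm (Fin n)) :
    (Fin.cons u w : Fin (n + 1) → V) ∘ (Perm.decomposeFin.symm (0, e) * Fin.cycleRange p : Perm _) =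
      p.insertNth (α := fun _ => V) u (w ∘ e) := by
  rw [Fin.eq_insertNth_iff]
  constructor
  · simp
  · funext j
    simp [Fin.removeNth, Fin.cycleRange_succAbove, Perm.decomposeFin_symm_apply_succ]

section Pointwise

variable {V : Type*} [AddCommGroup V] [Module ℝ V] [TopologicalSpace V]

/-- Interior product `v ↦ a (u, v)`. -/
def interior {k : ℕ} (u : V) (a : V [⋀^Fin (k + 1)]→L[ℝ] ℝ) : V [⋀^Fin k]→L[ℝ] ℝ where
  toFun v := a (Fin.cons u v)
  map_update_add' := by
    intro inst v i x y
    obtain rfl : inst = instDecidableEqFin k := Subsingleton.elim _ _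
    simp only [Fin.cons_update, a.map_update_add]
  map_update_smul' := by
    intro inst v i c x
    obtain rfl : inst = instDecidableEqFin k := Subsingleton.elim _ _
    simp only [Fin.cons_update, a.map_update_smul]
  map_eq_zero_of_eq' := by
    intro v i j hv hij
    exact a.map_eq_zero_of_eq _ (i := i.succ) (j := j.succ) (by simpa using hv) (by simpa using hij)
  cont := a.cont.comp (by fun_prop)

@[simp] theorem interior_apply {k : ℕ} (u : V) (a : V [⋀^Fin (k + 1)]→L[ℝ] ℝ) (v : Fin k → V) :
    interior u a v = a (Matrix.vecCons u v) := rfl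

theorem wedgeAt_apply {k l : ℕ} (a : V [⋀^Fin k]→L[ℝ] ℝ) (b : V [⋀^Fin l]→L[ℝ] ℝ)
    (v : Fin (k + l) → V) :
    wedgeAt a b v = ((k.factorial : ℝ) * (l.factorial : ℝ))⁻¹ *
      ∑ σ : Equiv.Perm (Fin (k + l)), (Equiv.Perm.sign σ : ℝ) *
        (a (fun i => v (σ (Fin.castAdd l i))) * b (fun j => v (σ (Fin.natAdd k j)))) := by
  simp only [wedgeAt, ContinuousAlternatingMap.smul_apply,
    ContinuousMultilinearMap.alternatization_apply_apply, smul_eq_mul, Units.smul_def,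
    zsmul_eq_mul]
  rfl

theorem map_insertNth {k : ℕ} (a : V [⋀^Fin (k + 1)]→L[ℝ] ℝ) (p : Fin (k + 1)) (u : V)
    (w : Fin k → V) :
    a (p.insertNth (α := fun _ => V) u w) = (-1) ^ (p : ℕ) * a (Matrix.vecCons u w) := by
  have := a.toAlternatingMap.map_insertNth p u w
  simpa [Units.smul_def] using this

/-- The value of `a ∧ b` on `n = k + l` vectors. -/
def wedgeTo {k l n : ℕ} (h : k + l = n) (a : V [⋀^Fin k]→L[ℝ] ℝ) (b : V [⋀^Fin l]→L[ℝ] ℝ)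
    (v : Fin n → V) : ℝ :=
  wedgeAt a b (fun i => v (Fin.cast h i))

theorem wedgeTo_apply {k l n : ℕ} (h : k + l = n) (a : V [⋀^Fin k]→L[ℝ] ℝ)
    (b : V [⋀^Fin l]→L[ℝ] ℝ) (v : Fin n → V) :
    wedgeTo h a b v = ((k.factorial : ℝ) * (l.factorial : ℝ))⁻¹ *
      ∑ σ : Equiv.Perm (Fin n), (Equiv.Perm.sign σ : ℝ) *
        (a (v ∘ σ ∘ Fin.cast h ∘ Fin.castAdd l) * b (v ∘ σ ∘ Fin.cast h ∘ Fin.natAdd k)) := by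
  subst h
  exact wedgeAt_apply a b v

theorem wedgeTo_cons_aux {k l n : ℕ} (h : k + l = n + 1) (a : V [⋀^Fin k]→L[ℝ] ℝ)
    (b : V [⋀^Fin l]→L[ℝ] ℝ) (u : V) (w : Fin n → V) :
    wedgeTo h a b (Fin.cons u w : Fin (n + 1) → V) = ((k.factorial : ℝ) * (l.factorial : ℝ))⁻¹ *
      ((∑ i : Fin k, (-1) ^ (i : ℕ) * ∑ e : Equiv.Perm (Fin n), (Equiv.Perm.sign e : ℝ) *
        (a (((Fin.cast h (Fin.castAdd l i)).insertNth (α := fun _ => V) u (w ∘ e)) ∘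
            Fin.cast h ∘ Fin.castAdd l) *
          b (((Fin.cast h (Fin.castAdd l i)).insertNth (α := fun _ => V) u (w ∘ e)) ∘
            Fin.cast h ∘ Fin.natAdd k))) +
      ∑ j : Fin l, (-1) ^ (k + (j : ℕ)) * ∑ e : Equiv.Perm (Fin n), (Equiv.Perm.sign e : ℝ) *
        (a (((Fin.cast h (Fin.natAdd k j)).insertNth (α := fun _ => V) u (w ∘ e)) ∘
            Fin.cast h ∘ Fin.castAdd l) *
          b (((Fin.cast h (Fin.natAdd k j)).insertNth (α := fun _ => V) u (w ∘ e)) ∘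
            Fin.cast h ∘ Fin.natAdd k))) := by
  rw [wedgeTo_apply, sum_perm_fin_succ]
  congr 1
  have key : ∀ (G : Fin (n + 1) → ℝ), ∑ p, G p =
      ∑ i : Fin k, G (Fin.cast h (Fin.castAdd l i)) +
        ∑ j : Fin l, G (Fin.cast h (Fin.natAdd k j)) := by
    intro G
    rw [← Fin.sum_univ_add (f := fun i => G (Fin.cast h i))]
    exact (Equiv.sum_comp (finCongr h) G).symm
  rw [key]
  congr 1
  all_goals
    refine Finset.sum_congr rfl fun i _ => ?_
    rw [Finset.mul_sum]
    refine Finset.sum_congr rfl fun e _ => ?_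
    simp only [← Function.comp_assoc, cons_comp_perm]
    simp [Fin.sign_cycleRange, Equiv.Perm.decomposeFin.symm_sign]
    ring

theorem sum_left_slots {k l n : ℕ} (h : k + 1 + l = n + 1) (h' : k + l = n)
    (a : V [⋀^Fin (k + 1)]→L[ℝ] ℝ) (b : V [⋀^Fin l]→L[ℝ] ℝ) (u : V) (w : Fin n → V) :
    (((k + 1).factorial : ℝ) * (l.factorial : ℝ))⁻¹ *
      ∑ i : Fin (k + 1), (-1) ^ (i : ℕ) * ∑ e : Equiv.Perm (Fin n), (Equiv.Perm.sign e : ℝ) *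
        (a (((Fin.cast h (Fin.castAdd l i)).insertNth (α := fun _ => V) u (w ∘ e)) ∘
            Fin.cast h ∘ Fin.castAdd l) *
          b (((Fin.cast h (Fin.castAdd l i)).insertNth (α := fun _ => V) u (w ∘ e)) ∘
            Fin.cast h ∘ Fin.natAdd (k + 1))) = wedgeTo h' (interior u a) b w := by
  have h1 : ∀ (i : Fin (k + 1)) (z : Fin n → V),
      ((Fin.cast h (Fin.castAdd l i)).insertNth (α := fun _ => V) u z) ∘
        Fin.cast h ∘ Fin.castAdd l =
      i.insertNth (α := fun _ => V) u (z ∘ Fin.cast h' ∘ Fin.castAdd l) := by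
    intro i z
    rw [Fin.eq_insertNth_iff]
    refine ⟨by simp, ?_⟩
    funext j
    have : Fin.cast h (Fin.castAdd l (i.succAbove j)) =
        (Fin.cast h (Fin.castAdd l i)).succAbove (Fin.cast h' (Fin.castAdd l j)) := by
      ext
      simp [Fin.succAbove, Fin.lt_def]
      split_ifs <;> simp
    simp [Fin.removeNth, this]
  have h2 : ∀ (i : Fin (k + 1)) (z : Fin n → V),
      ((Fin.cast h (Fin.castAdd l i)).insertNth (α := fun _ => V) u z) ∘
        Fin.cast h ∘ Fin.natAdd (k + 1) = z ∘ Fin.cast h' ∘ Fin.natAdd k := by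
    intro i z
    funext j
    have : Fin.cast h (Fin.natAdd (k + 1) j) =
        (Fin.cast h (Fin.castAdd l i)).succAbove (Fin.cast h' (Fin.natAdd k j)) := by
      ext
      have := i.2
      simp [Fin.succAbove, Fin.lt_def]
      split_ifs <;> simp <;> omega
    simp [this]
  have h3 : ∀ i : Fin (k + 1), ((-1 : ℝ) ^ (i : ℕ)) * (-1) ^ (i : ℕ) = 1 := fun i => by
    rw [← mul_pow]; simp
  rw [wedgeTo_apply]
  simp only [h1, h2, map_insertNth]
  have : ∀ i : Fin (k + 1), (-1 : ℝ) ^ (i : ℕ) * ∑ e : Equiv.Perm (Fin n),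
      (Equiv.Perm.sign e : ℝ) *
        ((-1) ^ (i : ℕ) * a (Matrix.vecCons u ((w ∘ e) ∘ Fin.cast h' ∘ Fin.castAdd l)) *
          b ((w ∘ e) ∘ Fin.cast h' ∘ Fin.natAdd k)) =
      ∑ e : Equiv.Perm (Fin n), (Equiv.Perm.sign e : ℝ) *
        (interior u a (w ∘ e ∘ Fin.cast h' ∘ Fin.castAdd l) *
          b (w ∘ e ∘ Fin.cast h' ∘ Fin.natAdd k)) := by
    intro i
    rw [Finset.mul_sum]
    refine Finset.sum_congr rfl fun e _ => ?_
    simp only [interior_apply, Function.comp_assoc]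
    linear_combination ((Equiv.Perm.sign e : ℝ) *
      a (Matrix.vecCons u (w ∘ e ∘ Fin.cast h' ∘ Fin.castAdd l)) *
          b (w ∘ e ∘ Fin.cast h' ∘ Fin.natAdd k)) * h3 i
  simp only [this, Finset.sum_const, Finset.card_univ, Fintype.card_fin, nsmul_eq_mul,
    Nat.factorial_succ, Nat.cast_mul]
  have : ((k + 1 : ℕ) : ℝ) ≠ 0 := by positivity
  field_simp

theorem sum_right_slots {k l n : ℕ} (h : k + (l + 1) = n + 1) (h' : k + l = n)
    (a : V [⋀^Fin k]→L[ℝ] ℝ) (b : V [⋀^Fin (l + 1)]→L[ℝ] ℝ) (u : V) (w : Fin n → V) :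
    ((k.factorial : ℝ) * ((l + 1).factorial : ℝ))⁻¹ *
      ∑ j : Fin (l + 1), (-1) ^ (k + (j : ℕ)) * ∑ e : Equiv.Perm (Fin n),
        (Equiv.Perm.sign e : ℝ) *
        (a (((Fin.cast h (Fin.natAdd k j)).insertNth (α := fun _ => V) u (w ∘ e)) ∘
            Fin.cast h ∘ Fin.castAdd (l + 1)) *
          b (((Fin.cast h (Fin.natAdd k j)).insertNth (α := fun _ => V) u (w ∘ e)) ∘
            Fin.cast h ∘ Fin.natAdd k)) = (-1) ^ k * wedgeTo h' a (interior u b) w := by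
  have h1 : ∀ (i : Fin (l + 1)) (z : Fin n → V),
      ((Fin.cast h (Fin.natAdd k i)).insertNth (α := fun _ => V) u z) ∘
        Fin.cast h ∘ Fin.natAdd k =
      i.insertNth (α := fun _ => V) u (z ∘ Fin.cast h' ∘ Fin.natAdd k) := by
    intro i z
    rw [Fin.eq_insertNth_iff]
    refine ⟨by simp, ?_⟩
    funext j
    have : Fin.cast h (Fin.natAdd k (i.succAbove j)) =
        (Fin.cast h (Fin.natAdd k i)).succAbove (Fin.cast h' (Fin.natAdd k j)) := by
      ext
      simp [Fin.succAbove, Fin.lt_def]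
      split_ifs <;> simp; omega
    simp [Fin.removeNth, this]
  have h2 : ∀ (i : Fin (l + 1)) (z : Fin n → V),
      ((Fin.cast h (Fin.natAdd k i)).insertNth (α := fun _ => V) u z) ∘
        Fin.cast h ∘ Fin.castAdd (l + 1) = z ∘ Fin.cast h' ∘ Fin.castAdd l := by
    intro i z
    funext j
    have : Fin.cast h (Fin.castAdd (l + 1) j) =
        (Fin.cast h (Fin.natAdd k i)).succAbove (Fin.cast h' (Fin.castAdd l j)) := by
      ext
      have := j.2
      simp [Fin.succAbove, Fin.lt_def]
      split_ifs <;> simp; omega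
    simp [this]
  have h3 : ∀ i : Fin (l + 1), ((-1 : ℝ) ^ (i : ℕ)) * (-1) ^ (i : ℕ) = 1 := fun i => by
    rw [← mul_pow]; simp
  rw [wedgeTo_apply]
  simp only [h1, h2, map_insertNth]
  have : ∀ i : Fin (l + 1), (-1 : ℝ) ^ (k + (i : ℕ)) * ∑ e : Equiv.Perm (Fin n),
      (Equiv.Perm.sign e : ℝ) *
        (a ((w ∘ e) ∘ Fin.cast h' ∘ Fin.castAdd l) *
        ((-1) ^ (i : ℕ) * b (Matrix.vecCons u ((w ∘ e) ∘ Fin.cast h' ∘ Fin.natAdd k)))) =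
      (-1) ^ k * ∑ e : Equiv.Perm (Fin n), (Equiv.Perm.sign e : ℝ) *
        (a (w ∘ e ∘ Fin.cast h' ∘ Fin.castAdd l) *
          interior u b (w ∘ e ∘ Fin.cast h' ∘ Fin.natAdd k)) := by
    intro i
    rw [Finset.mul_sum, Finset.mul_sum]
    refine Finset.sum_congr rfl fun e _ => ?_
    simp only [interior_apply, Function.comp_assoc, pow_add]
    linear_combination ((-1) ^ k * (Equiv.Perm.sign e : ℝ) *
      a (w ∘ e ∘ Fin.cast h' ∘ Fin.castAdd l) *
          b (Matrix.vecCons u (w ∘ e ∘ Fin.cast h' ∘ Fin.natAdd k))) * h3 i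
  simp only [this, Finset.sum_const, Finset.card_univ, Fintype.card_fin, nsmul_eq_mul,
    Nat.factorial_succ, Nat.cast_mul]
  have : ((l + 1 : ℕ) : ℝ) ≠ 0 := by positivity
  field_simp

/-- The interior product is an antiderivation. -/
theorem wedgeTo_cons {k l n : ℕ} (h : k + 1 + (l + 1) = n + 1) (h₁ : k + (l + 1) = n)
    (h₂ : k + 1 + l = n) (a : V [⋀^Fin (k + 1)]→L[ℝ] ℝ) (b : V [⋀^Fin (l + 1)]→L[ℝ] ℝ) (u : V)
    (w : Fin n → V) :
    wedgeTo h a b (Matrix.vecCons u w) =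
      wedgeTo h₁ (interior u a) b w + (-1) ^ (k + 1) * wedgeTo h₂ a (interior u b) w := by
  rw [← sum_left_slots h h₁, ← sum_right_slots h h₂, ← mul_add]
  exact wedgeTo_cons_aux h a b u w

theorem wedgeTo_cons_right {l n : ℕ} (h : 0 + (l + 1) = n + 1)
    (h₂ : 0 + l = n) (a : V [⋀^Fin 0]→L[ℝ] ℝ) (b : V [⋀^Fin (l + 1)]→L[ℝ] ℝ) (u : V)
    (w : Fin n → V) :
    wedgeTo h a b (Matrix.vecCons u w) = wedgeTo h₂ a (interior u b) w := by
  have := sum_right_slots h h₂ a b u w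
  rw [pow_zero, one_mul] at this
  rw [← this]
  refine (wedgeTo_cons_aux h a b u w).trans ?_
  simp

theorem wedgeTo_cons_left {k n : ℕ} (h : k + 1 + 0 = n + 1)
    (h₁ : k + 0 = n) (a : V [⋀^Fin (k + 1)]→L[ℝ] ℝ) (b : V [⋀^Fin 0]→L[ℝ] ℝ) (u : V)
    (w : Fin n → V) :
    wedgeTo h a b (Matrix.vecCons u w) = wedgeTo h₁ (interior u a) b w := by
  rw [← sum_left_slots h h₁]
  refine (wedgeTo_cons_aux h a b u w).trans ?_
  simp

theorem wedgeTo_zero (h : 0 + 0 = 0) (a b : V [⋀^Fin 0]→L[ℝ] ℝ) (v : Fin 0 → V) :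
    wedgeTo h a b v = a ![] * b ![] := by
  rw [wedgeTo_apply]
  simp [Subsingleton.elim _ (![] : Fin 0 → V)]

end Pointwise

section Pointwise

variable {V : Type*} [AddCommGroup V] [Module ℝ V] [TopologicalSpace V]

theorem wedgeAt_eq_wedgeTo {k l : ℕ} (a : V [⋀^Fin k]→L[ℝ] ℝ) (b : V [⋀^Fin l]→L[ℝ] ℝ)
    (v : Fin (k + l) → V) : wedgeAt a b v = wedgeTo rfl a b v := rfl

/-- The wedge product `a ∧ b` as a form of degree `n = k + l`. -/
def wedgeOf {k l n : ℕ} (h : k + l = n) (a : V [⋀^Fin k]→L[ℝ] ℝ) (b : V [⋀^Fin l]→L[ℝ] ℝ) :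
    V [⋀^Fin n]→L[ℝ] ℝ :=
  h ▸ wedgeAt a b

theorem wedgeOf_apply {k l n : ℕ} (h : k + l = n) (a : V [⋀^Fin k]→L[ℝ] ℝ)
    (b : V [⋀^Fin l]→L[ℝ] ℝ) (v : Fin n → V) : wedgeOf h a b v = wedgeTo h a b v := by
  subst h; rfl

theorem wedgeTo_degree_zero_right {k : ℕ} (a : V [⋀^Fin k]→L[ℝ] ℝ) (b : V [⋀^Fin 0]→L[ℝ] ℝ)
    (h : k + 0 = k) (v : Fin k → V) : wedgeTo h a b v = a v * b ![] := by
  induction k with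
  | zero => rw [wedgeTo_zero, Subsingleton.elim v ![]]
  | succ k ih =>
    obtain ⟨u, w, rfl⟩ : ∃ u w, v = Matrix.vecCons u w :=
      ⟨v 0, Fin.tail v, (Fin.cons_self_tail v).symm⟩
    rw [wedgeTo_cons_left _ (Nat.add_zero k), ih, interior_apply]

theorem wedgeTo_degree_zero_left {l : ℕ} (a : V [⋀^Fin 0]→L[ℝ] ℝ) (b : V [⋀^Fin l]→L[ℝ] ℝ)
    (h : 0 + l = l) (v : Fin l → V) : wedgeTo h a b v = a ![] * b v := by
  induction l with
  | zero => rw [wedgeTo_zero, Subsingleton.elim v ![]]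
  | succ l ih =>
    obtain ⟨u, w, rfl⟩ : ∃ u w, v = Matrix.vecCons u w :=
      ⟨v 0, Fin.tail v, (Fin.cons_self_tail v).symm⟩
    rw [wedgeTo_cons_right _ (Nat.zero_add l), ih, interior_apply]

theorem wedgeTo_one_one (h : 1 + 1 = 2) (a : V [⋀^Fin 1]→L[ℝ] ℝ)
    (b : V [⋀^Fin 1]→L[ℝ] ℝ) (x₁ x₂ : V) :
    wedgeTo h a b ![x₁, x₂] =
    a ![x₁] * b ![x₂] - a ![x₂] * b ![x₁] := by
  rw [wedgeTo_cons (k := 0) (l := 0) (n := 1) h rfl rfl, wedgeTo_degree_zero_left,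
    wedgeTo_degree_zero_right]
  simp only [interior_apply, Nat.reduceAdd, pow_succ, pow_zero]
  ring

theorem wedgeAt_one_one (a : V [⋀^Fin 1]→L[ℝ] ℝ) (b : V [⋀^Fin 1]→L[ℝ] ℝ)
    (x₁ x₂ : V) :
    wedgeAt a b ![x₁, x₂] =
    a ![x₁] * b ![x₂] - a ![x₂] * b ![x₁] := by
  rw [wedgeAt_eq_wedgeTo, wedgeTo_one_one]

theorem wedgeTo_two_one (h : 2 + 1 = 3) (a : V [⋀^Fin 2]→L[ℝ] ℝ)
    (b : V [⋀^Fin 1]→L[ℝ] ℝ) (x₁ x₂ x₃ : V) :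
    wedgeTo h a b ![x₁, x₂, x₃] =
    a ![x₁, x₂] * b ![x₃] - a ![x₁, x₃] * b ![x₂] + a ![x₂, x₃] * b ![x₁] := by
  rw [wedgeTo_cons (k := 1) (l := 0) (n := 2) h rfl rfl, wedgeTo_one_one,
    wedgeTo_degree_zero_right]
  simp only [interior_apply, Nat.reduceAdd, pow_succ, pow_zero]
  ring

theorem wedgeAt_two_one (a : V [⋀^Fin 2]→L[ℝ] ℝ) (b : V [⋀^Fin 1]→L[ℝ] ℝ)
    (x₁ x₂ x₃ : V) :
    wedgeAt a b ![x₁, x₂, x₃] =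
    a ![x₁, x₂] * b ![x₃] - a ![x₁, x₃] * b ![x₂] + a ![x₂, x₃] * b ![x₁] := by
  rw [wedgeAt_eq_wedgeTo, wedgeTo_two_one]

theorem wedgeTo_one_two (h : 1 + 2 = 3) (a : V [⋀^Fin 1]→L[ℝ] ℝ)
    (b : V [⋀^Fin 2]→L[ℝ] ℝ) (x₁ x₂ x₃ : V) :
    wedgeTo h a b ![x₁, x₂, x₃] =
    a ![x₁] * b ![x₂, x₃] - a ![x₂] * b ![x₁, x₃] + a ![x₃] * b ![x₁, x₂] := by
  rw [wedgeTo_cons (k := 0) (l := 1) (n := 2) h rfl rfl, wedgeTo_degree_zero_left,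
    wedgeTo_one_one]
  simp only [interior_apply, Nat.reduceAdd, pow_succ, pow_zero]
  ring

theorem wedgeAt_one_two (a : V [⋀^Fin 1]→L[ℝ] ℝ) (b : V [⋀^Fin 2]→L[ℝ] ℝ)
    (x₁ x₂ x₃ : V) :
    wedgeAt a b ![x₁, x₂, x₃] =
    a ![x₁] * b ![x₂, x₃] - a ![x₂] * b ![x₁, x₃] + a ![x₃] * b ![x₁, x₂] := by
  rw [wedgeAt_eq_wedgeTo, wedgeTo_one_two]

theorem wedgeTo_three_one (h : 3 + 1 = 4) (a : V [⋀^Fin 3]→L[ℝ] ℝ)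
    (b : V [⋀^Fin 1]→L[ℝ] ℝ) (x₁ x₂ x₃ x₄ : V) :
    wedgeTo h a b ![x₁, x₂, x₃, x₄] =
    a ![x₁, x₂, x₃] * b ![x₄] - a ![x₁, x₂, x₄] * b ![x₃] + a ![x₁, x₃, x₄] * b ![x₂]
      - a ![x₂, x₃, x₄] * b ![x₁] := by
  rw [wedgeTo_cons (k := 2) (l := 0) (n := 3) h rfl rfl, wedgeTo_two_one,
    wedgeTo_degree_zero_right]
  simp only [interior_apply, Nat.reduceAdd, pow_succ, pow_zero]
  ring

theorem wedgeAt_three_one (a : V [⋀^Fin 3]→L[ℝ] ℝ) (b : V [⋀^Fin 1]→L[ℝ] ℝ)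
    (x₁ x₂ x₃ x₄ : V) :
    wedgeAt a b ![x₁, x₂, x₃, x₄] =
    a ![x₁, x₂, x₃] * b ![x₄] - a ![x₁, x₂, x₄] * b ![x₃] + a ![x₁, x₃, x₄] * b ![x₂]
      - a ![x₂, x₃, x₄] * b ![x₁] := by
  rw [wedgeAt_eq_wedgeTo, wedgeTo_three_one]

theorem wedgeTo_two_two (h : 2 + 2 = 4) (a : V [⋀^Fin 2]→L[ℝ] ℝ)
    (b : V [⋀^Fin 2]→L[ℝ] ℝ) (x₁ x₂ x₃ x₄ : V) :
    wedgeTo h a b ![x₁, x₂, x₃, x₄] =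
    a ![x₁, x₂] * b ![x₃, x₄] - a ![x₁, x₃] * b ![x₂, x₄] + a ![x₁, x₄] * b ![x₂, x₃]
      + a ![x₂, x₃] * b ![x₁, x₄] - a ![x₂, x₄] * b ![x₁, x₃] + a ![x₃, x₄] * b ![x₁, x₂] := by
  rw [wedgeTo_cons (k := 1) (l := 1) (n := 3) h rfl rfl, wedgeTo_one_two,
    wedgeTo_two_one]
  simp only [interior_apply, Nat.reduceAdd, pow_succ, pow_zero]
  ring

theorem wedgeAt_two_two (a : V [⋀^Fin 2]→L[ℝ] ℝ) (b : V [⋀^Fin 2]→L[ℝ] ℝ)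
    (x₁ x₂ x₃ x₄ : V) :
    wedgeAt a b ![x₁, x₂, x₃, x₄] =
    a ![x₁, x₂] * b ![x₃, x₄] - a ![x₁, x₃] * b ![x₂, x₄] + a ![x₁, x₄] * b ![x₂, x₃]
      + a ![x₂, x₃] * b ![x₁, x₄] - a ![x₂, x₄] * b ![x₁, x₃] + a ![x₃, x₄] * b ![x₁, x₂] := by
  rw [wedgeAt_eq_wedgeTo, wedgeTo_two_two]

theorem wedgeTo_one_three (h : 1 + 3 = 4) (a : V [⋀^Fin 1]→L[ℝ] ℝ)
    (b : V [⋀^Fin 3]→L[ℝ] ℝ) (x₁ x₂ x₃ x₄ : V) :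
    wedgeTo h a b ![x₁, x₂, x₃, x₄] =
    a ![x₁] * b ![x₂, x₃, x₄] - a ![x₂] * b ![x₁, x₃, x₄] + a ![x₃] * b ![x₁, x₂, x₄]
      - a ![x₄] * b ![x₁, x₂, x₃] := by
  rw [wedgeTo_cons (k := 0) (l := 2) (n := 3) h rfl rfl, wedgeTo_degree_zero_left,
    wedgeTo_one_two]
  simp only [interior_apply, Nat.reduceAdd, pow_succ, pow_zero]
  ring

theorem wedgeAt_one_three (a : V [⋀^Fin 1]→L[ℝ] ℝ) (b : V [⋀^Fin 3]→L[ℝ] ℝ)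
    (x₁ x₂ x₃ x₄ : V) :
    wedgeAt a b ![x₁, x₂, x₃, x₄] =
    a ![x₁] * b ![x₂, x₃, x₄] - a ![x₂] * b ![x₁, x₃, x₄] + a ![x₃] * b ![x₁, x₂, x₄]
      - a ![x₄] * b ![x₁, x₂, x₃] := by
  rw [wedgeAt_eq_wedgeTo, wedgeTo_one_three]

theorem wedgeTo_four_one (h : 4 + 1 = 5) (a : V [⋀^Fin 4]→L[ℝ] ℝ)
    (b : V [⋀^Fin 1]→L[ℝ] ℝ) (x₁ x₂ x₃ x₄ x₅ : V) :
    wedgeTo h a b ![x₁, x₂, x₃, x₄, x₅] =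
    a ![x₁, x₂, x₃, x₄] * b ![x₅] - a ![x₁, x₂, x₃, x₅] * b ![x₄] + a ![x₁, x₂, x₄, x₅] * b ![x₃]
      - a ![x₁, x₃, x₄, x₅] * b ![x₂] + a ![x₂, x₃, x₄, x₅] * b ![x₁] := by
  rw [wedgeTo_cons (k := 3) (l := 0) (n := 4) h rfl rfl, wedgeTo_three_one,
    wedgeTo_degree_zero_right]
  simp only [interior_apply, Nat.reduceAdd, pow_succ, pow_zero]
  ring

theorem wedgeAt_four_one (a : V [⋀^Fin 4]→L[ℝ] ℝ) (b : V [⋀^Fin 1]→L[ℝ] ℝ)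
    (x₁ x₂ x₃ x₄ x₅ : V) :
    wedgeAt a b ![x₁, x₂, x₃, x₄, x₅] =
    a ![x₁, x₂, x₃, x₄] * b ![x₅] - a ![x₁, x₂, x₃, x₅] * b ![x₄] + a ![x₁, x₂, x₄, x₅] * b ![x₃]
      - a ![x₁, x₃, x₄, x₅] * b ![x₂] + a ![x₂, x₃, x₄, x₅] * b ![x₁] := by
  rw [wedgeAt_eq_wedgeTo, wedgeTo_four_one]

theorem wedgeTo_three_two (h : 3 + 2 = 5) (a : V [⋀^Fin 3]→L[ℝ] ℝ)
    (b : V [⋀^Fin 2]→L[ℝ] ℝ) (x₁ x₂ x₃ x₄ x₅ : V) :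
    wedgeTo h a b ![x₁, x₂, x₃, x₄, x₅] =
    a ![x₁, x₂, x₃] * b ![x₄, x₅] - a ![x₁, x₂, x₄] * b ![x₃, x₅] + a ![x₁, x₂, x₅] * b ![x₃, x₄]
      + a ![x₁, x₃, x₄] * b ![x₂, x₅] - a ![x₁, x₃, x₅] * b ![x₂, x₄]
      + a ![x₁, x₄, x₅] * b ![x₂, x₃] - a ![x₂, x₃, x₄] * b ![x₁, x₅]
      + a ![x₂, x₃, x₅] * b ![x₁, x₄] - a ![x₂, x₄, x₅] * b ![x₁, x₃]
      + a ![x₃, x₄, x₅] * b ![x₁, x₂] := by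
  rw [wedgeTo_cons (k := 2) (l := 1) (n := 4) h rfl rfl, wedgeTo_two_two,
    wedgeTo_three_one]
  simp only [interior_apply, Nat.reduceAdd, pow_succ, pow_zero]
  ring

theorem wedgeAt_three_two (a : V [⋀^Fin 3]→L[ℝ] ℝ) (b : V [⋀^Fin 2]→L[ℝ] ℝ)
    (x₁ x₂ x₃ x₄ x₅ : V) :
    wedgeAt a b ![x₁, x₂, x₃, x₄, x₅] =
    a ![x₁, x₂, x₃] * b ![x₄, x₅] - a ![x₁, x₂, x₄] * b ![x₃, x₅] + a ![x₁, x₂, x₅] * b ![x₃, x₄]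
      + a ![x₁, x₃, x₄] * b ![x₂, x₅] - a ![x₁, x₃, x₅] * b ![x₂, x₄]
      + a ![x₁, x₄, x₅] * b ![x₂, x₃] - a ![x₂, x₃, x₄] * b ![x₁, x₅]
      + a ![x₂, x₃, x₅] * b ![x₁, x₄] - a ![x₂, x₄, x₅] * b ![x₁, x₃]
      + a ![x₃, x₄, x₅] * b ![x₁, x₂] := by
  rw [wedgeAt_eq_wedgeTo, wedgeTo_three_two]

theorem wedgeTo_two_three (h : 2 + 3 = 5) (a : V [⋀^Fin 2]→L[ℝ] ℝ)
    (b : V [⋀^Fin 3]→L[ℝ] ℝ) (x₁ x₂ x₃ x₄ x₅ : V) :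
    wedgeTo h a b ![x₁, x₂, x₃, x₄, x₅] =
    a ![x₁, x₂] * b ![x₃, x₄, x₅] - a ![x₁, x₃] * b ![x₂, x₄, x₅] + a ![x₁, x₄] * b ![x₂, x₃, x₅]
      - a ![x₁, x₅] * b ![x₂, x₃, x₄] + a ![x₂, x₃] * b ![x₁, x₄, x₅]
      - a ![x₂, x₄] * b ![x₁, x₃, x₅] + a ![x₂, x₅] * b ![x₁, x₃, x₄]
      + a ![x₃, x₄] * b ![x₁, x₂, x₅] - a ![x₃, x₅] * b ![x₁, x₂, x₄]
      + a ![x₄, x₅] * b ![x₁, x₂, x₃] := by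
  rw [wedgeTo_cons (k := 1) (l := 2) (n := 4) h rfl rfl, wedgeTo_one_three,
    wedgeTo_two_two]
  simp only [interior_apply, Nat.reduceAdd, pow_succ, pow_zero]
  ring

theorem wedgeAt_two_three (a : V [⋀^Fin 2]→L[ℝ] ℝ) (b : V [⋀^Fin 3]→L[ℝ] ℝ)
    (x₁ x₂ x₃ x₄ x₅ : V) :
    wedgeAt a b ![x₁, x₂, x₃, x₄, x₅] =
    a ![x₁, x₂] * b ![x₃, x₄, x₅] - a ![x₁, x₃] * b ![x₂, x₄, x₅] + a ![x₁, x₄] * b ![x₂, x₃, x₅]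
      - a ![x₁, x₅] * b ![x₂, x₃, x₄] + a ![x₂, x₃] * b ![x₁, x₄, x₅]
      - a ![x₂, x₄] * b ![x₁, x₃, x₅] + a ![x₂, x₅] * b ![x₁, x₃, x₄]
      + a ![x₃, x₄] * b ![x₁, x₂, x₅] - a ![x₃, x₅] * b ![x₁, x₂, x₄]
      + a ![x₄, x₅] * b ![x₁, x₂, x₃] := by
  rw [wedgeAt_eq_wedgeTo, wedgeTo_two_three]

theorem wedgeTo_one_four (h : 1 + 4 = 5) (a : V [⋀^Fin 1]→L[ℝ] ℝ)
    (b : V [⋀^Fin 4]→L[ℝ] ℝ) (x₁ x₂ x₃ x₄ x₅ : V) :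
    wedgeTo h a b ![x₁, x₂, x₃, x₄, x₅] =
    a ![x₁] * b ![x₂, x₃, x₄, x₅] - a ![x₂] * b ![x₁, x₃, x₄, x₅] + a ![x₃] * b ![x₁, x₂, x₄, x₅]
      - a ![x₄] * b ![x₁, x₂, x₃, x₅] + a ![x₅] * b ![x₁, x₂, x₃, x₄] := by
  rw [wedgeTo_cons (k := 0) (l := 3) (n := 4) h rfl rfl, wedgeTo_degree_zero_left,
    wedgeTo_one_three]
  simp only [interior_apply, Nat.reduceAdd, pow_succ, pow_zero]
  ring

theorem wedgeAt_one_four (a : V [⋀^Fin 1]→L[ℝ] ℝ) (b : V [⋀^Fin 4]→L[ℝ] ℝ)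
    (x₁ x₂ x₃ x₄ x₅ : V) :
    wedgeAt a b ![x₁, x₂, x₃, x₄, x₅] =
    a ![x₁] * b ![x₂, x₃, x₄, x₅] - a ![x₂] * b ![x₁, x₃, x₄, x₅] + a ![x₃] * b ![x₁, x₂, x₄, x₅]
      - a ![x₄] * b ![x₁, x₂, x₃, x₅] + a ![x₅] * b ![x₁, x₂, x₃, x₄] := by
  rw [wedgeAt_eq_wedgeTo, wedgeTo_one_four]

theorem wedgeTo_five_one (h : 5 + 1 = 6) (a : V [⋀^Fin 5]→L[ℝ] ℝ)
    (b : V [⋀^Fin 1]→L[ℝ] ℝ) (x₁ x₂ x₃ x₄ x₅ x₆ : V) :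
    wedgeTo h a b ![x₁, x₂, x₃, x₄, x₅, x₆] =
    a ![x₁, x₂, x₃, x₄, x₅] * b ![x₆] - a ![x₁, x₂, x₃, x₄, x₆] * b ![x₅]
      + a ![x₁, x₂, x₃, x₅, x₆] * b ![x₄] - a ![x₁, x₂, x₄, x₅, x₆] * b ![x₃]
      + a ![x₁, x₃, x₄, x₅, x₆] * b ![x₂] - a ![x₂, x₃, x₄, x₅, x₆] * b ![x₁] := by
  rw [wedgeTo_cons (k := 4) (l := 0) (n := 5) h rfl rfl, wedgeTo_four_one,
    wedgeTo_degree_zero_right]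
  simp only [interior_apply, Nat.reduceAdd, pow_succ, pow_zero]
  ring

theorem wedgeTo_four_two (h : 4 + 2 = 6) (a : V [⋀^Fin 4]→L[ℝ] ℝ)
    (b : V [⋀^Fin 2]→L[ℝ] ℝ) (x₁ x₂ x₃ x₄ x₅ x₆ : V) :
    wedgeTo h a b ![x₁, x₂, x₃, x₄, x₅, x₆] =
    a ![x₁, x₂, x₃, x₄] * b ![x₅, x₆] - a ![x₁, x₂, x₃, x₅] * b ![x₄, x₆]
      + a ![x₁, x₂, x₃, x₆] * b ![x₄, x₅] + a ![x₁, x₂, x₄, x₅] * b ![x₃, x₆]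
      - a ![x₁, x₂, x₄, x₆] * b ![x₃, x₅] + a ![x₁, x₂, x₅, x₆] * b ![x₃, x₄]
      - a ![x₁, x₃, x₄, x₅] * b ![x₂, x₆] + a ![x₁, x₃, x₄, x₆] * b ![x₂, x₅]
      - a ![x₁, x₃, x₅, x₆] * b ![x₂, x₄] + a ![x₁, x₄, x₅, x₆] * b ![x₂, x₃]
      + a ![x₂, x₃, x₄, x₅] * b ![x₁, x₆] - a ![x₂, x₃, x₄, x₆] * b ![x₁, x₅]
      + a ![x₂, x₃, x₅, x₆] * b ![x₁, x₄] - a ![x₂, x₄, x₅, x₆] * b ![x₁, x₃]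
      + a ![x₃, x₄, x₅, x₆] * b ![x₁, x₂] := by
  rw [wedgeTo_cons (k := 3) (l := 1) (n := 5) h rfl rfl, wedgeTo_three_two,
    wedgeTo_four_one]
  simp only [interior_apply, Nat.reduceAdd, pow_succ, pow_zero]
  ring

theorem wedgeTo_three_three (h : 3 + 3 = 6) (a : V [⋀^Fin 3]→L[ℝ] ℝ)
    (b : V [⋀^Fin 3]→L[ℝ] ℝ) (x₁ x₂ x₃ x₄ x₅ x₆ : V) :
    wedgeTo h a b ![x₁, x₂, x₃, x₄, x₅, x₆] =
    a ![x₁, x₂, x₃] * b ![x₄, x₅, x₆] - a ![x₁, x₂, x₄] * b ![x₃, x₅, x₆]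
      + a ![x₁, x₂, x₅] * b ![x₃, x₄, x₆] - a ![x₁, x₂, x₆] * b ![x₃, x₄, x₅]
      + a ![x₁, x₃, x₄] * b ![x₂, x₅, x₆] - a ![x₁, x₃, x₅] * b ![x₂, x₄, x₆]
      + a ![x₁, x₃, x₆] * b ![x₂, x₄, x₅] + a ![x₁, x₄, x₅] * b ![x₂, x₃, x₆]
      - a ![x₁, x₄, x₆] * b ![x₂, x₃, x₅] + a ![x₁, x₅, x₆] * b ![x₂, x₃, x₄]
      - a ![x₂, x₃, x₄] * b ![x₁, x₅, x₆] + a ![x₂, x₃, x₅] * b ![x₁, x₄, x₆]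
      - a ![x₂, x₃, x₆] * b ![x₁, x₄, x₅] - a ![x₂, x₄, x₅] * b ![x₁, x₃, x₆]
      + a ![x₂, x₄, x₆] * b ![x₁, x₃, x₅] - a ![x₂, x₅, x₆] * b ![x₁, x₃, x₄]
      + a ![x₃, x₄, x₅] * b ![x₁, x₂, x₆] - a ![x₃, x₄, x₆] * b ![x₁, x₂, x₅]
      + a ![x₃, x₅, x₆] * b ![x₁, x₂, x₄] - a ![x₄, x₅, x₆] * b ![x₁, x₂, x₃] := by
  rw [wedgeTo_cons (k := 2) (l := 2) (n := 5) h rfl rfl, wedgeTo_two_three,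
    wedgeTo_three_two]
  simp only [interior_apply, Nat.reduceAdd, pow_succ, pow_zero]
  ring

theorem wedgeAt_three_three (a : V [⋀^Fin 3]→L[ℝ] ℝ) (b : V [⋀^Fin 3]→L[ℝ] ℝ)
    (x₁ x₂ x₃ x₄ x₅ x₆ : V) :
    wedgeAt a b ![x₁, x₂, x₃, x₄, x₅, x₆] =
    a ![x₁, x₂, x₃] * b ![x₄, x₅, x₆] - a ![x₁, x₂, x₄] * b ![x₃, x₅, x₆]
      + a ![x₁, x₂, x₅] * b ![x₃, x₄, x₆] - a ![x₁, x₂, x₆] * b ![x₃, x₄, x₅]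
      + a ![x₁, x₃, x₄] * b ![x₂, x₅, x₆] - a ![x₁, x₃, x₅] * b ![x₂, x₄, x₆]
      + a ![x₁, x₃, x₆] * b ![x₂, x₄, x₅] + a ![x₁, x₄, x₅] * b ![x₂, x₃, x₆]
      - a ![x₁, x₄, x₆] * b ![x₂, x₃, x₅] + a ![x₁, x₅, x₆] * b ![x₂, x₃, x₄]
      - a ![x₂, x₃, x₄] * b ![x₁, x₅, x₆] + a ![x₂, x₃, x₅] * b ![x₁, x₄, x₆]
      - a ![x₂, x₃, x₆] * b ![x₁, x₄, x₅] - a ![x₂, x₄, x₅] * b ![x₁, x₃, x₆]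
      + a ![x₂, x₄, x₆] * b ![x₁, x₃, x₅] - a ![x₂, x₅, x₆] * b ![x₁, x₃, x₄]
      + a ![x₃, x₄, x₅] * b ![x₁, x₂, x₆] - a ![x₃, x₄, x₆] * b ![x₁, x₂, x₅]
      + a ![x₃, x₅, x₆] * b ![x₁, x₂, x₄] - a ![x₄, x₅, x₆] * b ![x₁, x₂, x₃] := by
  rw [wedgeAt_eq_wedgeTo, wedgeTo_three_three]

theorem wedgeTo_six_one (h : 6 + 1 = 7) (a : V [⋀^Fin 6]→L[ℝ] ℝ)
    (b : V [⋀^Fin 1]→L[ℝ] ℝ) (x₁ x₂ x₃ x₄ x₅ x₆ x₇ : V) :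
    wedgeTo h a b ![x₁, x₂, x₃, x₄, x₅, x₆, x₇] =
    a ![x₁, x₂, x₃, x₄, x₅, x₆] * b ![x₇] - a ![x₁, x₂, x₃, x₄, x₅, x₇] * b ![x₆]
      + a ![x₁, x₂, x₃, x₄, x₆, x₇] * b ![x₅] - a ![x₁, x₂, x₃, x₅, x₆, x₇] * b ![x₄]
      + a ![x₁, x₂, x₄, x₅, x₆, x₇] * b ![x₃] - a ![x₁, x₃, x₄, x₅, x₆, x₇] * b ![x₂]
      + a ![x₂, x₃, x₄, x₅, x₆, x₇] * b ![x₁] := by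
  rw [wedgeTo_cons (k := 5) (l := 0) (n := 6) h rfl rfl, wedgeTo_five_one,
    wedgeTo_degree_zero_right]
  simp only [interior_apply, Nat.reduceAdd, pow_succ, pow_zero]
  ring

theorem wedgeTo_four_three (h : 4 + 3 = 7) (a : V [⋀^Fin 4]→L[ℝ] ℝ)
    (b : V [⋀^Fin 3]→L[ℝ] ℝ) (x₁ x₂ x₃ x₄ x₅ x₆ x₇ : V) :
    wedgeTo h a b ![x₁, x₂, x₃, x₄, x₅, x₆, x₇] =
    a ![x₁, x₂, x₃, x₄] * b ![x₅, x₆, x₇] - a ![x₁, x₂, x₃, x₅] * b ![x₄, x₆, x₇]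
      + a ![x₁, x₂, x₃, x₆] * b ![x₄, x₅, x₇] - a ![x₁, x₂, x₃, x₇] * b ![x₄, x₅, x₆]
      + a ![x₁, x₂, x₄, x₅] * b ![x₃, x₆, x₇] - a ![x₁, x₂, x₄, x₆] * b ![x₃, x₅, x₇]
      + a ![x₁, x₂, x₄, x₇] * b ![x₃, x₅, x₆] + a ![x₁, x₂, x₅, x₆] * b ![x₃, x₄, x₇]
      - a ![x₁, x₂, x₅, x₇] * b ![x₃, x₄, x₆] + a ![x₁, x₂, x₆, x₇] * b ![x₃, x₄, x₅]
      - a ![x₁, x₃, x₄, x₅] * b ![x₂, x₆, x₇] + a ![x₁, x₃, x₄, x₆] * b ![x₂, x₅, x₇]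
      - a ![x₁, x₃, x₄, x₇] * b ![x₂, x₅, x₆] - a ![x₁, x₃, x₅, x₆] * b ![x₂, x₄, x₇]
      + a ![x₁, x₃, x₅, x₇] * b ![x₂, x₄, x₆] - a ![x₁, x₃, x₆, x₇] * b ![x₂, x₄, x₅]
      + a ![x₁, x₄, x₅, x₆] * b ![x₂, x₃, x₇] - a ![x₁, x₄, x₅, x₇] * b ![x₂, x₃, x₆]
      + a ![x₁, x₄, x₆, x₇] * b ![x₂, x₃, x₅] - a ![x₁, x₅, x₆, x₇] * b ![x₂, x₃, x₄]
      + a ![x₂, x₃, x₄, x₅] * b ![x₁, x₆, x₇] - a ![x₂, x₃, x₄, x₆] * b ![x₁, x₅, x₇]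
      + a ![x₂, x₃, x₄, x₇] * b ![x₁, x₅, x₆] + a ![x₂, x₃, x₅, x₆] * b ![x₁, x₄, x₇]
      - a ![x₂, x₃, x₅, x₇] * b ![x₁, x₄, x₆] + a ![x₂, x₃, x₆, x₇] * b ![x₁, x₄, x₅]
      - a ![x₂, x₄, x₅, x₆] * b ![x₁, x₃, x₇] + a ![x₂, x₄, x₅, x₇] * b ![x₁, x₃, x₆]
      - a ![x₂, x₄, x₆, x₇] * b ![x₁, x₃, x₅] + a ![x₂, x₅, x₆, x₇] * b ![x₁, x₃, x₄]
      + a ![x₃, x₄, x₅, x₆] * b ![x₁, x₂, x₇] - a ![x₃, x₄, x₅, x₇] * b ![x₁, x₂, x₆]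
      + a ![x₃, x₄, x₆, x₇] * b ![x₁, x₂, x₅] - a ![x₃, x₅, x₆, x₇] * b ![x₁, x₂, x₄]
      + a ![x₄, x₅, x₆, x₇] * b ![x₁, x₂, x₃] := by
  rw [wedgeTo_cons (k := 3) (l := 2) (n := 6) h rfl rfl, wedgeTo_three_three,
    wedgeTo_four_two]
  simp only [interior_apply, Nat.reduceAdd, pow_succ, pow_zero]
  ring

end Pointwise

section Pointwise

variable {V : Type*} [AddCommGroup V] [Module ℝ V] [TopologicalSpace V]

@[simp] theorem covector_apply (ξ : V →L[ℝ] ℝ) (v : Fin 1 → V) : covector ξ v = ξ (v 0) := rfl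

theorem insertFirst_apply {k m : ℕ} (ν : V [⋀^Fin (k + m)]→L[ℝ] ℝ) (w : Fin k → V)
    (v : Fin m → V) : insertFirst ν w v = ν (Fin.append w v) := rfl

theorem wedgeAt_covector {k : ℕ} (a : V [⋀^Fin k]→L[ℝ] ℝ) (ξ : V →L[ℝ] ℝ)
    (v : Fin (k + 1) → V) :
    wedgeAt a (covector ξ) v = ∑ i : Fin (k + 1), (-1) ^ (k + (i : ℕ)) * ξ (v i) *
      a (i.removeNth v) := by
  rw [wedgeAt_eq_wedgeTo]
  induction k with
  | zero =>
    obtain ⟨u, w, rfl⟩ : ∃ u w, v = Matrix.vecCons u w :=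
      ⟨v 0, Fin.tail v, (Fin.cons_self_tail v).symm⟩
    rw [wedgeTo_degree_zero_left, mul_comm]
    simp [Subsingleton.elim _ (![] : Fin 0 → V)]
  | succ k ih =>
    obtain ⟨u, w, rfl⟩ : ∃ u w, v = Matrix.vecCons u w :=
      ⟨v 0, Fin.tail v, (Fin.cons_self_tail v).symm⟩
    rw [wedgeTo_cons (k := k) (l := 0) (n := k + 1) rfl rfl rfl, ih,
      wedgeTo_degree_zero_right, add_comm]
    conv_rhs => rw [Fin.sum_univ_succ]
    congr 1
    · have : Fin.removeNth 0 (Matrix.vecCons u w) = w := rfl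
      rw [this]
      simp
      ring
    · refine Finset.sum_congr rfl fun i _ => ?_
      have : Fin.removeNth i.succ (Matrix.vecCons u w) = Matrix.vecCons u (i.removeNth w) := by
        funext j
        refine Fin.cases ?_ (fun j => ?_) j <;> simp [Fin.removeNth]
      rw [this]
      simp [pow_succ, pow_add]

/-- Covectors without common zeros have a dual basis. -/
theorem exists_dual_basis_of_injective [Module.Finite ℝ V] {n : ℕ} (e : Fin n → V →L[ℝ] ℝ)
    (he : ∀ v, (∀ i, e i v = 0) → v = 0) (hn : Module.finrank ℝ V = n) :
    ∃ E : Module.Basis (Fin n) ℝ V, ∀ v i, E.repr v i = e i v := by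
  let Φ : V →ₗ[ℝ] (Fin n → ℝ) := LinearMap.pi fun i => (e i : V →ₗ[ℝ] ℝ)
  have hinj : Function.Injective Φ := by
    rw [← LinearMap.ker_eq_bot, LinearMap.ker_eq_bot']
    exact fun v hv => he v fun i => congrFun hv i
  let Ψ : V ≃ₗ[ℝ] (Fin n → ℝ) := LinearEquiv.ofInjectiveOfFinrankEq Φ hinj (by simp [hn])
  exact ⟨Module.Basis.ofEquivFun Ψ, fun v i => rfl⟩

/-- A linear coframe has a dual basis. -/
theorem exists_dual_basis [Module.Finite ℝ V] {n : ℕ} (e : Fin n → V →L[ℝ] ℝ)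
    (he : LinearIndependent ℝ e) (hn : Module.finrank ℝ V = n) :
    ∃ E : Module.Basis (Fin n) ℝ V, ∀ v i, E.repr v i = e i v := by
  have he' : LinearIndependent ℝ (fun i => (e i : V →ₗ[ℝ] ℝ)) :=
    he.map' (ContinuousLinearMap.coeLM ℝ : (V →L[ℝ] ℝ) →ₗ[ℝ] (V →ₗ[ℝ] ℝ))
      (LinearMap.ker_eq_bot.2 ContinuousLinearMap.coe_injective)
  have hspan : Submodule.span ℝ (Set.range fun i => (e i : V →ₗ[ℝ] ℝ)) = ⊤ :=
    he'.span_eq_top_of_card_eq_finrank' (by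
      rw [Fintype.card_fin]; exact (hn.symm.trans (Subspace.dual_finrank_eq (K := ℝ)).symm))
  refine exists_dual_basis_of_injective e (fun v hv => ?_) hn
  rw [← Module.forall_dual_apply_eq_zero_iff ℝ v]
  intro ξ
  have hξ : ξ ∈ Submodule.span ℝ (Set.range fun i => (e i : V →ₗ[ℝ] ℝ)) := hspan ▸ trivial
  induction hξ using Submodule.span_induction with
  | mem x hx => obtain ⟨i, rfl⟩ := hx; exact hv i
  | zero => rfl
  | add x y _ _ hx hy => simp [hx, hy]
  | smul c x _ hx => simp [hx]

theorem dual_basis_apply {n : ℕ} {e : Fin n → V →L[ℝ] ℝ} {E : Module.Basis (Fin n) ℝ V}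
    (hE : ∀ v i, E.repr v i = e i v) (i j : Fin n) : e i (E j) = if j = i then 1 else 0 := by
  rw [← hE, E.repr_self, Finsupp.single_apply]

/-- Forms are determined by their values on increasing tuples of basis vectors. -/
theorem ext_strictMono {n k : ℕ} (E : Module.Basis (Fin n) ℝ V) {a b : V [⋀^Fin k]→L[ℝ] ℝ}
    (h : ∀ s : Fin k → Fin n, StrictMono s → a (E ∘ s) = b (E ∘ s)) : a = b := by
  apply ContinuousAlternatingMap.toAlternatingMap_injective
  refine Module.Basis.ext_alternating E fun v hv => ?_
  have hs : StrictMono (v ∘ Tuple.sort v) :=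
    (Tuple.monotone_sort v).strictMono_of_injective (hv.comp (Tuple.sort v).injective)
  have h₁ := h _ hs
  have h₂ : ∀ c : V [⋀^Fin k]→L[ℝ] ℝ, c (E ∘ v ∘ Tuple.sort v) =
      Equiv.Perm.sign (Tuple.sort v) • c (E ∘ v) := fun c =>
    c.toAlternatingMap.map_perm (E ∘ v) (Tuple.sort v)
  rw [h₂, h₂] at h₁
  exact smul_left_cancel _ h₁

theorem ext_top {n : ℕ} (E : Module.Basis (Fin n) ℝ V) {a b : V [⋀^Fin n]→L[ℝ] ℝ}
    (h : a E = b E) : a = b := by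
  refine ext_strictMono E fun s hs => ?_
  have : s = id := by
    refine (StrictMono.range_inj hs strictMono_id).1 ?_
    rw [Set.range_id, (Finite.surjective_of_injective hs.injective).range_eq]
  subst this
  exact h

theorem sum_append_multilinear {k m : ℕ} (ν : V [⋀^Fin (k + m)]→L[ℝ] ℝ) (v : Fin m → V)
    {ι : Type*} [Fintype ι] [DecidableEq ι] (c : Fin k → ι → ℝ) (x : ι → V) :
    ν (Fin.append (fun p => ∑ i, c p i • x i) v) =
      ∑ q : Fin k → ι, (∏ p, c p (q p)) * ν (Fin.append (x ∘ q) v) := by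
  let μ : MultilinearMap ℝ (fun _ : Fin k => V) (MultilinearMap ℝ (fun _ : Fin m => V) ℝ) :=
    (ν.toMultilinearMap.domDomCongr finSumFinEquiv.symm).currySum
  have hμ : ∀ w : Fin k → V, μ w v = ν (Fin.append w v) := by
    intro w
    change ν _ = ν _
    congr 1
    funext j
    refine Fin.addCases (fun j => ?_) (fun j => ?_) j <;> simp
  rw [← hμ, MultilinearMap.map_sum]
  simp only [MultilinearMap.map_smul_univ, sum_apply, smul_apply,
    smul_eq_mul]
  refine Finset.sum_congr rfl fun q _ => ?_
  rw [← hμ]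
  rfl

variable [Module.Finite ℝ V]

/-- The Hodge star in an orthonormal frame. -/
theorem hodgeStarAt_frame {n k m : ℕ} {g : V →L[ℝ] V →L[ℝ] ℝ} {e : Fin n → V →L[ℝ] ℝ}
    {E : Module.Basis (Fin n) ℝ V} (hE : ∀ v i, E.repr v i = e i v)
    (hg : ∀ v w, g v w = ∑ i, e i v * e i w) (ν : V [⋀^Fin (k + m)]→L[ℝ] ℝ)
    (a : V [⋀^Fin k]→L[ℝ] ℝ) (v : Fin m → V) :
    hodgeStarAt m g ν a v =
      (k.factorial : ℝ)⁻¹ * ∑ q : Fin k → Fin n, a (E ∘ q) * ν (Fin.append (E ∘ q) v) := by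
  classical
  set b := Module.finBasis ℝ V with hb
  let P : Matrix (Fin n) (Fin (Module.finrank ℝ V)) ℝ := Matrix.of fun i p => e i (b p)
  let Q : Matrix (Fin (Module.finrank ℝ V)) (Fin n) ℝ := Matrix.of fun p j => b.repr (E j) p
  have hb' : ∀ p, b p = ∑ i, P i p • E i := fun p => by
    conv_lhs => rw [← E.sum_repr (b p)]
    simp [P, hE]
  have hE' : ∀ j, E j = ∑ p, Q p j • b p := fun j => (b.sum_repr (E j)).symm
  have hPQ : P * Q = 1 := by
    ext i j
    have := congrArg (e i) (hE' j)
    rw [dual_basis_apply hE, map_sum] at this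
    rw [Matrix.mul_apply, Matrix.one_apply]
    simp only [map_smul, smul_eq_mul] at this
    simp only [P, Matrix.of_apply, eq_comm (a := i), this, mul_comm]
  have hQP : Q * P = 1 := by
    ext p q
    have := congrArg (fun x => b.repr x p) (hb' q)
    simp only [b.repr_self, map_sum, map_smul, Finsupp.coe_finsetSum, Finset.sum_apply,
      Finsupp.smul_apply, smul_eq_mul, Finsupp.single_apply] at this
    rw [Matrix.mul_apply, Matrix.one_apply]
    simp only [Q, Matrix.of_apply, eq_comm (a := p), this, mul_comm]
  have hG : (Matrix.of fun p q => g (b p) (b q)) = P.transpose * P := by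
    ext p q
    simp [Matrix.mul_apply, hg, P]
  have hGinv : (P.transpose * P)⁻¹ = Q * Q.transpose := by
    refine Matrix.inv_eq_right_inv ?_
    rw [Matrix.mul_assoc, ← Matrix.mul_assoc P, hPQ, Matrix.one_mul, ← Matrix.transpose_mul, hQP,
      Matrix.transpose_one]
  have hdual : ∀ i, metricDual g i = ∑ r, Q i r • E r := by
    intro i
    simp only [metricDual, ← hb, hG, hGinv, Matrix.mul_apply, Finset.sum_smul]
    rw [Finset.sum_comm]
    refine Finset.sum_congr rfl fun r _ => ?_
    rw [hE' r, Finset.smul_sum]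
    simp [mul_smul]
  have hsum : ∀ q, E q = ∑ i, P q i • metricDual g i := by
    intro q
    simp only [hdual, Finset.smul_sum, smul_smul]
    rw [Finset.sum_comm]
    simp only [← Finset.sum_smul, ← Matrix.mul_apply, hPQ, Matrix.one_apply]
    simp
  have ha : ∀ i : Fin k → Fin (Module.finrank ℝ V), a (fun p => b (i p)) =
      ∑ q : Fin k → Fin n, (∏ p, P (q p) (i p)) * a (E ∘ q) := by
    intro i
    simp only [hb']
    rw [ContinuousAlternatingMap.map_sum]
    refine Finset.sum_congr rfl fun q _ => ?_
    rw [ContinuousAlternatingMap.map_smul_univ]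
    rfl
  rw [hodgeStarAt, ContinuousAlternatingMap.smul_apply, ContinuousAlternatingMap.sum_apply,
    smul_eq_mul]
  congr 1
  simp only [ContinuousAlternatingMap.smul_apply, smul_eq_mul, ← hb, ha, insertFirst_apply,
    Finset.sum_mul]
  rw [Finset.sum_comm]
  refine Finset.sum_congr rfl fun q _ => ?_
  have := sum_append_multilinear ν v (fun p i => P (q p) i) (fun i => metricDual g i)
  simp only [← hsum] at this
  change _ = a (E ∘ q) * ν (Fin.append (fun p => E (q p)) v)
  rw [this, Finset.mul_sum]
  refine Finset.sum_congr rfl fun i _ => ?_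
  change _ * ν (Fin.append ((fun i => metricDual g i) ∘ i) v) = _
  ring

omit [Module.Finite ℝ V] in
theorem map_append_perm {k m : ℕ} (ν : V [⋀^Fin (k + m)]→L[ℝ] ℝ) (w : Fin k → V) (v : Fin m → V)
    (τ : Equiv.Perm (Fin k)) :
    ν (Fin.append (w ∘ τ) v) = Equiv.Perm.sign τ • ν (Fin.append w v) := by
  have h := ν.toAlternatingMap.map_perm (Fin.append w v)
    (finSumFinEquiv.permCongr (Equiv.Perm.sumCongr τ 1))
  rw [Equiv.Perm.sign_permCongr, Equiv.Perm.sign_sumCongr, Equiv.Perm.sign_one, mul_one] at h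
  refine Eq.trans ?_ h
  change ν _ = ν _
  congr 1
  funext j
  refine Fin.addCases (fun j => ?_) (fun j => ?_) j <;> simp [Equiv.permCongr_apply]

/-- Components of the Hodge star: `(⋆a)_J = ν_{IJ} a_I`, where `IJ` is a permutation. -/
theorem hodgeStarAt_component {n k m : ℕ} {g : V →L[ℝ] V →L[ℝ] ℝ} {e : Fin n → V →L[ℝ] ℝ}
    {E : Module.Basis (Fin n) ℝ V} (hE : ∀ v i, E.repr v i = e i v)
    (hg : ∀ v w, g v w = ∑ i, e i v * e i w) (ν : V [⋀^Fin (k + m)]→L[ℝ] ℝ)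
    (a : V [⋀^Fin k]→L[ℝ] ℝ) (I : Fin k → Fin n) (J : Fin m → Fin n)
    (hIJ : Function.Bijective (Fin.append I J)) :
    hodgeStarAt m g ν a (E ∘ J) = ν (E ∘ Fin.append I J) * a (E ∘ I) := by
  classical
  have hI : Function.Injective I := fun i j hij => by
    have := @hIJ.1 (Fin.castAdd m i) (Fin.castAdd m j) (by simpa using hij)
    simpa using this
  have happ : ∀ q : Fin k → Fin n, Fin.append (E ∘ q) (E ∘ J) = E ∘ Fin.append q J := fun q => by
    funext j
    refine Fin.addCases (fun j => ?_) (fun j => ?_) j <;> simp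
  have hzero : ∀ q : Fin k → Fin n, q ∉ Set.range (fun τ : Equiv.Perm (Fin k) => I ∘ τ) →
      a (E ∘ q) * ν (Fin.append (E ∘ q) (E ∘ J)) = 0 := by
    intro q hq
    rw [happ]
    by_cases hinj : Function.Injective (Fin.append q J)
    · exfalso
      apply hq
      have hqinj : Function.Injective q := fun i j hij => by
        have := @hinj (Fin.castAdd m i) (Fin.castAdd m j) (by simpa using hij)
        simpa using this
      have hmem : ∀ i, ∃ j, I j = q i := by
        intro i
        obtain ⟨x, hx⟩ := hIJ.2 (q i)
        revert hx
        refine Fin.addCases (fun j => ?_) (fun j => ?_) x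
        · intro hx; exact ⟨j, by simpa using hx⟩
        · intro hx
          have := @hinj (Fin.natAdd k j) (Fin.castAdd m i) (by simpa using hx)
          simp [Fin.ext_iff] at this
          omega
      choose τ hτ using hmem
      have hτinj : Function.Injective τ := fun i j hij => hqinj (by rw [← hτ, ← hτ, hij])
      exact ⟨Equiv.ofBijective τ (Finite.injective_iff_bijective.1 hτinj), funext hτ⟩
    · rw [ν.map_eq_zero_of_not_injective _ (fun h => hinj (Function.Injective.of_comp h)),
        mul_zero]
  rw [hodgeStarAt_frame hE hg,
    ← Fintype.sum_of_injective (fun τ : Equiv.Perm (Fin k) => I ∘ τ)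
      (fun τ σ h => Equiv.ext fun i => hI (congrFun h i))
      (fun _ => ν (E ∘ Fin.append I J) * a (E ∘ I)) _ hzero ?_]
  · have : (k.factorial : ℝ) ≠ 0 := by positivity
    simp [Fintype.card_perm]
    field_simp
  · intro τ
    have h₁ := a.toAlternatingMap.map_perm (E ∘ I) τ
    have h₂ := map_append_perm ν (E ∘ I) (E ∘ J) τ
    change a (E ∘ I ∘ τ) = _ • a (E ∘ I) at h₁
    change ν (Fin.append (E ∘ I ∘ τ) _) = _ at h₂
    rw [h₁, h₂, happ]
    rcases Int.units_eq_one_or (Equiv.Perm.sign τ) with h | h <;> simp [h, mul_comm]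

/-- Complementary indices exist. -/
theorem exists_complement {n k m : ℕ} (hn : k + m = n) {I : Fin k → Fin n}
    (hI : Function.Injective I) :
    ∃ J : Fin m → Fin n, Function.Bijective (Fin.append I J) := by
  classical
  have hc : ((Finset.univ.image I)ᶜ).card = m := by
    rw [Finset.card_compl, Finset.card_image_of_injective _ hI]
    simp
    omega
  refine ⟨((Finset.univ.image I)ᶜ).orderEmbOfFin hc, ?_⟩
  rw [Fintype.bijective_iff_injective_and_card]
  refine ⟨Fin.append_injective_iff.2 ⟨hI, RelEmbedding.injective _, ?_⟩, by simp [hn]⟩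
  intro i j hij
  have := Finset.orderEmbOfFin_mem _ hc j
  rw [← hij] at this
  simp at this

omit [Module.Finite ℝ V] in
theorem map_basis_sq {n : ℕ} (E : Module.Basis (Fin n) ℝ V) (ν : V [⋀^Fin n]→L[ℝ] ℝ)
    (hν : ν E = 1) (s : Fin n → Fin n) (hs : Function.Bijective s) : ν (E ∘ s) * ν (E ∘ s) = 1 := by
  have h := ν.toAlternatingMap.map_perm E (Equiv.ofBijective s hs)
  change ν (E ∘ s) = _ • ν E at h
  rw [h, hν]
  rcases Int.units_eq_one_or (Equiv.Perm.sign (Equiv.ofBijective s hs)) with h | h <;> simp [h]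

/-- `⋆⋆ = 1` when exchanging the blocks of the volume form is an even operation. -/
theorem hodgeStarAt_hodgeStarAt {n k m : ℕ} (hn : k + m = n) {g : V →L[ℝ] V →L[ℝ] ℝ}
    {e : Fin n → V →L[ℝ] ℝ}
    {E : Module.Basis (Fin n) ℝ V} (hE : ∀ v i, E.repr v i = e i v)
    (hg : ∀ v w, g v w = ∑ i, e i v * e i w) (ν : V [⋀^Fin (k + m)]→L[ℝ] ℝ)
    (ν' : V [⋀^Fin (m + k)]→L[ℝ] ℝ) (hν : ∀ v w, ν' (Fin.append w v) = ν (Fin.append v w))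
    (hone : ν (E ∘ Fin.cast hn) = 1)
    (a : V [⋀^Fin k]→L[ℝ] ℝ) :
    hodgeStarAt k g ν' (hodgeStarAt m g ν a) = a := by
  refine ext_strictMono E fun I hI => ?_
  obtain ⟨J, hJ⟩ := exists_complement hn hI.injective
  have hJ' : Function.Bijective (Fin.append J I) := by
    rw [Fintype.bijective_iff_injective_and_card]
    have := Fin.append_injective_iff.1 hJ.1
    exact ⟨Fin.append_injective_iff.2 ⟨this.2.1, this.1, fun i j h => this.2.2 j i h.symm⟩,
      by simp [← hn, add_comm]⟩
  rw [hodgeStarAt_component hE hg _ _ J I hJ', hodgeStarAt_component hE hg _ _ I J hJ, ← mul_assoc]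
  have happ : ∀ {k m : ℕ} (I : Fin k → Fin n) (J : Fin m → Fin n),
      E ∘ Fin.append I J = Fin.append (E ∘ I) (E ∘ J) := fun I J => by
    funext j
    refine Fin.addCases (fun j => ?_) (fun j => ?_) j <;> simp
  rw [happ J I, hν, ← happ]
  subst hn
  rw [map_basis_sq E ν hone _ hJ, one_mul]

end Pointwise

section Product

variable {V : Type*} [AddCommGroup V] [Module ℝ V] [TopologicalSpace V] [Module.Finite ℝ V]
  {V' : Type*} [AddCommGroup V'] [Module ℝ V'] [TopologicalSpace V'] [Module.Finite ℝ V']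

omit [Module.Finite ℝ V] [Module.Finite ℝ V'] in
theorem dual_basis_projection {n : ℕ} {e : Fin n → V →L[ℝ] ℝ}
    {E : Module.Basis (Fin n) ℝ V} (hE : ∀ v i, E.repr v i = e i v)
    {e' : Fin (n + 1) → V' →L[ℝ] ℝ}
    {E' : Module.Basis (Fin (n + 1)) ℝ V'} (hE' : ∀ v i, E'.repr v i = e' i v)
    (P : V' →L[ℝ] V) (hP : ∀ i, e' i.castSucc = e i ∘L P) :
    (∀ i, P (E' (Fin.castSucc i)) = E i) ∧ P (E' (Fin.last n)) = 0 := by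
  constructor
  · intro i
    apply E.repr.injective
    ext j
    have h := dual_basis_apply hE' j.castSucc i.castSucc
    simp only [hP, Fin.castSucc_inj] at h
    rw [hE, hE, dual_basis_apply hE]
    exact h
  · apply E.repr.injective
    ext j
    have h := dual_basis_apply hE' j.castSucc (Fin.last n)
    rw [hP, if_neg (Fin.castSucc_lt_last j).ne'] at h
    rw [hE, map_zero, Finsupp.zero_apply]
    exact h

/-- The Hodge star of a pulled back form on a product with a line. -/
theorem hodgeStarAt_product {n k m : ℕ} {g : V →L[ℝ] V →L[ℝ] ℝ} {e : Fin n → V →L[ℝ] ℝ}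
    {E : Module.Basis (Fin n) ℝ V} (hE : ∀ v i, E.repr v i = e i v)
    (hg : ∀ v w, g v w = ∑ i, e i v * e i w)
    {g' : V' →L[ℝ] V' →L[ℝ] ℝ} {e' : Fin (n + 1) → V' →L[ℝ] ℝ}
    {E' : Module.Basis (Fin (n + 1)) ℝ V'} (hE' : ∀ v i, E'.repr v i = e' i v)
    (hg' : ∀ v w, g' v w = ∑ i, e' i v * e' i w) (P : V' →L[ℝ] V)
    (hP : ∀ i, e' i.castSucc = e i ∘L P) (ν : V [⋀^Fin (k + m)]→L[ℝ] ℝ)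
    (ν' : V' [⋀^Fin (k + (m + 1))]→L[ℝ] ℝ)
    (hν' : ∀ v, ν' v = wedgeAt (ν.compContinuousLinearMap P) (covector (e' (Fin.last n))) v)
    (a : V [⋀^Fin k]→L[ℝ] ℝ) :
    hodgeStarAt (m + 1) g' ν' (a.compContinuousLinearMap P) =
      wedgeAt ((hodgeStarAt m g ν a).compContinuousLinearMap P) (covector (e' (Fin.last n))) := by
  obtain ⟨hPE, hPlast⟩ := dual_basis_projection hE hE' P hP
  have hlast : ∀ i : Fin n, e' (Fin.last n) (E' i.castSucc) = 0 := fun i => by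
    rw [dual_basis_apply hE', if_neg (Fin.castSucc_lt_last i).ne]
  ext v
  rw [hodgeStarAt_frame hE' hg', wedgeAt_covector,
    ← Fintype.sum_of_injective (fun q : Fin k → Fin n => Fin.castSucc ∘ q)
      (fun q r h => funext fun i => Fin.castSucc_injective n (congrFun h i))
      (fun q : Fin k → Fin n => ∑ j : Fin (m + 1), a (E ∘ q) * ((-1) ^ (m + (j : ℕ)) *
        e' (Fin.last n) (v j) * ν (Fin.append (E ∘ q) (P ∘ j.removeNth v)))) _ ?_ ?_]
  · simp only [ContinuousAlternatingMap.compContinuousLinearMap_apply, hodgeStarAt_frame hE hg]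
    rw [Finset.sum_comm, Finset.mul_sum]
    refine Finset.sum_congr rfl fun j _ => ?_
    simp only [Finset.mul_sum]
    refine Finset.sum_congr rfl fun q _ => ?_
    change _ = _ * (_ * (_ * ν (Fin.append (E ∘ q) (P ∘ j.removeNth v))))
    ring
  · intro q hq
    have : ∃ i, q i = Fin.last n := by
      by_contra! hne
      exact hq ⟨fun i => (q i).castPred (hne i), funext fun i => Fin.castSucc_castPred _ _⟩
    obtain ⟨i, hi⟩ := this
    rw [ContinuousAlternatingMap.compContinuousLinearMap_apply, a.map_coord_zero i (by simp [hi, hPlast]),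
      zero_mul]
  · intro q
    have h₁ : a.compContinuousLinearMap P (E' ∘ Fin.castSucc ∘ q) = a (E ∘ q) := by
      rw [ContinuousAlternatingMap.compContinuousLinearMap_apply]
      congr 1
      funext i
      exact hPE (q i)
    have h₂ := wedgeAt_covector (ν.compContinuousLinearMap P) (e' (Fin.last n))
      (Fin.append (E' ∘ Fin.castSucc ∘ q) v : Fin (k + (m + 1)) → V')
    have h₃ := Fin.sum_univ_add (a := k) (b := m + 1) (fun i : Fin (k + (m + 1)) =>
      (-1) ^ (k + m + (i : ℕ)) * e' (Fin.last n)
        ((Fin.append (E' ∘ Fin.castSucc ∘ q) v : Fin (k + (m + 1)) → V') i) *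
      (ν.compContinuousLinearMap P) (Fin.removeNth (n := k + m) (α := fun _ => V') i
        (Fin.append (E' ∘ Fin.castSucc ∘ q) v : Fin (k + (m + 1)) → V')))
    rw [h₁]
    refine Eq.symm ((congrArg _ ((hν' _).trans (h₂.trans h₃))).trans ?_)
    rw [Finset.sum_eq_zero, zero_add, Finset.mul_sum]
    · refine Finset.sum_congr rfl fun j _ => ?_
      congr 1
      have h₄ : P ∘ (Fin.removeNth (n := k + m) (α := fun _ => V') (Fin.natAdd k j)
          (Fin.append (E' ∘ Fin.castSucc ∘ q) v : Fin (k + (m + 1)) → V')) =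
          Fin.append (E ∘ q) (P ∘ j.removeNth v) := by
        funext x
        refine Fin.addCases (fun x => ?_) (fun x => ?_) x
        · have : (Fin.natAdd k j).succAbove (n := k + m) (Fin.castAdd m x) =
              Fin.castAdd (m + 1) x := by
            ext
            have := x.2
            simp [Fin.succAbove, Fin.lt_def]
            rw [if_pos (by omega)]
            simp
          simp only [Function.comp_apply, Fin.removeNth, Fin.append_left]
          rw [this, Fin.append_left]
          exact hPE _
        · have : (Fin.natAdd k j).succAbove (n := k + m) (Fin.natAdd k x) =
              Fin.natAdd k (j.succAbove x) := by
            ext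
            simp [Fin.succAbove, Fin.lt_def]
            split_ifs <;> simp; omega
          simp only [Function.comp_apply, Fin.removeNth, Fin.append_right]
          rw [this, Fin.append_right]
      rw [ContinuousAlternatingMap.compContinuousLinearMap_apply, h₄, Fin.append_right]
      have : ((-1 : ℝ)) ^ k * (-1) ^ k = 1 := by rw [← mul_pow]; simp
      simp only [Fin.val_natAdd, pow_add]
      linear_combination (((-1 : ℝ)) ^ m * (-1) ^ (j : ℕ) * e' (Fin.last n) (v j) *
        ν (Fin.append (E ∘ q) (P ∘ j.removeNth v))) * this
    · intro i _
      simp [hlast]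

end Product

section Pointwise

variable {V : Type*} [AddCommGroup V] [Module ℝ V] [TopologicalSpace V]

theorem mono₂_apply {n : ℕ} (e : Fin n → V →L[ℝ] ℝ) (i j : Fin n) (x y : V) :
    mono₂ e i j ![x, y] = e i x * e j y - e i y * e j x := by
  simp [mono₂, wedgeAt_one_one]

theorem mono₃_apply {n : ℕ} (e : Fin n → V →L[ℝ] ℝ) (i j k : Fin n) (x y z : V) :
    mono₃ e i j k ![x, y, z] = (e i x * e j y - e i y * e j x) * e k z -
      (e i x * e j z - e i z * e j x) * e k y + (e i y * e j z - e i z * e j y) * e k x := by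
  simp [mono₃, wedgeAt_two_one, mono₂_apply]

/-- The standard `G₂` form in a coframe. -/
def g2Form (e : Fin 7 → V →L[ℝ] ℝ) : V [⋀^Fin 3]→L[ℝ] ℝ :=
  mono₃ e 0 1 6 + mono₃ e 2 3 6 + mono₃ e 4 5 6
    + mono₃ e 0 2 4 - mono₃ e 0 3 5 - mono₃ e 1 2 5 - mono₃ e 1 3 4

theorem g2Form_apply (e : Fin 7 → V →L[ℝ] ℝ) (x y z : V) : g2Form e ![x, y, z] =
    mono₃ e 0 1 6 ![x, y, z] + mono₃ e 2 3 6 ![x, y, z] + mono₃ e 4 5 6 ![x, y, z] +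
      mono₃ e 0 2 4 ![x, y, z] - mono₃ e 0 3 5 ![x, y, z] - mono₃ e 1 2 5 ![x, y, z] -
      mono₃ e 1 3 4 ![x, y, z] := rfl

theorem g2Form_components (e : Fin 7 → V →L[ℝ] ℝ) {E : Fin 7 → V}
    (hE : ∀ i j, e i (E j) = if j = i then 1 else 0) :
      g2Form e ![E 0, E 1, E 2] = 0 ∧ g2Form e ![E 0, E 1, E 3] = 0 ∧
      g2Form e ![E 0, E 1, E 4] = 0 ∧ g2Form e ![E 0, E 1, E 5] = 0 ∧
      g2Form e ![E 0, E 1, E 6] = 1 ∧ g2Form e ![E 0, E 2, E 3] = 0 ∧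
      g2Form e ![E 0, E 2, E 4] = 1 ∧ g2Form e ![E 0, E 2, E 5] = 0 ∧
      g2Form e ![E 0, E 2, E 6] = 0 ∧ g2Form e ![E 0, E 3, E 4] = 0 ∧
      g2Form e ![E 0, E 3, E 5] = -1 ∧ g2Form e ![E 0, E 3, E 6] = 0 ∧
      g2Form e ![E 0, E 4, E 5] = 0 ∧ g2Form e ![E 0, E 4, E 6] = 0 ∧
      g2Form e ![E 0, E 5, E 6] = 0 ∧ g2Form e ![E 1, E 2, E 3] = 0 ∧
      g2Form e ![E 1, E 2, E 4] = 0 ∧ g2Form e ![E 1, E 2, E 5] = -1 ∧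
      g2Form e ![E 1, E 2, E 6] = 0 ∧ g2Form e ![E 1, E 3, E 4] = -1 ∧
      g2Form e ![E 1, E 3, E 5] = 0 ∧ g2Form e ![E 1, E 3, E 6] = 0 ∧
      g2Form e ![E 1, E 4, E 5] = 0 ∧ g2Form e ![E 1, E 4, E 6] = 0 ∧
      g2Form e ![E 1, E 5, E 6] = 0 ∧ g2Form e ![E 2, E 3, E 4] = 0 ∧
      g2Form e ![E 2, E 3, E 5] = 0 ∧ g2Form e ![E 2, E 3, E 6] = 1 ∧
      g2Form e ![E 2, E 4, E 5] = 0 ∧ g2Form e ![E 2, E 4, E 6] = 0 ∧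
      g2Form e ![E 2, E 5, E 6] = 0 ∧ g2Form e ![E 3, E 4, E 5] = 0 ∧
      g2Form e ![E 3, E 4, E 6] = 0 ∧ g2Form e ![E 3, E 5, E 6] = 0 ∧
      g2Form e ![E 4, E 5, E 6] = 1 := by
  refine ⟨?_, ?_, ?_, ?_, ?_, ?_, ?_, ?_, ?_, ?_, ?_, ?_, ?_, ?_, ?_, ?_, ?_, ?_, ?_, ?_, ?_, ?_, ?_,
    ?_, ?_, ?_, ?_, ?_, ?_, ?_, ?_, ?_, ?_, ?_, ?_⟩ <;>
    simp [g2Form_apply, mono₃_apply, hE]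

theorem g2Form_interior_components (e : Fin 7 → V →L[ℝ] ℝ) {E : Fin 7 → V}
    (hE : ∀ i j, e i (E j) = if j = i then 1 else 0) (u : V) :
      g2Form e ![u, E 0, E 1] = e 6 u ∧ g2Form e ![u, E 0, E 2] = e 4 u ∧
      g2Form e ![u, E 0, E 3] = -e 5 u ∧ g2Form e ![u, E 0, E 4] = -e 2 u ∧
      g2Form e ![u, E 0, E 5] = e 3 u ∧ g2Form e ![u, E 0, E 6] = -e 1 u ∧
      g2Form e ![u, E 1, E 2] = -e 5 u ∧ g2Form e ![u, E 1, E 3] = -e 4 u ∧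
      g2Form e ![u, E 1, E 4] = e 3 u ∧ g2Form e ![u, E 1, E 5] = e 2 u ∧
      g2Form e ![u, E 1, E 6] = e 0 u ∧ g2Form e ![u, E 2, E 3] = e 6 u ∧
      g2Form e ![u, E 2, E 4] = e 0 u ∧ g2Form e ![u, E 2, E 5] = -e 1 u ∧
      g2Form e ![u, E 2, E 6] = -e 3 u ∧ g2Form e ![u, E 3, E 4] = -e 1 u ∧
      g2Form e ![u, E 3, E 5] = -e 0 u ∧ g2Form e ![u, E 3, E 6] = e 2 u ∧
      g2Form e ![u, E 4, E 5] = e 6 u ∧ g2Form e ![u, E 4, E 6] = -e 5 u ∧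
      g2Form e ![u, E 5, E 6] = e 4 u := by
  refine ⟨?_, ?_, ?_, ?_, ?_, ?_, ?_, ?_, ?_, ?_, ?_, ?_, ?_, ?_, ?_, ?_, ?_, ?_, ?_, ?_, ?_⟩ <;>
    simp [g2Form_apply, mono₃_apply, hE]

theorem wedgeTo_g2Form (e : Fin 7 → V →L[ℝ] ℝ) {E : Fin 7 → V}
    (hE : ∀ i j, e i (E j) = if j = i then 1 else 0) (a : V [⋀^Fin 4]→L[ℝ] ℝ) :
    wedgeTo (n := 7) rfl a (g2Form e) ![E 0, E 1, E 2, E 3, E 4, E 5, E 6] =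
      a ![E 2, E 3, E 4, E 5] + a ![E 0, E 1, E 4, E 5] + a ![E 0, E 1, E 2, E 3] -
      a ![E 1, E 3, E 5, E 6] + a ![E 1, E 2, E 4, E 6] + a ![E 0, E 3, E 4, E 6] +
      a ![E 0, E 2, E 5, E 6] := by
  obtain ⟨h012, h013, h014, h015, h016, h023, h024, h025, h026, h034, h035, h036, h045, h046, h056,
    h123, h124, h125, h126, h134, h135, h136, h145, h146, h156, h234, h235, h236, h245, h246,
    h256, h345, h346, h356, h456⟩ := g2Form_components e hE
  rw [wedgeTo_four_three, h012, h013, h014, h015, h016, h023, h024, h025, h026, h034, h035,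
    h036, h045, h046, h056, h123, h124, h125, h126, h134, h135, h136, h145, h146, h156,
    h234, h235, h236, h245, h246, h256, h345, h346, h356, h456]
  ring

/-- The form `φ` determines the metric up to the volume form: `ι_u φ ∧ ι_u φ ∧ φ = 6 |u|² vol`. -/
theorem g2Form_wedge_top (e : Fin 7 → V →L[ℝ] ℝ) {E : Fin 7 → V}
    (hE : ∀ i j, e i (E j) = if j = i then 1 else 0) (u : V) :
    wedgeTo (k := 4) (n := 7) rfl (wedgeAt (interior u (g2Form e)) (interior u (g2Form e)))
      (g2Form e)
      ![E 0, E 1, E 2, E 3, E 4, E 5, E 6] = 6 * ∑ i, e i u * e i u := by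
  obtain ⟨k01, k02, k03, k04, k05, k06, k12, k13, k14, k15, k16, k23, k24, k25, k26, k34, k35, k36,
    k45, k46, k56⟩ := g2Form_interior_components e hE u
  rw [wedgeTo_g2Form e hE]
  simp only [wedgeAt_two_two, interior_apply,
    k01, k02, k03, k04, k05, k06, k12, k13, k14, k15, k16, k23,
    k24, k25, k26, k34, k35, k36, k45, k46, k56, Fin.sum_univ_seven]
  ring

end Pointwise

section Pointwise

variable {V : Type*} [AddCommGroup V] [Module ℝ V] [TopologicalSpace V]

theorem volume_frame (e : Fin 7 → V →L[ℝ] ℝ) {E : Fin 7 → V}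
    (hE : ∀ i j, e i (E j) = if j = i then 1 else 0) :
    wedgeTo (k := 6) (n := 7) rfl (wedgeAt (mono₃ e 0 1 2) (mono₃ e 3 4 5)) (covector (e 6))
      ![E 0, E 1, E 2, E 3, E 4, E 5, E 6] = 1 := by
  have h : wedgeAt (mono₃ e 0 1 2) (mono₃ e 3 4 5) ![E 0, E 1, E 2, E 3, E 4, E 5] = 1 := by
    rw [wedgeAt_three_three]
    simp [mono₃_apply, hE]
  rw [wedgeTo_six_one]
  simp [hE, h]

theorem tuple_seven {V : Type*} (E : Fin 7 → V) : E = ![E 0, E 1, E 2, E 3, E 4, E 5, E 6] := by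
  funext i; fin_cases i <;> rfl

theorem tuple_six {V : Type*} (E : Fin 6 → V) : E = ![E 0, E 1, E 2, E 3, E 4, E 5] := by
  funext i; fin_cases i <;> rfl

/-- The `7`-form `ι_u φ ∧ ι_u φ ∧ φ`. -/
def g2Top (φ : V [⋀^Fin 3]→L[ℝ] ℝ) (u : V) : V [⋀^Fin 7]→L[ℝ] ℝ :=
  wedgeOf (k := 4) rfl (wedgeAt (interior u φ) (interior u φ)) φ

theorem g2Top_g2Form (e : Fin 7 → V →L[ℝ] ℝ) {E : Fin 7 → V}
    (hE : ∀ i j, e i (E j) = if j = i then 1 else 0) (u : V) :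
    g2Top (g2Form e) u E = 6 * ∑ i, e i u * e i u := by
  have h := g2Form_wedge_top e hE u
  rw [← tuple_seven E] at h
  rw [g2Top, wedgeOf_apply, h]

/-- The `7`-form `e¹²³⁴⁵⁶⁷`. -/
def g2Volume (e : Fin 7 → V →L[ℝ] ℝ) : V [⋀^Fin 7]→L[ℝ] ℝ :=
  wedgeOf (k := 6) rfl (wedgeAt (mono₃ e 0 1 2) (mono₃ e 3 4 5)) (covector (e 6))

theorem g2Volume_frame (e : Fin 7 → V →L[ℝ] ℝ) {E : Fin 7 → V}
    (hE : ∀ i j, e i (E j) = if j = i then 1 else 0) : g2Volume e E = 1 := by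
  have h := volume_frame e hE
  rw [← tuple_seven E] at h
  rw [g2Volume, wedgeOf_apply, h]

variable [Module.Finite ℝ V]

/-- The metric and the volume form of a `G₂` form can be read off in every adapted coframe. -/
theorem IsG2Coframe.of_form {g : V →L[ℝ] V →L[ℝ] ℝ} {ν : V [⋀^Fin 7]→L[ℝ] ℝ}
    {φ : V [⋀^Fin 3]→L[ℝ] ℝ} {e : Fin 7 → V →L[ℝ] ℝ} (h : IsG2Coframe g ν φ e)
    (hV : Module.finrank ℝ V = 7) {d : Fin 7 → V →L[ℝ] ℝ} {D : Module.Basis (Fin 7) ℝ V}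
    (hD : ∀ v i, D.repr v i = d i v) (hφ : φ = g2Form d) :
    (∀ v w, g v w = ∑ i, d i v * d i w) ∧ ν D = 1 := by
  obtain ⟨E, hE⟩ := exists_dual_basis e h.indep hV
  have hEe := dual_basis_apply hE
  have hDd := dual_basis_apply hD
  have hνE : ν E = 1 := by
    have h₁ : ν = g2Volume e := h.volume
    rw [h₁]
    exact g2Volume_frame e hEe
  have hφe : φ = g2Form e := h.form
  have key : ∀ u, (∑ i, e i u * e i u) * ν D = ∑ i, d i u * d i u := by
    intro u
    have h₁ := g2Top_g2Form e hEe u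
    have h₂ := g2Top_g2Form d hDd u
    rw [← hφe] at h₁
    rw [← hφ] at h₂
    have h₃ : g2Top φ u = (6 * ∑ i, e i u * e i u) • ν := by
      refine ext_top E ?_
      rw [ContinuousAlternatingMap.smul_apply, hνE]
      exact h₁.trans (by simp)
    have h₄ := congrArg (fun a : V [⋀^Fin 7]→L[ℝ] ℝ => a D) h₃
    simp only [ContinuousAlternatingMap.smul_apply, smul_eq_mul] at h₄
    have h₅ := h₄.symm.trans h₂
    linarith
  have hgsymm : ∀ v w, g v w = g w v := fun v w => by
    rw [h.metric, h.metric]; exact Finset.sum_congr rfl fun i _ => mul_comm _ _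
  have key' : ∀ v w, g v w * ν D = ∑ i, d i v * d i w := by
    intro v w
    have h₁ := key (v + w)
    have h₂ := key v
    have h₃ := key w
    have h₄ : ∑ i, e i (v + w) * e i (v + w) =
        ∑ i, e i v * e i v + ∑ i, e i w * e i w + 2 * ∑ i, e i v * e i w := by
      rw [Finset.mul_sum, ← Finset.sum_add_distrib, ← Finset.sum_add_distrib]
      exact Finset.sum_congr rfl fun i _ => by rw [map_add]; ring
    have h₅ : ∑ i, d i (v + w) * d i (v + w) =
        ∑ i, d i v * d i v + ∑ i, d i w * d i w + 2 * ∑ i, d i v * d i w := by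
      rw [Finset.mul_sum, ← Finset.sum_add_distrib, ← Finset.sum_add_distrib]
      exact Finset.sum_congr rfl fun i _ => by rw [map_add]; ring
    rw [h₄, h₅] at h₁
    rw [h.metric]
    linarith
  let A : Matrix (Fin 7) (Fin 7) ℝ := E.toMatrix D
  have hA : ∀ i j, A i j = e i (D j) := fun i j => by
    simp [A, Module.Basis.toMatrix_apply, hE]
  have hdet : ν D = A.det := by
    have h₁ := AlternatingMap.eq_smul_basis_det E ν.toAlternatingMap
    have h₂ : ν D = (ν.toAlternatingMap E • E.det) D :=
      congrArg (fun f : V [⋀^Fin 7]→ₗ[ℝ] ℝ => f D) h₁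
    rw [h₂]
    have h₃ : ν.toAlternatingMap E = 1 := hνE
    rw [h₃, one_smul, Module.Basis.det_apply]
  have hAA : ν D • (A.transpose * A) = 1 := by
    ext i j
    have h₁ := key' (D i) (D j)
    rw [h.metric] at h₁
    simp only [hDd] at h₁
    rw [Matrix.smul_apply, Matrix.mul_apply, smul_eq_mul, Matrix.one_apply, mul_comm]
    simp only [Matrix.transpose_apply, hA]
    rw [h₁]
    simp
  have hpow : ν D ^ 9 = 1 := by
    have h₁ := congrArg Matrix.det hAA
    rw [Matrix.det_smul, Matrix.det_mul, Matrix.det_transpose, Matrix.det_one, ← hdet,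
      Fintype.card_fin] at h₁
    linear_combination h₁
  have hone : ν D = 1 := by
    have h₁ : Odd 9 := by decide
    exact (h₁.strictMono_pow (R := ℝ)).injective (by simpa using hpow)
  refine ⟨fun v w => ?_, hone⟩
  rw [← key', hone, mul_one]

end Pointwise

section Pointwise

variable {V : Type*} [AddCommGroup V] [Module ℝ V] [TopologicalSpace V]

theorem comp_vec_two {ι V : Type*} (E : ι → V) (i j : ι) :
    E ∘ ![i, j] = ![E i, E j] := by
  funext x; fin_cases x <;> rfl

theorem comp_vec_three {ι V : Type*} (E : ι → V) (i j k : ι) :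
    E ∘ ![i, j, k] = ![E i, E j, E k] := by
  funext x; fin_cases x <;> rfl

theorem comp_vec_four {ι V : Type*} (E : ι → V) (i j k l : ι) :
    E ∘ ![i, j, k, l] = ![E i, E j, E k, E l] := by
  funext x; fin_cases x <;> rfl

theorem ext_two_six (E : Module.Basis (Fin 6) ℝ V) {a b : V [⋀^Fin 2]→L[ℝ] ℝ}
    (h :
      a ![E 0, E 1] = b ![E 0, E 1] ∧ a ![E 0, E 2] = b ![E 0, E 2] ∧
      a ![E 0, E 3] = b ![E 0, E 3] ∧ a ![E 0, E 4] = b ![E 0, E 4] ∧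
      a ![E 0, E 5] = b ![E 0, E 5] ∧ a ![E 1, E 2] = b ![E 1, E 2] ∧
      a ![E 1, E 3] = b ![E 1, E 3] ∧ a ![E 1, E 4] = b ![E 1, E 4] ∧
      a ![E 1, E 5] = b ![E 1, E 5] ∧ a ![E 2, E 3] = b ![E 2, E 3] ∧
      a ![E 2, E 4] = b ![E 2, E 4] ∧ a ![E 2, E 5] = b ![E 2, E 5] ∧
      a ![E 3, E 4] = b ![E 3, E 4] ∧ a ![E 3, E 5] = b ![E 3, E 5] ∧
      a ![E 4, E 5] = b ![E 4, E 5]) : a = b := by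
  refine ext_strictMono E fun s hs => ?_
  have h₁ : s = ![s 0, s 1] := by
    funext x; fin_cases x <;> rfl
  have l0 : s 0 < s 1 := hs (by decide)
  rw [h₁, comp_vec_two]
  generalize s 0 = p at *
  generalize s 1 = q at *
  clear h₁ hs s
  obtain ⟨h01, h02, h03, h04, h05, h12, h13, h14, h15, h23, h24, h25, h34, h35, h45⟩ := h
  fin_cases p <;> fin_cases q <;> first | exact absurd l0 (by decide) | assumption

theorem ext_three_six (E : Module.Basis (Fin 6) ℝ V) {a b : V [⋀^Fin 3]→L[ℝ] ℝ}
    (h :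
      a ![E 0, E 1, E 2] = b ![E 0, E 1, E 2] ∧ a ![E 0, E 1, E 3] = b ![E 0, E 1, E 3] ∧
      a ![E 0, E 1, E 4] = b ![E 0, E 1, E 4] ∧ a ![E 0, E 1, E 5] = b ![E 0, E 1, E 5] ∧
      a ![E 0, E 2, E 3] = b ![E 0, E 2, E 3] ∧ a ![E 0, E 2, E 4] = b ![E 0, E 2, E 4] ∧
      a ![E 0, E 2, E 5] = b ![E 0, E 2, E 5] ∧ a ![E 0, E 3, E 4] = b ![E 0, E 3, E 4] ∧
      a ![E 0, E 3, E 5] = b ![E 0, E 3, E 5] ∧ a ![E 0, E 4, E 5] = b ![E 0, E 4, E 5] ∧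
      a ![E 1, E 2, E 3] = b ![E 1, E 2, E 3] ∧ a ![E 1, E 2, E 4] = b ![E 1, E 2, E 4] ∧
      a ![E 1, E 2, E 5] = b ![E 1, E 2, E 5] ∧ a ![E 1, E 3, E 4] = b ![E 1, E 3, E 4] ∧
      a ![E 1, E 3, E 5] = b ![E 1, E 3, E 5] ∧ a ![E 1, E 4, E 5] = b ![E 1, E 4, E 5] ∧
      a ![E 2, E 3, E 4] = b ![E 2, E 3, E 4] ∧ a ![E 2, E 3, E 5] = b ![E 2, E 3, E 5] ∧
      a ![E 2, E 4, E 5] = b ![E 2, E 4, E 5] ∧ a ![E 3, E 4, E 5] = b ![E 3, E 4, E 5]) : a = b := by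
  refine ext_strictMono E fun s hs => ?_
  have h₁ : s = ![s 0, s 1, s 2] := by
    funext x; fin_cases x <;> rfl
  have l0 : s 0 < s 1 := hs (by decide)
  have l1 : s 1 < s 2 := hs (by decide)
  rw [h₁, comp_vec_three]
  generalize s 0 = p at *
  generalize s 1 = q at *
  generalize s 2 = r at *
  clear h₁ hs s
  obtain ⟨h012, h013, h014, h015, h023, h024, h025, h034, h035, h045, h123, h124, h125, h134, h135,
    h145, h234, h235, h245, h345⟩ := h
  fin_cases p <;> fin_cases q <;> first | exact absurd l0 (by decide) | skip
  all_goals fin_cases r <;> first | exact absurd l1 (by decide) | assumption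

theorem ext_one_six (E : Module.Basis (Fin 6) ℝ V) {a b : V [⋀^Fin 1]→L[ℝ] ℝ}
    (h : a ![E 0] = b ![E 0] ∧ a ![E 1] = b ![E 1] ∧ a ![E 2] = b ![E 2] ∧ a ![E 3] = b ![E 3] ∧
      a ![E 4] = b ![E 4] ∧ a ![E 5] = b ![E 5]) : a = b := by
  refine ext_strictMono E fun s _ => ?_
  have h₁ : E ∘ s = ![E (s 0)] := by
    funext x; fin_cases x; rfl
  rw [h₁]
  generalize s 0 = p
  obtain ⟨h0, h1, h2, h3, h4, h5⟩ := h
  fin_cases p <;> assumption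

theorem map_basis_eq_sign {n : ℕ} {E : Fin n → V} {ν : V [⋀^Fin n]→L[ℝ] ℝ} (hν : ν E = 1)
    (s : Fin n → Fin n) (hs : Function.Injective s) (ε : ℤˣ)
    (hε : ∏ i, ∏ j ∈ Finset.Ioi i, (if s i < s j then 1 else -1) = ε) :
    ν (E ∘ s) = ((ε : ℤ) : ℝ) := by
  have h := ν.toAlternatingMap.map_perm E (Equiv.ofBijective s (Finite.injective_iff_bijective.1 hs))
  change ν (E ∘ s) = _ • ν E at h
  rw [h, hν, Equiv.Perm.sign_eq_prod_prod_Ioi]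
  simp only [Equiv.ofBijective_apply, hε, Units.smul_def, zsmul_eq_mul, mul_one]

variable [Module.Finite ℝ V]

/-- Components of the Hodge star in an orthonormal frame. -/
theorem hodgeStarAt_sign {n k m : ℕ} (hn : k + m = n) {g : V →L[ℝ] V →L[ℝ] ℝ}
    {e : Fin n → V →L[ℝ] ℝ} {E : Module.Basis (Fin n) ℝ V} (hE : ∀ v i, E.repr v i = e i v)
    (hg : ∀ v w, g v w = ∑ i, e i v * e i w) {ν : V [⋀^Fin (k + m)]→L[ℝ] ℝ}
    (hν : ν (E ∘ Fin.cast hn) = 1) (a : V [⋀^Fin k]→L[ℝ] ℝ) (I : Fin k → Fin n) (J : Fin m → Fin n)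
    (hs : Function.Injective (Fin.append I J)) (ε : ℤˣ)
    (hε : ∏ i, ∏ j ∈ Finset.Ioi i, (if Fin.append I J i < Fin.append I J j then 1 else -1) = ε) :
    hodgeStarAt m g ν a (E ∘ J) = ((ε : ℤ) : ℝ) * a (E ∘ I) := by
  subst hn
  rw [hodgeStarAt_component hE hg ν a I J (Finite.injective_iff_bijective.1 hs),
    map_basis_eq_sign (E := E) hν _ hs ε hε]

theorem hodgeStarAt_four_two {g : V →L[ℝ] V →L[ℝ] ℝ} {e : Fin 6 → V →L[ℝ] ℝ}
    {E : Module.Basis (Fin 6) ℝ V} (hE : ∀ v i, E.repr v i = e i v)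
    (hg : ∀ v w, g v w = ∑ i, e i v * e i w) {ν : V [⋀^Fin 6]→L[ℝ] ℝ} (hν : ν E = 1)
    (a : V [⋀^Fin 4]→L[ℝ] ℝ) (star : V [⋀^Fin 2]→L[ℝ] ℝ)
    (hstar : star = hodgeStarAt (k := 4) 2 g ν a) :
      star ![E 0, E 1] = a ![E 2, E 3, E 4, E 5] ∧ star ![E 0, E 2] = -a ![E 1, E 3, E 4, E 5] ∧
      star ![E 0, E 3] = a ![E 1, E 2, E 4, E 5] ∧ star ![E 0, E 4] = -a ![E 1, E 2, E 3, E 5] ∧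
      star ![E 0, E 5] = a ![E 1, E 2, E 3, E 4] ∧ star ![E 1, E 2] = a ![E 0, E 3, E 4, E 5] ∧
      star ![E 1, E 3] = -a ![E 0, E 2, E 4, E 5] ∧ star ![E 1, E 4] = a ![E 0, E 2, E 3, E 5] ∧
      star ![E 1, E 5] = -a ![E 0, E 2, E 3, E 4] ∧ star ![E 2, E 3] = a ![E 0, E 1, E 4, E 5] ∧
      star ![E 2, E 4] = -a ![E 0, E 1, E 3, E 5] ∧ star ![E 2, E 5] = a ![E 0, E 1, E 3, E 4] ∧
      star ![E 3, E 4] = a ![E 0, E 1, E 2, E 5] ∧ star ![E 3, E 5] = -a ![E 0, E 1, E 2, E 4] ∧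
      star ![E 4, E 5] = a ![E 0, E 1, E 2, E 3] := by
  have h := hodgeStarAt_sign (k := 4) (m := 2) rfl hE hg (ν := ν) hν a
  rw [← hstar] at h
  refine ⟨?_, ?_, ?_, ?_, ?_, ?_, ?_, ?_, ?_, ?_, ?_, ?_, ?_, ?_, ?_⟩
  · simpa [comp_vec_four, comp_vec_two] using
      h ![2, 3, 4, 5] ![0, 1] (by decide) 1 (by decide)
  · simpa [comp_vec_four, comp_vec_two] using
      h ![1, 3, 4, 5] ![0, 2] (by decide) (-1) (by decide)
  · simpa [comp_vec_four, comp_vec_two] using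
      h ![1, 2, 4, 5] ![0, 3] (by decide) 1 (by decide)
  · simpa [comp_vec_four, comp_vec_two] using
      h ![1, 2, 3, 5] ![0, 4] (by decide) (-1) (by decide)
  · simpa [comp_vec_four, comp_vec_two] using
      h ![1, 2, 3, 4] ![0, 5] (by decide) 1 (by decide)
  · simpa [comp_vec_four, comp_vec_two] using
      h ![0, 3, 4, 5] ![1, 2] (by decide) 1 (by decide)
  · simpa [comp_vec_four, comp_vec_two] using
      h ![0, 2, 4, 5] ![1, 3] (by decide) (-1) (by decide)
  · simpa [comp_vec_four, comp_vec_two] using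
      h ![0, 2, 3, 5] ![1, 4] (by decide) 1 (by decide)
  · simpa [comp_vec_four, comp_vec_two] using
      h ![0, 2, 3, 4] ![1, 5] (by decide) (-1) (by decide)
  · simpa [comp_vec_four, comp_vec_two] using
      h ![0, 1, 4, 5] ![2, 3] (by decide) 1 (by decide)
  · simpa [comp_vec_four, comp_vec_two] using
      h ![0, 1, 3, 5] ![2, 4] (by decide) (-1) (by decide)
  · simpa [comp_vec_four, comp_vec_two] using
      h ![0, 1, 3, 4] ![2, 5] (by decide) 1 (by decide)
  · simpa [comp_vec_four, comp_vec_two] using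
      h ![0, 1, 2, 5] ![3, 4] (by decide) 1 (by decide)
  · simpa [comp_vec_four, comp_vec_two] using
      h ![0, 1, 2, 4] ![3, 5] (by decide) (-1) (by decide)
  · simpa [comp_vec_four, comp_vec_two] using
      h ![0, 1, 2, 3] ![4, 5] (by decide) 1 (by decide)

theorem hodgeStarAt_two_four {g : V →L[ℝ] V →L[ℝ] ℝ} {e : Fin 6 → V →L[ℝ] ℝ}
    {E : Module.Basis (Fin 6) ℝ V} (hE : ∀ v i, E.repr v i = e i v)
    (hg : ∀ v w, g v w = ∑ i, e i v * e i w) {ν : V [⋀^Fin 6]→L[ℝ] ℝ} (hν : ν E = 1)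
    (a : V [⋀^Fin 2]→L[ℝ] ℝ) (star : V [⋀^Fin 4]→L[ℝ] ℝ)
    (hstar : star = hodgeStarAt (k := 2) 4 g ν a) :
      star ![E 0, E 1, E 2, E 3] = a ![E 4, E 5] ∧ star ![E 0, E 1, E 2, E 4] = -a ![E 3, E 5] ∧
      star ![E 0, E 1, E 2, E 5] = a ![E 3, E 4] ∧ star ![E 0, E 1, E 3, E 4] = a ![E 2, E 5] ∧
      star ![E 0, E 1, E 3, E 5] = -a ![E 2, E 4] ∧ star ![E 0, E 1, E 4, E 5] = a ![E 2, E 3] ∧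
      star ![E 0, E 2, E 3, E 4] = -a ![E 1, E 5] ∧ star ![E 0, E 2, E 3, E 5] = a ![E 1, E 4] ∧
      star ![E 0, E 2, E 4, E 5] = -a ![E 1, E 3] ∧ star ![E 0, E 3, E 4, E 5] = a ![E 1, E 2] ∧
      star ![E 1, E 2, E 3, E 4] = a ![E 0, E 5] ∧ star ![E 1, E 2, E 3, E 5] = -a ![E 0, E 4] ∧
      star ![E 1, E 2, E 4, E 5] = a ![E 0, E 3] ∧ star ![E 1, E 3, E 4, E 5] = -a ![E 0, E 2] ∧
      star ![E 2, E 3, E 4, E 5] = a ![E 0, E 1] := by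
  have h := hodgeStarAt_sign (k := 2) (m := 4) rfl hE hg (ν := ν) hν a
  rw [← hstar] at h
  refine ⟨?_, ?_, ?_, ?_, ?_, ?_, ?_, ?_, ?_, ?_, ?_, ?_, ?_, ?_, ?_⟩
  · simpa [comp_vec_two, comp_vec_four] using
      h ![4, 5] ![0, 1, 2, 3] (by decide) 1 (by decide)
  · simpa [comp_vec_two, comp_vec_four] using
      h ![3, 5] ![0, 1, 2, 4] (by decide) (-1) (by decide)
  · simpa [comp_vec_two, comp_vec_four] using
      h ![3, 4] ![0, 1, 2, 5] (by decide) 1 (by decide)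
  · simpa [comp_vec_two, comp_vec_four] using
      h ![2, 5] ![0, 1, 3, 4] (by decide) 1 (by decide)
  · simpa [comp_vec_two, comp_vec_four] using
      h ![2, 4] ![0, 1, 3, 5] (by decide) (-1) (by decide)
  · simpa [comp_vec_two, comp_vec_four] using
      h ![2, 3] ![0, 1, 4, 5] (by decide) 1 (by decide)
  · simpa [comp_vec_two, comp_vec_four] using
      h ![1, 5] ![0, 2, 3, 4] (by decide) (-1) (by decide)
  · simpa [comp_vec_two, comp_vec_four] using
      h ![1, 4] ![0, 2, 3, 5] (by decide) 1 (by decide)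
  · simpa [comp_vec_two, comp_vec_four] using
      h ![1, 3] ![0, 2, 4, 5] (by decide) (-1) (by decide)
  · simpa [comp_vec_two, comp_vec_four] using
      h ![1, 2] ![0, 3, 4, 5] (by decide) 1 (by decide)
  · simpa [comp_vec_two, comp_vec_four] using
      h ![0, 5] ![1, 2, 3, 4] (by decide) 1 (by decide)
  · simpa [comp_vec_two, comp_vec_four] using
      h ![0, 4] ![1, 2, 3, 5] (by decide) (-1) (by decide)
  · simpa [comp_vec_two, comp_vec_four] using
      h ![0, 3] ![1, 2, 4, 5] (by decide) 1 (by decide)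
  · simpa [comp_vec_two, comp_vec_four] using
      h ![0, 2] ![1, 3, 4, 5] (by decide) (-1) (by decide)
  · simpa [comp_vec_two, comp_vec_four] using
      h ![0, 1] ![2, 3, 4, 5] (by decide) 1 (by decide)

theorem hodgeStarAt_three_three {g : V →L[ℝ] V →L[ℝ] ℝ} {e : Fin 6 → V →L[ℝ] ℝ}
    {E : Module.Basis (Fin 6) ℝ V} (hE : ∀ v i, E.repr v i = e i v)
    (hg : ∀ v w, g v w = ∑ i, e i v * e i w) {ν : V [⋀^Fin 6]→L[ℝ] ℝ} (hν : ν E = 1)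
    (a : V [⋀^Fin 3]→L[ℝ] ℝ) (star : V [⋀^Fin 3]→L[ℝ] ℝ)
    (hstar : star = hodgeStarAt (k := 3) 3 g ν a) :
      star ![E 0, E 1, E 2] = -a ![E 3, E 4, E 5] ∧ star ![E 0, E 1, E 3] = a ![E 2, E 4, E 5] ∧
      star ![E 0, E 1, E 4] = -a ![E 2, E 3, E 5] ∧ star ![E 0, E 1, E 5] = a ![E 2, E 3, E 4] ∧
      star ![E 0, E 2, E 3] = -a ![E 1, E 4, E 5] ∧ star ![E 0, E 2, E 4] = a ![E 1, E 3, E 5] ∧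
      star ![E 0, E 2, E 5] = -a ![E 1, E 3, E 4] ∧ star ![E 0, E 3, E 4] = -a ![E 1, E 2, E 5] ∧
      star ![E 0, E 3, E 5] = a ![E 1, E 2, E 4] ∧ star ![E 0, E 4, E 5] = -a ![E 1, E 2, E 3] ∧
      star ![E 1, E 2, E 3] = a ![E 0, E 4, E 5] ∧ star ![E 1, E 2, E 4] = -a ![E 0, E 3, E 5] ∧
      star ![E 1, E 2, E 5] = a ![E 0, E 3, E 4] ∧ star ![E 1, E 3, E 4] = a ![E 0, E 2, E 5] ∧
      star ![E 1, E 3, E 5] = -a ![E 0, E 2, E 4] ∧ star ![E 1, E 4, E 5] = a ![E 0, E 2, E 3] ∧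
      star ![E 2, E 3, E 4] = -a ![E 0, E 1, E 5] ∧ star ![E 2, E 3, E 5] = a ![E 0, E 1, E 4] ∧
      star ![E 2, E 4, E 5] = -a ![E 0, E 1, E 3] ∧ star ![E 3, E 4, E 5] = a ![E 0, E 1, E 2] := by
  have h := hodgeStarAt_sign (k := 3) (m := 3) rfl hE hg (ν := ν) hν a
  rw [← hstar] at h
  refine ⟨?_, ?_, ?_, ?_, ?_, ?_, ?_, ?_, ?_, ?_, ?_, ?_, ?_, ?_, ?_, ?_, ?_, ?_, ?_, ?_⟩
  · simpa [comp_vec_three, comp_vec_three] using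
      h ![3, 4, 5] ![0, 1, 2] (by decide) (-1) (by decide)
  · simpa [comp_vec_three, comp_vec_three] using
      h ![2, 4, 5] ![0, 1, 3] (by decide) 1 (by decide)
  · simpa [comp_vec_three, comp_vec_three] using
      h ![2, 3, 5] ![0, 1, 4] (by decide) (-1) (by decide)
  · simpa [comp_vec_three, comp_vec_three] using
      h ![2, 3, 4] ![0, 1, 5] (by decide) 1 (by decide)
  · simpa [comp_vec_three, comp_vec_three] using
      h ![1, 4, 5] ![0, 2, 3] (by decide) (-1) (by decide)
  · simpa [comp_vec_three, comp_vec_three] using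
      h ![1, 3, 5] ![0, 2, 4] (by decide) 1 (by decide)
  · simpa [comp_vec_three, comp_vec_three] using
      h ![1, 3, 4] ![0, 2, 5] (by decide) (-1) (by decide)
  · simpa [comp_vec_three, comp_vec_three] using
      h ![1, 2, 5] ![0, 3, 4] (by decide) (-1) (by decide)
  · simpa [comp_vec_three, comp_vec_three] using
      h ![1, 2, 4] ![0, 3, 5] (by decide) 1 (by decide)
  · simpa [comp_vec_three, comp_vec_three] using
      h ![1, 2, 3] ![0, 4, 5] (by decide) (-1) (by decide)
  · simpa [comp_vec_three, comp_vec_three] using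
      h ![0, 4, 5] ![1, 2, 3] (by decide) 1 (by decide)
  · simpa [comp_vec_three, comp_vec_three] using
      h ![0, 3, 5] ![1, 2, 4] (by decide) (-1) (by decide)
  · simpa [comp_vec_three, comp_vec_three] using
      h ![0, 3, 4] ![1, 2, 5] (by decide) 1 (by decide)
  · simpa [comp_vec_three, comp_vec_three] using
      h ![0, 2, 5] ![1, 3, 4] (by decide) 1 (by decide)
  · simpa [comp_vec_three, comp_vec_three] using
      h ![0, 2, 4] ![1, 3, 5] (by decide) (-1) (by decide)
  · simpa [comp_vec_three, comp_vec_three] using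
      h ![0, 2, 3] ![1, 4, 5] (by decide) 1 (by decide)
  · simpa [comp_vec_three, comp_vec_three] using
      h ![0, 1, 5] ![2, 3, 4] (by decide) (-1) (by decide)
  · simpa [comp_vec_three, comp_vec_three] using
      h ![0, 1, 4] ![2, 3, 5] (by decide) 1 (by decide)
  · simpa [comp_vec_three, comp_vec_three] using
      h ![0, 1, 3] ![2, 4, 5] (by decide) (-1) (by decide)
  · simpa [comp_vec_three, comp_vec_three] using
      h ![0, 1, 2] ![3, 4, 5] (by decide) 1 (by decide)

end Pointwise

section Pointwise

variable {V : Type*} [AddCommGroup V] [Module ℝ V] [TopologicalSpace V]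
  {g : V →L[ℝ] V →L[ℝ] ℝ} {ω₀ : V [⋀^Fin 2]→L[ℝ] ℝ} {ψp ψm : V [⋀^Fin 3]→L[ℝ] ℝ}
  {e : Fin 6 → V →L[ℝ] ℝ}

/-- Multiplying the complex volume form by the unit complex number `α + iβ`. -/
theorem IsSU3Coframe.rotate (h : IsSU3Coframe g ω₀ ψp ψm e) {α β : ℝ} (hαβ : α ^ 2 + β ^ 2 = 1) :
    IsSU3Coframe g ω₀ (α • ψp - β • ψm) (α • ψm + β • ψp)
      ![α • e 0 - β • e 1, β • e 0 + α • e 1, e 2, e 3, e 4, e 5] where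
  indep := by
    have hi := h.indep
    rw [Fintype.linearIndependent_iff] at hi ⊢
    intro c hc
    have h₁ := hi ![α * c 0 + β * c 1, -β * c 0 + α * c 1, c 2, c 3, c 4, c 5] (by
      rw [← hc]
      simp only [Fin.sum_univ_six, Matrix.cons_val]
      module)
    have h₀ := h₁ 0
    have h₂ := h₁ 1
    simp only [Matrix.cons_val] at h₀ h₂
    intro i
    fin_cases i
    · show c 0 = 0
      linear_combination α * h₀ - β * h₂ - c 0 * hαβ
    · show c 1 = 0
      linear_combination β * h₀ + α * h₂ - c 1 * hαβ
    · exact h₁ 2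
    · exact h₁ 3
    · exact h₁ 4
    · exact h₁ 5
  metric v w := by
    rw [h.metric]
    simp [Fin.sum_univ_six]
    linear_combination -(e 0 v * e 0 w + e 1 v * e 1 w) * hαβ
  omega := by
    rw [h.omega]
    ext v
    obtain ⟨x, y, rfl⟩ : ∃ x y, v = ![x, y] := ⟨v 0, v 1, by ext i; fin_cases i <;> rfl⟩
    simp [mono₂_apply]
    linear_combination -(e 0 x * e 1 y - e 0 y * e 1 x) * hαβ
  psi_plus := by
    rw [h.psi_plus, h.psi_minus]
    ext v
    obtain ⟨x, y, z, rfl⟩ : ∃ x y z, v = ![x, y, z] :=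
      ⟨v 0, v 1, v 2, by ext i; fin_cases i <;> rfl⟩
    simp [mono₃_apply]
    ring
  psi_minus := by
    rw [h.psi_plus, h.psi_minus]
    ext v
    obtain ⟨x, y, z, rfl⟩ : ∃ x y z, v = ![x, y, z] :=
      ⟨v 0, v 1, v 2, by ext i; fin_cases i <;> rfl⟩
    simp [mono₃_apply]
    ring

theorem IsSU3Coframe.omega_components (h : IsSU3Coframe g ω₀ ψp ψm e) {E : Fin 6 → V}
    (hE : ∀ i j, e i (E j) = if j = i then 1 else 0) :
      ω₀ ![E 0, E 1] = 1 ∧ ω₀ ![E 0, E 2] = 0 ∧ ω₀ ![E 0, E 3] = 0 ∧ ω₀ ![E 0, E 4] = 0 ∧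
      ω₀ ![E 0, E 5] = 0 ∧ ω₀ ![E 1, E 2] = 0 ∧ ω₀ ![E 1, E 3] = 0 ∧ ω₀ ![E 1, E 4] = 0 ∧
      ω₀ ![E 1, E 5] = 0 ∧ ω₀ ![E 2, E 3] = 1 ∧ ω₀ ![E 2, E 4] = 0 ∧ ω₀ ![E 2, E 5] = 0 ∧
      ω₀ ![E 3, E 4] = 0 ∧ ω₀ ![E 3, E 5] = 0 ∧ ω₀ ![E 4, E 5] = 1 := by
  refine ⟨?_, ?_, ?_, ?_, ?_, ?_, ?_, ?_, ?_, ?_, ?_, ?_, ?_, ?_, ?_⟩ <;>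
    simp [h.omega, mono₂_apply, hE]

theorem IsSU3Coframe.psi_plus_components (h : IsSU3Coframe g ω₀ ψp ψm e) {E : Fin 6 → V}
    (hE : ∀ i j, e i (E j) = if j = i then 1 else 0) :
      ψp ![E 0, E 1, E 2] = 0 ∧ ψp ![E 0, E 1, E 3] = 0 ∧ ψp ![E 0, E 1, E 4] = 0 ∧
      ψp ![E 0, E 1, E 5] = 0 ∧ ψp ![E 0, E 2, E 3] = 0 ∧ ψp ![E 0, E 2, E 4] = 1 ∧
      ψp ![E 0, E 2, E 5] = 0 ∧ ψp ![E 0, E 3, E 4] = 0 ∧ ψp ![E 0, E 3, E 5] = -1 ∧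
      ψp ![E 0, E 4, E 5] = 0 ∧ ψp ![E 1, E 2, E 3] = 0 ∧ ψp ![E 1, E 2, E 4] = 0 ∧
      ψp ![E 1, E 2, E 5] = -1 ∧ ψp ![E 1, E 3, E 4] = -1 ∧ ψp ![E 1, E 3, E 5] = 0 ∧
      ψp ![E 1, E 4, E 5] = 0 ∧ ψp ![E 2, E 3, E 4] = 0 ∧ ψp ![E 2, E 3, E 5] = 0 ∧
      ψp ![E 2, E 4, E 5] = 0 ∧ ψp ![E 3, E 4, E 5] = 0 := by
  refine ⟨?_, ?_, ?_, ?_, ?_, ?_, ?_, ?_, ?_, ?_, ?_, ?_, ?_, ?_, ?_, ?_, ?_, ?_, ?_, ?_⟩ <;>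
    simp [h.psi_plus, mono₃_apply, hE]

theorem IsSU3Coframe.psi_minus_components (h : IsSU3Coframe g ω₀ ψp ψm e) {E : Fin 6 → V}
    (hE : ∀ i j, e i (E j) = if j = i then 1 else 0) :
      ψm ![E 0, E 1, E 2] = 0 ∧ ψm ![E 0, E 1, E 3] = 0 ∧ ψm ![E 0, E 1, E 4] = 0 ∧
      ψm ![E 0, E 1, E 5] = 0 ∧ ψm ![E 0, E 2, E 3] = 0 ∧ ψm ![E 0, E 2, E 4] = 0 ∧
      ψm ![E 0, E 2, E 5] = 1 ∧ ψm ![E 0, E 3, E 4] = 1 ∧ ψm ![E 0, E 3, E 5] = 0 ∧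
      ψm ![E 0, E 4, E 5] = 0 ∧ ψm ![E 1, E 2, E 3] = 0 ∧ ψm ![E 1, E 2, E 4] = 1 ∧
      ψm ![E 1, E 2, E 5] = 0 ∧ ψm ![E 1, E 3, E 4] = 0 ∧ ψm ![E 1, E 3, E 5] = -1 ∧
      ψm ![E 1, E 4, E 5] = 0 ∧ ψm ![E 2, E 3, E 4] = 0 ∧ ψm ![E 2, E 3, E 5] = 0 ∧
      ψm ![E 2, E 4, E 5] = 0 ∧ ψm ![E 3, E 4, E 5] = 0 := by
  refine ⟨?_, ?_, ?_, ?_, ?_, ?_, ?_, ?_, ?_, ?_, ?_, ?_, ?_, ?_, ?_, ?_, ?_, ?_, ?_, ?_⟩ <;>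
    simp [h.psi_minus, mono₃_apply, hE]

/-- `ω₀³ / 6` is the volume form of adapted coframes. -/
theorem IsSU3Coframe.volume (h : IsSU3Coframe g ω₀ ψp ψm e) {E : Fin 6 → V}
    (hE : ∀ i j, e i (E j) = if j = i then 1 else 0) :
    (1 / 6 : ℝ) * wedgeOf (n := 6) rfl (wedgeAt ω₀ ω₀) ω₀ E = 1 := by
  obtain ⟨w01, w02, w03, w04, w05, w12, w13, w14, w15, w23, w24, w25, w34, w35, w45⟩ :=
    h.omega_components hE
  have hE' := tuple_six E
  rw [wedgeOf_apply]
  rw [hE', wedgeTo_four_two]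
  simp only [wedgeAt_two_two, w01, w02, w03, w04, w05, w12, w13, w14, w15, w23, w24, w25, w34, w35, w45]
  norm_num

theorem IsSU3Coframe.wedge_omega_components (h : IsSU3Coframe g ω₀ ψp ψm e) {E : Fin 6 → V}
    (hE : ∀ i j, e i (E j) = if j = i then 1 else 0) (a : V [⋀^Fin 2]→L[ℝ] ℝ) :
      wedgeAt a ω₀ ![E 0, E 1, E 2, E 3] = a ![E 0, E 1] + a ![E 2, E 3] ∧
      wedgeAt a ω₀ ![E 0, E 1, E 2, E 4] = a ![E 2, E 4] ∧
      wedgeAt a ω₀ ![E 0, E 1, E 2, E 5] = a ![E 2, E 5] ∧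
      wedgeAt a ω₀ ![E 0, E 1, E 3, E 4] = a ![E 3, E 4] ∧
      wedgeAt a ω₀ ![E 0, E 1, E 3, E 5] = a ![E 3, E 5] ∧
      wedgeAt a ω₀ ![E 0, E 1, E 4, E 5] = a ![E 0, E 1] + a ![E 4, E 5] ∧
      wedgeAt a ω₀ ![E 0, E 2, E 3, E 4] = a ![E 0, E 4] ∧
      wedgeAt a ω₀ ![E 0, E 2, E 3, E 5] = a ![E 0, E 5] ∧
      wedgeAt a ω₀ ![E 0, E 2, E 4, E 5] = a ![E 0, E 2] ∧
      wedgeAt a ω₀ ![E 0, E 3, E 4, E 5] = a ![E 0, E 3] ∧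
      wedgeAt a ω₀ ![E 1, E 2, E 3, E 4] = a ![E 1, E 4] ∧
      wedgeAt a ω₀ ![E 1, E 2, E 3, E 5] = a ![E 1, E 5] ∧
      wedgeAt a ω₀ ![E 1, E 2, E 4, E 5] = a ![E 1, E 2] ∧
      wedgeAt a ω₀ ![E 1, E 3, E 4, E 5] = a ![E 1, E 3] ∧
      wedgeAt a ω₀ ![E 2, E 3, E 4, E 5] = a ![E 2, E 3] + a ![E 4, E 5] := by
  obtain ⟨w01, w02, w03, w04, w05, w12, w13, w14, w15, w23, w24, w25, w34, w35, w45⟩ :=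
    h.omega_components hE
  refine ⟨?_, ?_, ?_, ?_, ?_, ?_, ?_, ?_, ?_, ?_, ?_, ?_, ?_, ?_, ?_⟩ <;>
    simp only [wedgeAt_two_two, w01, w02, w03, w04, w05, w12, w13, w14, w15, w23, w24, w25, w34, w35, w45] <;>
    ring

end Pointwise

section Pointwise

variable {V : Type*} [AddCommGroup V] [Module ℝ V] [TopologicalSpace V] [Module.Finite ℝ V]
  {g : V →L[ℝ] V →L[ℝ] ℝ} {ω₀ : V [⋀^Fin 2]→L[ℝ] ℝ} {ψp ψm : V [⋀^Fin 3]→L[ℝ] ℝ}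
  {e : Fin 6 → V →L[ℝ] ℝ}

/-- `⋆ψ₊ = ψ₋`. -/
theorem IsSU3Coframe.star_psi_plus (h : IsSU3Coframe g ω₀ ψp ψm e)
    {E : Module.Basis (Fin 6) ℝ V} (hE : ∀ v i, E.repr v i = e i v) {ν : V [⋀^Fin 6]→L[ℝ] ℝ}
    (hν : ν E = 1) :
    hodgeStarAt (k := 3) 3 g ν ψp = ψm := by
  obtain ⟨p012, p013, p014, p015, p023, p024, p025, p034, p035, p045, p123, p124, p125, p134, p135,
    p145, p234, p235, p245, p345⟩ :=
    h.psi_plus_components (dual_basis_apply hE)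
  obtain ⟨m012, m013, m014, m015, m023, m024, m025, m034, m035, m045, m123, m124, m125, m134, m135,
    m145, m234, m235, m245, m345⟩ :=
    h.psi_minus_components (dual_basis_apply hE)
  obtain ⟨s012, s013, s014, s015, s023, s024, s025, s034, s035, s045, s123, s124, s125, s134, s135,
    s145, s234, s235, s245, s345⟩ :=
    hodgeStarAt_three_three hE h.metric hν ψp _ rfl
  refine ext_three_six E ⟨?_, ?_, ?_, ?_, ?_, ?_, ?_, ?_, ?_, ?_, ?_, ?_, ?_, ?_, ?_, ?_, ?_,
      ?_, ?_, ?_⟩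
  · norm_num [s012, p345, m012]
  · norm_num [s013, p245, m013]
  · norm_num [s014, p235, m014]
  · norm_num [s015, p234, m015]
  · norm_num [s023, p145, m023]
  · norm_num [s024, p135, m024]
  · norm_num [s025, p134, m025]
  · norm_num [s034, p125, m034]
  · norm_num [s035, p124, m035]
  · norm_num [s045, p123, m045]
  · norm_num [s123, p045, m123]
  · norm_num [s124, p035, m124]
  · norm_num [s125, p034, m125]
  · norm_num [s134, p025, m134]
  · norm_num [s135, p024, m135]
  · norm_num [s145, p023, m145]
  · norm_num [s234, p015, m234]
  · norm_num [s235, p014, m235]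
  · norm_num [s245, p013, m245]
  · norm_num [s345, p012, m345]

/-- `⋆(½ ω²) = ω`. -/
theorem IsSU3Coframe.star_omega_sq (h : IsSU3Coframe g ω₀ ψp ψm e)
    {E : Module.Basis (Fin 6) ℝ V} (hE : ∀ v i, E.repr v i = e i v) {ν : V [⋀^Fin 6]→L[ℝ] ℝ}
    (hν : ν E = 1) :
    hodgeStarAt (k := 4) 2 g ν ((1 / 2 : ℝ) • wedgeAt ω₀ ω₀) = ω₀ := by
  obtain ⟨w01, w02, w03, w04, w05, w12, w13, w14, w15, w23, w24, w25, w34, w35, w45⟩ :=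
    h.omega_components (dual_basis_apply hE)
  obtain ⟨q0123, q0124, q0125, q0134, q0135, q0145, q0234, q0235, q0245, q0345, q1234, q1235,
    q1245, q1345, q2345⟩ :=
    h.wedge_omega_components (dual_basis_apply hE) ω₀
  obtain ⟨s01, s02, s03, s04, s05, s12, s13, s14, s15, s23, s24, s25, s34, s35, s45⟩ :=
    hodgeStarAt_four_two hE h.metric hν ((1 / 2 : ℝ) • wedgeAt ω₀ ω₀) _ rfl
  refine ext_two_six E ⟨?_, ?_, ?_, ?_, ?_, ?_, ?_, ?_, ?_, ?_, ?_, ?_, ?_, ?_, ?_⟩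
  · rw [s01, ContinuousAlternatingMap.smul_apply, q2345, w01, w23, w45]; norm_num
  · rw [s02, ContinuousAlternatingMap.smul_apply, q1345, w02, w13]; norm_num
  · rw [s03, ContinuousAlternatingMap.smul_apply, q1245, w03, w12]; norm_num
  · rw [s04, ContinuousAlternatingMap.smul_apply, q1235, w04, w15]; norm_num
  · rw [s05, ContinuousAlternatingMap.smul_apply, q1234, w05, w14]; norm_num
  · rw [s12, ContinuousAlternatingMap.smul_apply, q0345, w03, w12]; norm_num
  · rw [s13, ContinuousAlternatingMap.smul_apply, q0245, w02, w13]; norm_num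
  · rw [s14, ContinuousAlternatingMap.smul_apply, q0235, w05, w14]; norm_num
  · rw [s15, ContinuousAlternatingMap.smul_apply, q0234, w04, w15]; norm_num
  · rw [s23, ContinuousAlternatingMap.smul_apply, q0145, w01, w23, w45]; norm_num
  · rw [s24, ContinuousAlternatingMap.smul_apply, q0135, w24, w35]; norm_num
  · rw [s25, ContinuousAlternatingMap.smul_apply, q0134, w25, w34]; norm_num
  · rw [s34, ContinuousAlternatingMap.smul_apply, q0125, w25, w34]; norm_num
  · rw [s35, ContinuousAlternatingMap.smul_apply, q0124, w24, w35]; norm_num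
  · rw [s45, ContinuousAlternatingMap.smul_apply, q0123, w01, w23, w45]; norm_num

omit [Module.Finite ℝ V] in
theorem map_vec_two_swap (a : V [⋀^Fin 2]→L[ℝ] ℝ) (x y : V) : a ![y, x] = -a ![x, y] := by
  have h := a.toAlternatingMap.map_swap ![x, y] (i := 0) (j := 1) (by decide)
  have h₁ : (![x, y] : Fin 2 → V) ∘ Equiv.swap 0 1 = ![y, x] := by
    funext i; fin_cases i <;> simp
  rw [h₁] at h
  exact h

omit [Module.Finite ℝ V] in
theorem map_vec_two_neg_left (a : V [⋀^Fin 2]→L[ℝ] ℝ) (x y : V) : a ![-x, y] = -a ![x, y] := by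
  have h := a.vecCons_smul ![y] (-1) x
  simpa using h

omit [Module.Finite ℝ V] in
theorem map_vec_two_neg_right (a : V [⋀^Fin 2]→L[ℝ] ℝ) (x y : V) : a ![x, -y] = -a ![x, y] := by
  rw [map_vec_two_swap, map_vec_two_neg_left, ← map_vec_two_swap]

omit [Module.Finite ℝ V] in
theorem IsSU3Coframe.complexStructure_apply (h : IsSU3Coframe g ω₀ ψp ψm e)
    {E : Module.Basis (Fin 6) ℝ V} (hE : ∀ v i, E.repr v i = e i v) {J : V →L[ℝ] V}
    (hJ : ∀ v w, ω₀ ![v, w] = g (J v) w) :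
    J (E 0) = E 1 ∧ J (E 1) = -E 0 ∧ J (E 2) = E 3 ∧ J (E 3) = -E 2 ∧ J (E 4) = E 5 ∧
      J (E 5) = -E 4 := by
  have h₁ : ∀ v i, e i (J v) = ω₀ ![v, E i] := by
    intro v i
    rw [hJ, h.metric]
    simp [dual_basis_apply hE]
  have h₂ : ∀ v w, (∀ i, ω₀ ![v, E i] = e i w) → J v = w := by
    intro v w hvw
    apply E.repr.injective
    ext i
    rw [hE, hE, h₁, hvw]
  refine ⟨h₂ _ _ fun i => ?_, h₂ _ _ fun i => ?_, h₂ _ _ fun i => ?_, h₂ _ _ fun i => ?_,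
    h₂ _ _ fun i => ?_, h₂ _ _ fun i => ?_⟩ <;>
  fin_cases i <;> simp [h.omega, mono₂_apply, dual_basis_apply hE]

omit [Module.Finite ℝ V] in
theorem comp_apply_two {W : Type*} [AddCommGroup W] [Module ℝ W] [TopologicalSpace W]
    (a : W [⋀^Fin 2]→L[ℝ] ℝ) (P : V →L[ℝ] W) (x y : V) :
    a.compContinuousLinearMap P ![x, y] = a ![P x, P y] := by
  rw [ContinuousAlternatingMap.compContinuousLinearMap_apply]
  congr 1
  funext i; fin_cases i <;> rfl

/-- Primitive `(1,1)`-forms satisfy `⋆(σ ∧ ω) = -σ`. -/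
theorem IsSU3Coframe.star_wedge_omega (h : IsSU3Coframe g ω₀ ψp ψm e)
    {E : Module.Basis (Fin 6) ℝ V} (hE : ∀ v i, E.repr v i = e i v) {ν : V [⋀^Fin 6]→L[ℝ] ℝ}
    (hν : ν E = 1) {J : V →L[ℝ] V}
    (hJ : ∀ v w, ω₀ ![v, w] = g (J v) w) {σ : V [⋀^Fin 2]→L[ℝ] ℝ} (hσ : wedgeAt σ ψp = 0)
    (hstar : hodgeStarAt (k := 2) 4 g ν (σ.compContinuousLinearMap J) = -wedgeAt σ ω₀) :
    hodgeStarAt (k := 4) 2 g ν (wedgeAt σ ω₀) = -σ := by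
  obtain ⟨J0, J1, J2, J3, J4, J5⟩ := h.complexStructure_apply hE hJ
  obtain ⟨p012, p013, p014, p015, p023, p024, p025, p034, p035, p045, p123, p124, p125, p134, p135,
    p145, p234, p235, p245, p345⟩ :=
    h.psi_plus_components (dual_basis_apply hE)
  obtain ⟨q0123, q0124, q0125, q0134, q0135, q0145, q0234, q0235, q0245, q0345, q1234, q1235,
    q1245, q1345, q2345⟩ :=
    h.wedge_omega_components (dual_basis_apply hE) σ
  obtain ⟨s0123, s0124, s0125, s0134, s0135, s0145, s0234, s0235, s0245, s0345, s1234, s1235,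
    s1245, s1345, s2345⟩ :=
    hodgeStarAt_two_four hE h.metric hν (σ.compContinuousLinearMap J) _ rfl
  obtain ⟨r01, r02, r03, r04, r05, r12, r13, r14, r15, r23, r24, r25, r34, r35, r45⟩ :=
    hodgeStarAt_four_two hE h.metric hν (wedgeAt σ ω₀) _ rfl
  have j01 : σ.compContinuousLinearMap J ![E 0, E 1] = σ ![E 0, E 1] := by
    rw [comp_apply_two, J0, J1, map_vec_two_neg_right, map_vec_two_swap, neg_neg]
  have y01 : hodgeStarAt (k := 2) 4 g ν (σ.compContinuousLinearMap J) ![E 2, E 3, E 4, E 5] =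
      -wedgeAt σ ω₀ ![E 2, E 3, E 4, E 5] := by rw [hstar]; rfl
  rw [s2345, j01, q2345] at y01
  have j02 : σ.compContinuousLinearMap J ![E 0, E 2] = σ ![E 1, E 3] := by
    rw [comp_apply_two, J0, J2]
  have y02 : hodgeStarAt (k := 2) 4 g ν (σ.compContinuousLinearMap J) ![E 1, E 3, E 4, E 5] =
      -wedgeAt σ ω₀ ![E 1, E 3, E 4, E 5] := by rw [hstar]; rfl
  rw [s1345, j02, q1345] at y02
  have j03 : σ.compContinuousLinearMap J ![E 0, E 3] = -σ ![E 1, E 2] := by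
    rw [comp_apply_two, J0, J3, map_vec_two_neg_right]
  have y03 : hodgeStarAt (k := 2) 4 g ν (σ.compContinuousLinearMap J) ![E 1, E 2, E 4, E 5] =
      -wedgeAt σ ω₀ ![E 1, E 2, E 4, E 5] := by rw [hstar]; rfl
  rw [s1245, j03, q1245] at y03
  have j04 : σ.compContinuousLinearMap J ![E 0, E 4] = σ ![E 1, E 5] := by
    rw [comp_apply_two, J0, J4]
  have y04 : hodgeStarAt (k := 2) 4 g ν (σ.compContinuousLinearMap J) ![E 1, E 2, E 3, E 5] =
      -wedgeAt σ ω₀ ![E 1, E 2, E 3, E 5] := by rw [hstar]; rfl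
  rw [s1235, j04, q1235] at y04
  have j05 : σ.compContinuousLinearMap J ![E 0, E 5] = -σ ![E 1, E 4] := by
    rw [comp_apply_two, J0, J5, map_vec_two_neg_right]
  have y05 : hodgeStarAt (k := 2) 4 g ν (σ.compContinuousLinearMap J) ![E 1, E 2, E 3, E 4] =
      -wedgeAt σ ω₀ ![E 1, E 2, E 3, E 4] := by rw [hstar]; rfl
  rw [s1234, j05, q1234] at y05
  have j12 : σ.compContinuousLinearMap J ![E 1, E 2] = -σ ![E 0, E 3] := by
    rw [comp_apply_two, J1, J2, map_vec_two_neg_left]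
  have y12 : hodgeStarAt (k := 2) 4 g ν (σ.compContinuousLinearMap J) ![E 0, E 3, E 4, E 5] =
      -wedgeAt σ ω₀ ![E 0, E 3, E 4, E 5] := by rw [hstar]; rfl
  rw [s0345, j12, q0345] at y12
  have j13 : σ.compContinuousLinearMap J ![E 1, E 3] = σ ![E 0, E 2] := by
    rw [comp_apply_two, J1, J3, map_vec_two_neg_left, map_vec_two_neg_right, neg_neg]
  have y13 : hodgeStarAt (k := 2) 4 g ν (σ.compContinuousLinearMap J) ![E 0, E 2, E 4, E 5] =
      -wedgeAt σ ω₀ ![E 0, E 2, E 4, E 5] := by rw [hstar]; rfl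
  rw [s0245, j13, q0245] at y13
  have j14 : σ.compContinuousLinearMap J ![E 1, E 4] = -σ ![E 0, E 5] := by
    rw [comp_apply_two, J1, J4, map_vec_two_neg_left]
  have y14 : hodgeStarAt (k := 2) 4 g ν (σ.compContinuousLinearMap J) ![E 0, E 2, E 3, E 5] =
      -wedgeAt σ ω₀ ![E 0, E 2, E 3, E 5] := by rw [hstar]; rfl
  rw [s0235, j14, q0235] at y14
  have j15 : σ.compContinuousLinearMap J ![E 1, E 5] = σ ![E 0, E 4] := by
    rw [comp_apply_two, J1, J5, map_vec_two_neg_left, map_vec_two_neg_right, neg_neg]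
  have y15 : hodgeStarAt (k := 2) 4 g ν (σ.compContinuousLinearMap J) ![E 0, E 2, E 3, E 4] =
      -wedgeAt σ ω₀ ![E 0, E 2, E 3, E 4] := by rw [hstar]; rfl
  rw [s0234, j15, q0234] at y15
  have j23 : σ.compContinuousLinearMap J ![E 2, E 3] = σ ![E 2, E 3] := by
    rw [comp_apply_two, J2, J3, map_vec_two_neg_right, map_vec_two_swap, neg_neg]
  have y23 : hodgeStarAt (k := 2) 4 g ν (σ.compContinuousLinearMap J) ![E 0, E 1, E 4, E 5] =
      -wedgeAt σ ω₀ ![E 0, E 1, E 4, E 5] := by rw [hstar]; rfl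
  rw [s0145, j23, q0145] at y23
  have j24 : σ.compContinuousLinearMap J ![E 2, E 4] = σ ![E 3, E 5] := by
    rw [comp_apply_two, J2, J4]
  have y24 : hodgeStarAt (k := 2) 4 g ν (σ.compContinuousLinearMap J) ![E 0, E 1, E 3, E 5] =
      -wedgeAt σ ω₀ ![E 0, E 1, E 3, E 5] := by rw [hstar]; rfl
  rw [s0135, j24, q0135] at y24
  have j25 : σ.compContinuousLinearMap J ![E 2, E 5] = -σ ![E 3, E 4] := by
    rw [comp_apply_two, J2, J5, map_vec_two_neg_right]
  have y25 : hodgeStarAt (k := 2) 4 g ν (σ.compContinuousLinearMap J) ![E 0, E 1, E 3, E 4] =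
      -wedgeAt σ ω₀ ![E 0, E 1, E 3, E 4] := by rw [hstar]; rfl
  rw [s0134, j25, q0134] at y25
  have j34 : σ.compContinuousLinearMap J ![E 3, E 4] = -σ ![E 2, E 5] := by
    rw [comp_apply_two, J3, J4, map_vec_two_neg_left]
  have y34 : hodgeStarAt (k := 2) 4 g ν (σ.compContinuousLinearMap J) ![E 0, E 1, E 2, E 5] =
      -wedgeAt σ ω₀ ![E 0, E 1, E 2, E 5] := by rw [hstar]; rfl
  rw [s0125, j34, q0125] at y34
  have j35 : σ.compContinuousLinearMap J ![E 3, E 5] = σ ![E 2, E 4] := by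
    rw [comp_apply_two, J3, J5, map_vec_two_neg_left, map_vec_two_neg_right, neg_neg]
  have y35 : hodgeStarAt (k := 2) 4 g ν (σ.compContinuousLinearMap J) ![E 0, E 1, E 2, E 4] =
      -wedgeAt σ ω₀ ![E 0, E 1, E 2, E 4] := by rw [hstar]; rfl
  rw [s0124, j35, q0124] at y35
  have j45 : σ.compContinuousLinearMap J ![E 4, E 5] = σ ![E 4, E 5] := by
    rw [comp_apply_two, J4, J5, map_vec_two_neg_right, map_vec_two_swap, neg_neg]
  have y45 : hodgeStarAt (k := 2) 4 g ν (σ.compContinuousLinearMap J) ![E 0, E 1, E 2, E 3] =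
      -wedgeAt σ ω₀ ![E 0, E 1, E 2, E 3] := by rw [hstar]; rfl
  rw [s0123, j45, q0123] at y45
  have z01234 : wedgeAt σ ψp ![E 0, E 1, E 2, E 3, E 4] = 0 := by rw [hσ]; rfl
  simp only [wedgeAt_two_three, p012, p013, p014, p023, p024, p034, p123, p124, p134,
      p234] at z01234
  have z01235 : wedgeAt σ ψp ![E 0, E 1, E 2, E 3, E 5] = 0 := by rw [hσ]; rfl
  simp only [wedgeAt_two_three, p012, p013, p015, p023, p025, p035, p123, p125, p135,
      p235] at z01235
  have z01245 : wedgeAt σ ψp ![E 0, E 1, E 2, E 4, E 5] = 0 := by rw [hσ]; rfl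
  simp only [wedgeAt_two_three, p012, p014, p015, p024, p025, p045, p124, p125, p145,
      p245] at z01245
  have z01345 : wedgeAt σ ψp ![E 0, E 1, E 3, E 4, E 5] = 0 := by rw [hσ]; rfl
  simp only [wedgeAt_two_three, p013, p014, p015, p034, p035, p045, p134, p135, p145,
      p345] at z01345
  have z02345 : wedgeAt σ ψp ![E 0, E 2, E 3, E 4, E 5] = 0 := by rw [hσ]; rfl
  simp only [wedgeAt_two_three, p023, p024, p025, p034, p035, p045, p234, p235, p245,
      p345] at z02345
  have z12345 : wedgeAt σ ψp ![E 1, E 2, E 3, E 4, E 5] = 0 := by rw [hσ]; rfl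
  simp only [wedgeAt_two_three, p123, p124, p125, p134, p135, p145, p234, p235, p245,
      p345] at z12345
  refine ext_two_six E ⟨?_, ?_, ?_, ?_, ?_, ?_, ?_, ?_, ?_, ?_, ?_, ?_, ?_, ?_, ?_⟩
  · rw [r01, q2345, ContinuousAlternatingMap.neg_apply]
    linear_combination y01
  · rw [r02, q1345, ContinuousAlternatingMap.neg_apply]
    linear_combination z01234
  · rw [r03, q1245, ContinuousAlternatingMap.neg_apply]
    linear_combination -z01235
  · rw [r04, q1235, ContinuousAlternatingMap.neg_apply]
    linear_combination -z01245
  · rw [r05, q1234, ContinuousAlternatingMap.neg_apply]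
    linear_combination z01345
  · rw [r12, q0345, ContinuousAlternatingMap.neg_apply]
    linear_combination -z01235
  · rw [r13, q0245, ContinuousAlternatingMap.neg_apply]
    linear_combination -z01234
  · rw [r14, q0235, ContinuousAlternatingMap.neg_apply]
    linear_combination z01345
  · rw [r15, q0234, ContinuousAlternatingMap.neg_apply]
    linear_combination z01245
  · rw [r23, q0145, ContinuousAlternatingMap.neg_apply]
    linear_combination y01
  · rw [r24, q0135, ContinuousAlternatingMap.neg_apply]
    linear_combination z02345
  · rw [r25, q0134, ContinuousAlternatingMap.neg_apply]
    linear_combination -z12345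
  · rw [r34, q0125, ContinuousAlternatingMap.neg_apply]
    linear_combination -z12345
  · rw [r35, q0124, ContinuousAlternatingMap.neg_apply]
    linear_combination -z02345
  · rw [r45, q0123, ContinuousAlternatingMap.neg_apply]
    linear_combination y01

/-- The components `(1)`, `(6)` and `(8)` of a `4`-form are independent. -/
theorem IsSU3Coframe.four_form_components_eq_zero (h : IsSU3Coframe g ω₀ ψp ψm e)
    {E : Module.Basis (Fin 6) ℝ V} (hE : ∀ v i, E.repr v i = e i v) {ν : V [⋀^Fin 6]→L[ℝ] ℝ}
    (hν : ν E = 1) {p : ℝ} {θ : V [⋀^Fin 1]→L[ℝ] ℝ}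
    {σ : V [⋀^Fin 2]→L[ℝ] ℝ} (hstar : hodgeStarAt (k := 4) 2 g ν (wedgeAt σ ω₀) = -σ)
    (heq : p • wedgeAt ω₀ ω₀ + wedgeAt θ ψp - wedgeAt σ ω₀ = 0) : θ = 0 ∧ σ = 0 := by
  obtain ⟨w01, w02, w03, w04, w05, w12, w13, w14, w15, w23, w24, w25, w34, w35, w45⟩ :=
    h.omega_components (dual_basis_apply hE)
  obtain ⟨p012, p013, p014, p015, p023, p024, p025, p034, p035, p045, p123, p124, p125, p134, p135,
    p145, p234, p235, p245, p345⟩ :=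
    h.psi_plus_components (dual_basis_apply hE)
  obtain ⟨q0123, q0124, q0125, q0134, q0135, q0145, q0234, q0235, q0245, q0345, q1234, q1235,
    q1245, q1345, q2345⟩ :=
    h.wedge_omega_components (dual_basis_apply hE) σ
  obtain ⟨v0123, v0124, v0125, v0134, v0135, v0145, v0234, v0235, v0245, v0345, v1234, v1235,
    v1245, v1345, v2345⟩ :=
    h.wedge_omega_components (dual_basis_apply hE) ω₀
  obtain ⟨r01, r02, r03, r04, r05, r12, r13, r14, r15, r23, r24, r25, r34, r35, r45⟩ :=
    hodgeStarAt_four_two hE h.metric hν (wedgeAt σ ω₀) _ rfl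
  have y01 : hodgeStarAt (k := 4) 2 g ν (wedgeAt σ ω₀) ![E 0, E 1] = -σ ![E 0, E 1] := by
    rw [hstar]; rfl
  rw [r01, q2345] at y01
  have y02 : hodgeStarAt (k := 4) 2 g ν (wedgeAt σ ω₀) ![E 0, E 2] = -σ ![E 0, E 2] := by
    rw [hstar]; rfl
  rw [r02, q1345] at y02
  have y03 : hodgeStarAt (k := 4) 2 g ν (wedgeAt σ ω₀) ![E 0, E 3] = -σ ![E 0, E 3] := by
    rw [hstar]; rfl
  rw [r03, q1245] at y03
  have y04 : hodgeStarAt (k := 4) 2 g ν (wedgeAt σ ω₀) ![E 0, E 4] = -σ ![E 0, E 4] := by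
    rw [hstar]; rfl
  rw [r04, q1235] at y04
  have y05 : hodgeStarAt (k := 4) 2 g ν (wedgeAt σ ω₀) ![E 0, E 5] = -σ ![E 0, E 5] := by
    rw [hstar]; rfl
  rw [r05, q1234] at y05
  have y12 : hodgeStarAt (k := 4) 2 g ν (wedgeAt σ ω₀) ![E 1, E 2] = -σ ![E 1, E 2] := by
    rw [hstar]; rfl
  rw [r12, q0345] at y12
  have y13 : hodgeStarAt (k := 4) 2 g ν (wedgeAt σ ω₀) ![E 1, E 3] = -σ ![E 1, E 3] := by
    rw [hstar]; rfl
  rw [r13, q0245] at y13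
  have y14 : hodgeStarAt (k := 4) 2 g ν (wedgeAt σ ω₀) ![E 1, E 4] = -σ ![E 1, E 4] := by
    rw [hstar]; rfl
  rw [r14, q0235] at y14
  have y15 : hodgeStarAt (k := 4) 2 g ν (wedgeAt σ ω₀) ![E 1, E 5] = -σ ![E 1, E 5] := by
    rw [hstar]; rfl
  rw [r15, q0234] at y15
  have y23 : hodgeStarAt (k := 4) 2 g ν (wedgeAt σ ω₀) ![E 2, E 3] = -σ ![E 2, E 3] := by
    rw [hstar]; rfl
  rw [r23, q0145] at y23
  have y24 : hodgeStarAt (k := 4) 2 g ν (wedgeAt σ ω₀) ![E 2, E 4] = -σ ![E 2, E 4] := by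
    rw [hstar]; rfl
  rw [r24, q0135] at y24
  have y25 : hodgeStarAt (k := 4) 2 g ν (wedgeAt σ ω₀) ![E 2, E 5] = -σ ![E 2, E 5] := by
    rw [hstar]; rfl
  rw [r25, q0134] at y25
  have y34 : hodgeStarAt (k := 4) 2 g ν (wedgeAt σ ω₀) ![E 3, E 4] = -σ ![E 3, E 4] := by
    rw [hstar]; rfl
  rw [r34, q0125] at y34
  have y35 : hodgeStarAt (k := 4) 2 g ν (wedgeAt σ ω₀) ![E 3, E 5] = -σ ![E 3, E 5] := by
    rw [hstar]; rfl
  rw [r35, q0124] at y35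
  have y45 : hodgeStarAt (k := 4) 2 g ν (wedgeAt σ ω₀) ![E 4, E 5] = -σ ![E 4, E 5] := by
    rw [hstar]; rfl
  rw [r45, q0123] at y45
  have z0123 : p * wedgeAt ω₀ ω₀ ![E 0, E 1, E 2, E 3] + wedgeAt θ ψp ![E 0, E 1, E 2, E 3] -
      wedgeAt σ ω₀ ![E 0, E 1, E 2, E 3] = 0 := congrArg (fun a : V [⋀^Fin 4]→L[ℝ] ℝ => a ![E 0,
          E 1, E 2, E 3]) heq
  simp only [wedgeAt_one_three, p012, p013, p023, p123, q0123, v0123, w01, w23] at z0123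
  have z0124 : p * wedgeAt ω₀ ω₀ ![E 0, E 1, E 2, E 4] + wedgeAt θ ψp ![E 0, E 1, E 2, E 4] -
      wedgeAt σ ω₀ ![E 0, E 1, E 2, E 4] = 0 := congrArg (fun a : V [⋀^Fin 4]→L[ℝ] ℝ => a ![E 0,
          E 1, E 2, E 4]) heq
  simp only [wedgeAt_one_three, p012, p014, p024, p124, q0124, v0124, w24] at z0124
  have z0125 : p * wedgeAt ω₀ ω₀ ![E 0, E 1, E 2, E 5] + wedgeAt θ ψp ![E 0, E 1, E 2, E 5] -
      wedgeAt σ ω₀ ![E 0, E 1, E 2, E 5] = 0 := congrArg (fun a : V [⋀^Fin 4]→L[ℝ] ℝ => a ![E 0,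
          E 1, E 2, E 5]) heq
  simp only [wedgeAt_one_three, p012, p015, p025, p125, q0125, v0125, w25] at z0125
  have z0134 : p * wedgeAt ω₀ ω₀ ![E 0, E 1, E 3, E 4] + wedgeAt θ ψp ![E 0, E 1, E 3, E 4] -
      wedgeAt σ ω₀ ![E 0, E 1, E 3, E 4] = 0 := congrArg (fun a : V [⋀^Fin 4]→L[ℝ] ℝ => a ![E 0,
          E 1, E 3, E 4]) heq
  simp only [wedgeAt_one_three, p013, p014, p034, p134, q0134, v0134, w34] at z0134
  have z0135 : p * wedgeAt ω₀ ω₀ ![E 0, E 1, E 3, E 5] + wedgeAt θ ψp ![E 0, E 1, E 3, E 5] -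
      wedgeAt σ ω₀ ![E 0, E 1, E 3, E 5] = 0 := congrArg (fun a : V [⋀^Fin 4]→L[ℝ] ℝ => a ![E 0,
          E 1, E 3, E 5]) heq
  simp only [wedgeAt_one_three, p013, p015, p035, p135, q0135, v0135, w35] at z0135
  have z0145 : p * wedgeAt ω₀ ω₀ ![E 0, E 1, E 4, E 5] + wedgeAt θ ψp ![E 0, E 1, E 4, E 5] -
      wedgeAt σ ω₀ ![E 0, E 1, E 4, E 5] = 0 := congrArg (fun a : V [⋀^Fin 4]→L[ℝ] ℝ => a ![E 0,
          E 1, E 4, E 5]) heq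
  simp only [wedgeAt_one_three, p014, p015, p045, p145, q0145, v0145, w01, w45] at z0145
  have z0234 : p * wedgeAt ω₀ ω₀ ![E 0, E 2, E 3, E 4] + wedgeAt θ ψp ![E 0, E 2, E 3, E 4] -
      wedgeAt σ ω₀ ![E 0, E 2, E 3, E 4] = 0 := congrArg (fun a : V [⋀^Fin 4]→L[ℝ] ℝ => a ![E 0,
          E 2, E 3, E 4]) heq
  simp only [wedgeAt_one_three, p023, p024, p034, p234, q0234, v0234, w04] at z0234
  have z0235 : p * wedgeAt ω₀ ω₀ ![E 0, E 2, E 3, E 5] + wedgeAt θ ψp ![E 0, E 2, E 3, E 5] -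
      wedgeAt σ ω₀ ![E 0, E 2, E 3, E 5] = 0 := congrArg (fun a : V [⋀^Fin 4]→L[ℝ] ℝ => a ![E 0,
          E 2, E 3, E 5]) heq
  simp only [wedgeAt_one_three, p023, p025, p035, p235, q0235, v0235, w05] at z0235
  have z0245 : p * wedgeAt ω₀ ω₀ ![E 0, E 2, E 4, E 5] + wedgeAt θ ψp ![E 0, E 2, E 4, E 5] -
      wedgeAt σ ω₀ ![E 0, E 2, E 4, E 5] = 0 := congrArg (fun a : V [⋀^Fin 4]→L[ℝ] ℝ => a ![E 0,
          E 2, E 4, E 5]) heq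
  simp only [wedgeAt_one_three, p024, p025, p045, p245, q0245, v0245, w02] at z0245
  have z0345 : p * wedgeAt ω₀ ω₀ ![E 0, E 3, E 4, E 5] + wedgeAt θ ψp ![E 0, E 3, E 4, E 5] -
      wedgeAt σ ω₀ ![E 0, E 3, E 4, E 5] = 0 := congrArg (fun a : V [⋀^Fin 4]→L[ℝ] ℝ => a ![E 0,
          E 3, E 4, E 5]) heq
  simp only [wedgeAt_one_three, p034, p035, p045, p345, q0345, v0345, w03] at z0345
  have z1234 : p * wedgeAt ω₀ ω₀ ![E 1, E 2, E 3, E 4] + wedgeAt θ ψp ![E 1, E 2, E 3, E 4] -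
      wedgeAt σ ω₀ ![E 1, E 2, E 3, E 4] = 0 := congrArg (fun a : V [⋀^Fin 4]→L[ℝ] ℝ => a ![E 1,
          E 2, E 3, E 4]) heq
  simp only [wedgeAt_one_three, p123, p124, p134, p234, q1234, v1234, w14] at z1234
  have z1235 : p * wedgeAt ω₀ ω₀ ![E 1, E 2, E 3, E 5] + wedgeAt θ ψp ![E 1, E 2, E 3, E 5] -
      wedgeAt σ ω₀ ![E 1, E 2, E 3, E 5] = 0 := congrArg (fun a : V [⋀^Fin 4]→L[ℝ] ℝ => a ![E 1,
          E 2, E 3, E 5]) heq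
  simp only [wedgeAt_one_three, p123, p125, p135, p235, q1235, v1235, w15] at z1235
  have z1245 : p * wedgeAt ω₀ ω₀ ![E 1, E 2, E 4, E 5] + wedgeAt θ ψp ![E 1, E 2, E 4, E 5] -
      wedgeAt σ ω₀ ![E 1, E 2, E 4, E 5] = 0 := congrArg (fun a : V [⋀^Fin 4]→L[ℝ] ℝ => a ![E 1,
          E 2, E 4, E 5]) heq
  simp only [wedgeAt_one_three, p124, p125, p145, p245, q1245, v1245, w12] at z1245
  have z1345 : p * wedgeAt ω₀ ω₀ ![E 1, E 3, E 4, E 5] + wedgeAt θ ψp ![E 1, E 3, E 4, E 5] -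
      wedgeAt σ ω₀ ![E 1, E 3, E 4, E 5] = 0 := congrArg (fun a : V [⋀^Fin 4]→L[ℝ] ℝ => a ![E 1,
          E 3, E 4, E 5]) heq
  simp only [wedgeAt_one_three, p134, p135, p145, p345, q1345, v1345, w13] at z1345
  have z2345 : p * wedgeAt ω₀ ω₀ ![E 2, E 3, E 4, E 5] + wedgeAt θ ψp ![E 2, E 3, E 4, E 5] -
      wedgeAt σ ω₀ ![E 2, E 3, E 4, E 5] = 0 := congrArg (fun a : V [⋀^Fin 4]→L[ℝ] ℝ => a ![E 2,
          E 3, E 4, E 5]) heq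
  simp only [wedgeAt_one_three, p234, p235, p245, p345, q2345, v2345, w23, w45] at z2345
  refine ⟨ext_one_six E ⟨?_, ?_, ?_, ?_, ?_, ?_⟩, ext_two_six E ⟨?_, ?_, ?_, ?_, ?_, ?_, ?_, ?_,
      ?_, ?_, ?_, ?_, ?_, ?_, ?_⟩⟩
  · change _ = (0 : ℝ)
    linear_combination -(1 / 2) * y25 - (1 / 2) * z0125 - (1 / 2) * z0134
  · change _ = (0 : ℝ)
    linear_combination -(1 / 2) * y24 - (1 / 2) * z0124 + (1 / 2) * z0135
  · change _ = (0 : ℝ)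
    linear_combination (1 / 2) * y05 + (1 / 2) * z0235 + (1 / 2) * z1234
  · change _ = (0 : ℝ)
    linear_combination (1 / 2) * y04 + (1 / 2) * z0234 - (1 / 2) * z1235
  · change _ = (0 : ℝ)
    linear_combination -(1 / 2) * y03 - (1 / 2) * z0345 - (1 / 2) * z1245
  · change _ = (0 : ℝ)
    linear_combination -(1 / 2) * y02 - (1 / 2) * z0245 + (1 / 2) * z1345
  · change _ = (0 : ℝ)
    linear_combination (1 / 3) * y01 - (1 / 3) * z0123 - (1 / 3) * z0145 + (2 / 3) * z2345
  · change _ = (0 : ℝ)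
    linear_combination (1 / 2) * y02 - (1 / 2) * z0245 - (1 / 2) * z1345
  · change _ = (0 : ℝ)
    linear_combination (1 / 2) * y03 - (1 / 2) * z0345 + (1 / 2) * z1245
  · change _ = (0 : ℝ)
    linear_combination (1 / 2) * y04 - (1 / 2) * z0234 - (1 / 2) * z1235
  · change _ = (0 : ℝ)
    linear_combination (1 / 2) * y05 - (1 / 2) * z0235 + (1 / 2) * z1234
  · change _ = (0 : ℝ)
    linear_combination (1 / 2) * y03 + (1 / 2) * z0345 - (1 / 2) * z1245
  · change _ = (0 : ℝ)
    linear_combination -(1 / 2) * y02 - (1 / 2) * z0245 - (1 / 2) * z1345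
  · change _ = (0 : ℝ)
    linear_combination (1 / 2) * y05 + (1 / 2) * z0235 - (1 / 2) * z1234
  · change _ = (0 : ℝ)
    linear_combination -(1 / 2) * y04 - (1 / 2) * z0234 - (1 / 2) * z1235
  · change _ = (0 : ℝ)
    linear_combination (1 / 3) * y01 - (1 / 3) * z0123 + (2 / 3) * z0145 - (1 / 3) * z2345
  · change _ = (0 : ℝ)
    linear_combination (1 / 2) * y24 - (1 / 2) * z0124 - (1 / 2) * z0135
  · change _ = (0 : ℝ)
    linear_combination (1 / 2) * y25 - (1 / 2) * z0125 + (1 / 2) * z0134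
  · change _ = (0 : ℝ)
    linear_combination (1 / 2) * y25 + (1 / 2) * z0125 - (1 / 2) * z0134
  · change _ = (0 : ℝ)
    linear_combination -(1 / 2) * y24 - (1 / 2) * z0124 - (1 / 2) * z0135
  · change _ = (0 : ℝ)
    linear_combination (1 / 3) * y01 + (2 / 3) * z0123 - (1 / 3) * z0145 - (1 / 3) * z2345

omit [Module.Finite ℝ V] in
/-- The components `(1)`, `(1)`, `(6)` and `(12)` of a `3`-form are independent. -/
theorem IsSU3Coframe.three_form_components_eq_zero (h : IsSU3Coframe g ω₀ ψp ψm e)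
    {E : Module.Basis (Fin 6) ℝ V} (hE : ∀ v i, E.repr v i = e i v) {s p : ℝ} {θ : V [⋀^Fin
        1]→L[ℝ] ℝ}
    {γ : V [⋀^Fin 3]→L[ℝ] ℝ} (hω : wedgeAt γ ω₀ = 0) (hψp : wedgeAt γ ψp = 0)
    (hψm : wedgeAt γ ψm = 0) (heq : s • ψp + p • ψm + wedgeAt θ ω₀ + γ = 0) :
    s = 0 ∧ p = 0 ∧ θ = 0 := by
  obtain ⟨w01, w02, w03, w04, w05, w12, w13, w14, w15, w23, w24, w25, w34, w35, w45⟩ :=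
    h.omega_components (dual_basis_apply hE)
  obtain ⟨p012, p013, p014, p015, p023, p024, p025, p034, p035, p045, p123, p124, p125, p134, p135,
    p145, p234, p235, p245, p345⟩ :=
    h.psi_plus_components (dual_basis_apply hE)
  obtain ⟨m012, m013, m014, m015, m023, m024, m025, m034, m035, m045, m123, m124, m125, m134, m135,
    m145, m234, m235, m245, m345⟩ :=
    h.psi_minus_components (dual_basis_apply hE)
  have x012 : s * ψp ![E 0, E 1, E 2] + p * ψm ![E 0, E 1, E 2] + wedgeAt θ ω₀ ![E 0, E 1, E 2] +
      γ ![E 0, E 1, E 2] = 0 := congrArg (fun a : V [⋀^Fin 3]→L[ℝ] ℝ => a ![E 0, E 1, E 2]) heq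
  simp only [wedgeAt_one_two, p012, m012, w01, w02, w12] at x012
  have x013 : s * ψp ![E 0, E 1, E 3] + p * ψm ![E 0, E 1, E 3] + wedgeAt θ ω₀ ![E 0, E 1, E 3] +
      γ ![E 0, E 1, E 3] = 0 := congrArg (fun a : V [⋀^Fin 3]→L[ℝ] ℝ => a ![E 0, E 1, E 3]) heq
  simp only [wedgeAt_one_two, p013, m013, w01, w03, w13] at x013
  have x014 : s * ψp ![E 0, E 1, E 4] + p * ψm ![E 0, E 1, E 4] + wedgeAt θ ω₀ ![E 0, E 1, E 4] +
      γ ![E 0, E 1, E 4] = 0 := congrArg (fun a : V [⋀^Fin 3]→L[ℝ] ℝ => a ![E 0, E 1, E 4]) heq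
  simp only [wedgeAt_one_two, p014, m014, w01, w04, w14] at x014
  have x015 : s * ψp ![E 0, E 1, E 5] + p * ψm ![E 0, E 1, E 5] + wedgeAt θ ω₀ ![E 0, E 1, E 5] +
      γ ![E 0, E 1, E 5] = 0 := congrArg (fun a : V [⋀^Fin 3]→L[ℝ] ℝ => a ![E 0, E 1, E 5]) heq
  simp only [wedgeAt_one_two, p015, m015, w01, w05, w15] at x015
  have x023 : s * ψp ![E 0, E 2, E 3] + p * ψm ![E 0, E 2, E 3] + wedgeAt θ ω₀ ![E 0, E 2, E 3] +
      γ ![E 0, E 2, E 3] = 0 := congrArg (fun a : V [⋀^Fin 3]→L[ℝ] ℝ => a ![E 0, E 2, E 3]) heq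
  simp only [wedgeAt_one_two, p023, m023, w02, w03, w23] at x023
  have x024 : s * ψp ![E 0, E 2, E 4] + p * ψm ![E 0, E 2, E 4] + wedgeAt θ ω₀ ![E 0, E 2, E 4] +
      γ ![E 0, E 2, E 4] = 0 := congrArg (fun a : V [⋀^Fin 3]→L[ℝ] ℝ => a ![E 0, E 2, E 4]) heq
  simp only [wedgeAt_one_two, p024, m024, w02, w04, w24] at x024
  have x025 : s * ψp ![E 0, E 2, E 5] + p * ψm ![E 0, E 2, E 5] + wedgeAt θ ω₀ ![E 0, E 2, E 5] +
      γ ![E 0, E 2, E 5] = 0 := congrArg (fun a : V [⋀^Fin 3]→L[ℝ] ℝ => a ![E 0, E 2, E 5]) heq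
  simp only [wedgeAt_one_two, p025, m025, w02, w05, w25] at x025
  have x034 : s * ψp ![E 0, E 3, E 4] + p * ψm ![E 0, E 3, E 4] + wedgeAt θ ω₀ ![E 0, E 3, E 4] +
      γ ![E 0, E 3, E 4] = 0 := congrArg (fun a : V [⋀^Fin 3]→L[ℝ] ℝ => a ![E 0, E 3, E 4]) heq
  simp only [wedgeAt_one_two, p034, m034, w03, w04, w34] at x034
  have x035 : s * ψp ![E 0, E 3, E 5] + p * ψm ![E 0, E 3, E 5] + wedgeAt θ ω₀ ![E 0, E 3, E 5] +
      γ ![E 0, E 3, E 5] = 0 := congrArg (fun a : V [⋀^Fin 3]→L[ℝ] ℝ => a ![E 0, E 3, E 5]) heq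
  simp only [wedgeAt_one_two, p035, m035, w03, w05, w35] at x035
  have x045 : s * ψp ![E 0, E 4, E 5] + p * ψm ![E 0, E 4, E 5] + wedgeAt θ ω₀ ![E 0, E 4, E 5] +
      γ ![E 0, E 4, E 5] = 0 := congrArg (fun a : V [⋀^Fin 3]→L[ℝ] ℝ => a ![E 0, E 4, E 5]) heq
  simp only [wedgeAt_one_two, p045, m045, w04, w05, w45] at x045
  have x123 : s * ψp ![E 1, E 2, E 3] + p * ψm ![E 1, E 2, E 3] + wedgeAt θ ω₀ ![E 1, E 2, E 3] +
      γ ![E 1, E 2, E 3] = 0 := congrArg (fun a : V [⋀^Fin 3]→L[ℝ] ℝ => a ![E 1, E 2, E 3]) heq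
  simp only [wedgeAt_one_two, p123, m123, w12, w13, w23] at x123
  have x124 : s * ψp ![E 1, E 2, E 4] + p * ψm ![E 1, E 2, E 4] + wedgeAt θ ω₀ ![E 1, E 2, E 4] +
      γ ![E 1, E 2, E 4] = 0 := congrArg (fun a : V [⋀^Fin 3]→L[ℝ] ℝ => a ![E 1, E 2, E 4]) heq
  simp only [wedgeAt_one_two, p124, m124, w12, w14, w24] at x124
  have x125 : s * ψp ![E 1, E 2, E 5] + p * ψm ![E 1, E 2, E 5] + wedgeAt θ ω₀ ![E 1, E 2, E 5] +
      γ ![E 1, E 2, E 5] = 0 := congrArg (fun a : V [⋀^Fin 3]→L[ℝ] ℝ => a ![E 1, E 2, E 5]) heq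
  simp only [wedgeAt_one_two, p125, m125, w12, w15, w25] at x125
  have x134 : s * ψp ![E 1, E 3, E 4] + p * ψm ![E 1, E 3, E 4] + wedgeAt θ ω₀ ![E 1, E 3, E 4] +
      γ ![E 1, E 3, E 4] = 0 := congrArg (fun a : V [⋀^Fin 3]→L[ℝ] ℝ => a ![E 1, E 3, E 4]) heq
  simp only [wedgeAt_one_two, p134, m134, w13, w14, w34] at x134
  have x135 : s * ψp ![E 1, E 3, E 5] + p * ψm ![E 1, E 3, E 5] + wedgeAt θ ω₀ ![E 1, E 3, E 5] +
      γ ![E 1, E 3, E 5] = 0 := congrArg (fun a : V [⋀^Fin 3]→L[ℝ] ℝ => a ![E 1, E 3, E 5]) heq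
  simp only [wedgeAt_one_two, p135, m135, w13, w15, w35] at x135
  have x145 : s * ψp ![E 1, E 4, E 5] + p * ψm ![E 1, E 4, E 5] + wedgeAt θ ω₀ ![E 1, E 4, E 5] +
      γ ![E 1, E 4, E 5] = 0 := congrArg (fun a : V [⋀^Fin 3]→L[ℝ] ℝ => a ![E 1, E 4, E 5]) heq
  simp only [wedgeAt_one_two, p145, m145, w14, w15, w45] at x145
  have x234 : s * ψp ![E 2, E 3, E 4] + p * ψm ![E 2, E 3, E 4] + wedgeAt θ ω₀ ![E 2, E 3, E 4] +
      γ ![E 2, E 3, E 4] = 0 := congrArg (fun a : V [⋀^Fin 3]→L[ℝ] ℝ => a ![E 2, E 3, E 4]) heq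
  simp only [wedgeAt_one_two, p234, m234, w23, w24, w34] at x234
  have x235 : s * ψp ![E 2, E 3, E 5] + p * ψm ![E 2, E 3, E 5] + wedgeAt θ ω₀ ![E 2, E 3, E 5] +
      γ ![E 2, E 3, E 5] = 0 := congrArg (fun a : V [⋀^Fin 3]→L[ℝ] ℝ => a ![E 2, E 3, E 5]) heq
  simp only [wedgeAt_one_two, p235, m235, w23, w25, w35] at x235
  have x245 : s * ψp ![E 2, E 4, E 5] + p * ψm ![E 2, E 4, E 5] + wedgeAt θ ω₀ ![E 2, E 4, E 5] +
      γ ![E 2, E 4, E 5] = 0 := congrArg (fun a : V [⋀^Fin 3]→L[ℝ] ℝ => a ![E 2, E 4, E 5]) heq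
  simp only [wedgeAt_one_two, p245, m245, w24, w25, w45] at x245
  have x345 : s * ψp ![E 3, E 4, E 5] + p * ψm ![E 3, E 4, E 5] + wedgeAt θ ω₀ ![E 3, E 4, E 5] +
      γ ![E 3, E 4, E 5] = 0 := congrArg (fun a : V [⋀^Fin 3]→L[ℝ] ℝ => a ![E 3, E 4, E 5]) heq
  simp only [wedgeAt_one_two, p345, m345, w34, w35, w45] at x345
  have y01234 : wedgeAt γ ω₀ ![E 0, E 1, E 2, E 3, E 4] = 0 := by rw [hω]; rfl
  simp only [wedgeAt_three_two, w01, w02, w03, w04, w12, w13, w14, w23, w24, w34] at y01234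
  have y01235 : wedgeAt γ ω₀ ![E 0, E 1, E 2, E 3, E 5] = 0 := by rw [hω]; rfl
  simp only [wedgeAt_three_two, w01, w02, w03, w05, w12, w13, w15, w23, w25, w35] at y01235
  have y01245 : wedgeAt γ ω₀ ![E 0, E 1, E 2, E 4, E 5] = 0 := by rw [hω]; rfl
  simp only [wedgeAt_three_two, w01, w02, w04, w05, w12, w14, w15, w24, w25, w45] at y01245
  have y01345 : wedgeAt γ ω₀ ![E 0, E 1, E 3, E 4, E 5] = 0 := by rw [hω]; rfl
  simp only [wedgeAt_three_two, w01, w03, w04, w05, w13, w14, w15, w34, w35, w45] at y01345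
  have y02345 : wedgeAt γ ω₀ ![E 0, E 2, E 3, E 4, E 5] = 0 := by rw [hω]; rfl
  simp only [wedgeAt_three_two, w02, w03, w04, w05, w23, w24, w25, w34, w35, w45] at y02345
  have y12345 : wedgeAt γ ω₀ ![E 1, E 2, E 3, E 4, E 5] = 0 := by rw [hω]; rfl
  simp only [wedgeAt_three_two, w12, w13, w14, w15, w23, w24, w25, w34, w35, w45] at y12345
  have zp : wedgeAt γ ψp ![E 0, E 1, E 2, E 3, E 4, E 5] = 0 := by rw [hψp]; rfl
  simp only [wedgeAt_three_three, p012, p013, p014, p015, p023, p024, p025, p034, p035, p045,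
      p123, p124, p125, p134, p135, p145, p234, p235, p245, p345] at zp
  have zm : wedgeAt γ ψm ![E 0, E 1, E 2, E 3, E 4, E 5] = 0 := by rw [hψm]; rfl
  simp only [wedgeAt_three_three, m012, m013, m014, m015, m023, m024, m025, m034, m035, m045,
      m123, m124, m125, m134, m135, m145, m234, m235, m245, m345] at zm
  refine ⟨?_, ?_, ext_one_six E ⟨?_, ?_, ?_, ?_, ?_, ?_⟩⟩
  · linear_combination (1 / 4) * x024 - (1 / 4) * x035 - (1 / 4) * x125 - (1 / 4) * x134 - (1 /
      4) * zm
  · linear_combination (1 / 4) * x025 + (1 / 4) * x034 + (1 / 4) * x124 - (1 / 4) * x135 + (1 /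
      4) * zp
  · change _ = (0 : ℝ)
    linear_combination (1 / 2) * x023 + (1 / 2) * x045 - (1 / 2) * y02345
  · change _ = (0 : ℝ)
    linear_combination (1 / 2) * x123 + (1 / 2) * x145 - (1 / 2) * y12345
  · change _ = (0 : ℝ)
    linear_combination (1 / 2) * x012 + (1 / 2) * x245 - (1 / 2) * y01245
  · change _ = (0 : ℝ)
    linear_combination (1 / 2) * x013 + (1 / 2) * x345 - (1 / 2) * y01345
  · change _ = (0 : ℝ)
    linear_combination (1 / 2) * x014 + (1 / 2) * x234 - (1 / 2) * y01234
  · change _ = (0 : ℝ)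
    linear_combination (1 / 2) * x015 + (1 / 2) * x235 - (1 / 2) * y01235

end Pointwise

section Pointwise

variable {V : Type*} [AddCommGroup V] [Module ℝ V] [TopologicalSpace V] [Module.Finite ℝ V]

theorem hodgeStarAt_add {k m : ℕ} (g : V →L[ℝ] V →L[ℝ] ℝ) (ν : V [⋀^Fin (k + m)]→L[ℝ] ℝ)
    (a b : V [⋀^Fin k]→L[ℝ] ℝ) :
    hodgeStarAt m g ν (a + b) = hodgeStarAt m g ν a + hodgeStarAt m g ν b := by
  simp only [hodgeStarAt, ContinuousAlternatingMap.add_apply, add_smul, Finset.sum_add_distrib,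
    smul_add]

theorem hodgeStarAt_smul {k m : ℕ} (g : V →L[ℝ] V →L[ℝ] ℝ) (ν : V [⋀^Fin (k + m)]→L[ℝ] ℝ)
    (c : ℝ) (a : V [⋀^Fin k]→L[ℝ] ℝ) :
    hodgeStarAt m g ν (c • a) = c • hodgeStarAt m g ν a := by
  simp only [hodgeStarAt, ContinuousAlternatingMap.smul_apply, smul_eq_mul, mul_smul,
    ← Finset.smul_sum]
  rw [smul_comm]

theorem hodgeStarAt_zero {k m : ℕ} (g : V →L[ℝ] V →L[ℝ] ℝ) (ν : V [⋀^Fin (k + m)]→L[ℝ] ℝ) :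
    hodgeStarAt m g ν (0 : V [⋀^Fin k]→L[ℝ] ℝ) = 0 := by
  simpa using hodgeStarAt_smul g ν 0 (0 : V [⋀^Fin k]→L[ℝ] ℝ)

omit [Module.Finite ℝ V] in
theorem map_append_comm_two_five (ν : V [⋀^Fin 7]→L[ℝ] ℝ) (v : Fin 2 → V) (w : Fin 5 → V) :
    ν (Fin.append w v : Fin (5 + 2) → V) = ν (Fin.append v w : Fin (2 + 5) → V) := by
  have h := ν.toAlternatingMap.map_perm (Fin.append v w : Fin (2 + 5) → V)
    (Equiv.addRight (2 : Fin 7))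
  have h₁ : Equiv.Perm.sign (Equiv.addRight (2 : Fin 7)) = 1 := by decide
  rw [h₁, one_smul] at h
  refine Eq.trans ?_ h
  change ν _ = ν _
  congr 1
  funext i
  fin_cases i <;> rfl

omit [Module.Finite ℝ V] in
theorem map_append_comm_four_three (ν : V [⋀^Fin 7]→L[ℝ] ℝ) (v : Fin 4 → V) (w : Fin 3 → V) :
    ν (Fin.append w v : Fin (3 + 4) → V) = ν (Fin.append v w : Fin (4 + 3) → V) := by
  have h := ν.toAlternatingMap.map_perm (Fin.append v w : Fin (4 + 3) → V)
    (Equiv.addRight (4 : Fin 7))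
  have h₁ : Equiv.Perm.sign (Equiv.addRight (4 : Fin 7)) = 1 := by decide
  rw [h₁, one_smul] at h
  refine Eq.trans ?_ h
  change ν _ = ν _
  congr 1
  funext i
  fin_cases i <;> rfl

omit [Module.Finite ℝ V] in
theorem map_append_comm_four_two (ν : V [⋀^Fin 6]→L[ℝ] ℝ) (v : Fin 4 → V) (w : Fin 2 → V) :
    ν (Fin.append w v : Fin (2 + 4) → V) = ν (Fin.append v w : Fin (4 + 2) → V) := by
  have h := ν.toAlternatingMap.map_perm (Fin.append v w : Fin (4 + 2) → V)
    (Equiv.addRight (4 : Fin 6))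
  have h₁ : Equiv.Perm.sign (Equiv.addRight (4 : Fin 6)) = 1 := by decide
  rw [h₁, one_smul] at h
  refine Eq.trans ?_ h
  change ν _ = ν _
  congr 1
  funext i
  fin_cases i <;> rfl

end Pointwise

section Product

variable {V : Type*} [AddCommGroup V] [Module ℝ V] [TopologicalSpace V]
  {V' : Type*} [AddCommGroup V'] [Module ℝ V'] [TopologicalSpace V']
  {g : V →L[ℝ] V →L[ℝ] ℝ} {ω₀ : V [⋀^Fin 2]→L[ℝ] ℝ} {ψp ψm : V [⋀^Fin 3]→L[ℝ] ℝ}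
  {e : Fin 6 → V →L[ℝ] ℝ}

/-- The coframe `e¹, …, e⁶, f ds` of a warped product. -/
def warpedCoframe (e : Fin 6 → V →L[ℝ] ℝ) (P : V' →L[ℝ] V) (ξ : V' →L[ℝ] ℝ) (f : ℝ) :
    Fin 7 → V' →L[ℝ] ℝ :=
  ![e 0 ∘L P, e 1 ∘L P, e 2 ∘L P, e 3 ∘L P, e 4 ∘L P, e 5 ∘L P, f • ξ]

theorem warpedCoframe_castSucc (e : Fin 6 → V →L[ℝ] ℝ) (P : V' →L[ℝ] V) (ξ : V' →L[ℝ] ℝ) (f : ℝ)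
    (i : Fin 6) : warpedCoframe e P ξ f i.castSucc = e i ∘L P := by
  fin_cases i <;> rfl

theorem IsSU3Coframe.g2Form_warpedCoframe (h : IsSU3Coframe g ω₀ ψp ψm e) (P : V' →L[ℝ] V)
    (ξ : V' →L[ℝ] ℝ) (f : ℝ) :
    g2Form (warpedCoframe e P ξ f) =
      wedgeAt ((f • ω₀).compContinuousLinearMap P) (covector ξ) +
        ψp.compContinuousLinearMap P := by
  ext v
  obtain ⟨x, y, z, rfl⟩ : ∃ x y z, v = ![x, y, z] :=
    ⟨v 0, v 1, v 2, by ext i; fin_cases i <;> rfl⟩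
  have h₁ : ψp.compContinuousLinearMap P ![x, y, z] = ψp ![P x, P y, P z] := by
    rw [ContinuousAlternatingMap.compContinuousLinearMap_apply]
    congr 1
    funext i; fin_cases i <;> rfl
  rw [g2Form_apply, ContinuousAlternatingMap.add_apply, wedgeAt_two_one, h₁]
  simp only [comp_apply_two, h.omega, h.psi_plus, ContinuousAlternatingMap.smul_apply,
    ContinuousAlternatingMap.add_apply, ContinuousAlternatingMap.sub_apply, mono₂_apply,
    mono₃_apply, warpedCoframe, covector_apply, Matrix.cons_val, ContinuousLinearMap.comp_apply,
    _root_.smul_apply, smul_eq_mul]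
  ring

end Product

section Warped

variable {V : Type*} [AddCommGroup V] [Module ℝ V] [TopologicalSpace V] [Module.Finite ℝ V]
  {V' : Type*} [AddCommGroup V'] [Module ℝ V'] [TopologicalSpace V'] [Module.Finite ℝ V']
  {g : V →L[ℝ] V →L[ℝ] ℝ} {ω₀ : V [⋀^Fin 2]→L[ℝ] ℝ} {ψp ψm : V [⋀^Fin 3]→L[ℝ] ℝ}
  {e : Fin 6 → V →L[ℝ] ℝ} {g' : V' →L[ℝ] V' →L[ℝ] ℝ} {ν' : V' [⋀^Fin 7]→L[ℝ] ℝ}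
  {φ : V' [⋀^Fin 3]→L[ℝ] ℝ} {e' : Fin 7 → V' →L[ℝ] ℝ}
  {P : V' →L[ℝ] V} {ξ : V' →L[ℝ] ℝ} {f : ℝ}

omit [Module.Finite ℝ V] in
/-- The metric and volume form of a warped `G₂` form. -/
theorem IsSU3Coframe.warped_frame (h : IsSU3Coframe g ω₀ ψp ψm e)
    {E : Module.Basis (Fin 6) ℝ V} (hE : ∀ v i, E.repr v i = e i v)
    {ν : V [⋀^Fin 6]→L[ℝ] ℝ} (hν : ν E = 1)
    (hG : IsG2Coframe g' ν' φ e') (hV' : Module.finrank ℝ V' = 7) (hf : f ≠ 0)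
    (hφ : φ = wedgeAt ((f • ω₀).compContinuousLinearMap P) (covector ξ) +
      ψp.compContinuousLinearMap P)
    (hP : ∀ v, P v = 0 → ξ v = 0 → v = 0) :
    ∃ D : Module.Basis (Fin 7) ℝ V', (∀ v i, D.repr v i = warpedCoframe e P ξ f i v) ∧
      (∀ v w, g' v w = ∑ i, warpedCoframe e P ξ f i v * warpedCoframe e P ξ f i w) ∧
      ν' D = 1 ∧
      ν' = wedgeAt (ν.compContinuousLinearMap P) (covector (warpedCoframe e P ξ f (Fin.last 6))) := by
  have hinj : ∀ v, (∀ i, warpedCoframe e P ξ f i v = 0) → v = 0 := by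
    intro v hv
    refine hP v ?_ ?_
    · apply E.repr.injective
      ext i
      rw [hE, map_zero, Finsupp.zero_apply]
      have := hv i.castSucc
      rwa [warpedCoframe_castSucc] at this
    · have : f • ξ v = 0 := hv 6
      exact (smul_eq_zero.1 this).resolve_left hf
  obtain ⟨D, hD⟩ := exists_dual_basis_of_injective _ hinj hV'
  obtain ⟨hg', hν'⟩ := hG.of_form hV' hD (hφ.trans (h.g2Form_warpedCoframe P ξ f).symm)
  refine ⟨D, hD, hg', hν', ext_top D ?_⟩
  obtain ⟨hPD, hPl⟩ := dual_basis_projection hE hD P (warpedCoframe_castSucc e P ξ f)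
  have hDd := dual_basis_apply hD
  rw [hν', wedgeAt_covector, Fin.sum_univ_castSucc, Finset.sum_eq_zero]
  · rw [hDd, if_pos rfl]
    have : (ν.compContinuousLinearMap P) (Fin.removeNth (Fin.last 6) D) = ν E := by
      rw [ContinuousAlternatingMap.compContinuousLinearMap_apply]
      congr 1
      funext i
      rw [Function.comp_apply, Fin.removeNth, Fin.succAbove_last]
      exact hPD i
    rw [this, hν]
    norm_num
  · intro i _
    rw [hDd, if_neg (Fin.castSucc_lt_last i).ne]
    simp

omit [Module.Finite ℝ V] [Module.Finite ℝ V'] in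
theorem wedgeAt_add_left {k l : ℕ} (a b : V [⋀^Fin k]→L[ℝ] ℝ) (c : V [⋀^Fin l]→L[ℝ] ℝ) :
    wedgeAt (a + b) c = wedgeAt a c + wedgeAt b c := by
  ext v
  simp only [wedgeAt_apply, ContinuousAlternatingMap.add_apply, add_mul, mul_add,
    Finset.sum_add_distrib]

omit [Module.Finite ℝ V] [Module.Finite ℝ V'] in
theorem wedgeAt_add_right {k l : ℕ} (a : V [⋀^Fin k]→L[ℝ] ℝ) (b c : V [⋀^Fin l]→L[ℝ] ℝ) :
    wedgeAt a (b + c) = wedgeAt a b + wedgeAt a c := by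
  ext v
  simp only [wedgeAt_apply, ContinuousAlternatingMap.add_apply, mul_add,
    Finset.sum_add_distrib]

omit [Module.Finite ℝ V] [Module.Finite ℝ V'] in
theorem wedgeAt_smul_left {k l : ℕ} (r : ℝ) (a : V [⋀^Fin k]→L[ℝ] ℝ) (c : V [⋀^Fin l]→L[ℝ] ℝ) :
    wedgeAt (r • a) c = r • wedgeAt a c := by
  ext v
  simp only [wedgeAt_apply, ContinuousAlternatingMap.smul_apply, smul_eq_mul, Finset.mul_sum]
  refine Finset.sum_congr rfl fun σ _ => ?_
  ring

omit [Module.Finite ℝ V] [Module.Finite ℝ V'] in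
theorem wedgeAt_smul_right {k l : ℕ} (r : ℝ) (a : V [⋀^Fin k]→L[ℝ] ℝ) (c : V [⋀^Fin l]→L[ℝ] ℝ) :
    wedgeAt a (r • c) = r • wedgeAt a c := by
  ext v
  simp only [wedgeAt_apply, ContinuousAlternatingMap.smul_apply, smul_eq_mul, Finset.mul_sum]
  refine Finset.sum_congr rfl fun σ _ => ?_
  ring

omit [Module.Finite ℝ V] [Module.Finite ℝ V'] in
theorem wedgeAt_zero_right {k l : ℕ} (a : V [⋀^Fin k]→L[ℝ] ℝ) :
    wedgeAt a (0 : V [⋀^Fin l]→L[ℝ] ℝ) = 0 := by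
  simpa using wedgeAt_smul_right 0 a (0 : V [⋀^Fin l]→L[ℝ] ℝ)

omit [Module.Finite ℝ V] [Module.Finite ℝ V'] in
theorem wedgeAt_zero_left {k l : ℕ} (b : V [⋀^Fin l]→L[ℝ] ℝ) :
    wedgeAt (0 : V [⋀^Fin k]→L[ℝ] ℝ) b = 0 := by
  simpa using wedgeAt_smul_left 0 (0 : V [⋀^Fin k]→L[ℝ] ℝ) b

omit [Module.Finite ℝ V] [Module.Finite ℝ V'] in
theorem covector_smul (r : ℝ) (ξ : V →L[ℝ] ℝ) : covector (r • ξ) = r • covector ξ := by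
  ext v
  simp

omit [Module.Finite ℝ V] [Module.Finite ℝ V'] in
theorem wedgeAt_comp_smul_covector {k : ℕ} (a : V [⋀^Fin k]→L[ℝ] ℝ) :
    wedgeAt (a.compContinuousLinearMap P) (covector (f • ξ)) =
      wedgeAt ((f • a).compContinuousLinearMap P) (covector ξ) := by
  rw [covector_smul, wedgeAt_smul_right, ← wedgeAt_smul_left]
  rfl

/-- The Hodge star of a warped `G₂`-structure on `5`-forms. -/
theorem IsSU3Coframe.star_five_warped (h : IsSU3Coframe g ω₀ ψp ψm e)
    {E : Module.Basis (Fin 6) ℝ V} (hE : ∀ v i, E.repr v i = e i v)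
    {ν : V [⋀^Fin 6]→L[ℝ] ℝ} (hν : ν E = 1)
    (hG : IsG2Coframe g' ν' φ e') (hV' : Module.finrank ℝ V' = 7) (hf : f ≠ 0)
    (hφ : φ = wedgeAt ((f • ω₀).compContinuousLinearMap P) (covector ξ) +
      ψp.compContinuousLinearMap P)
    (hP : ∀ v, P v = 0 → ξ v = 0 → v = 0) (A : V [⋀^Fin 5]→L[ℝ] ℝ) (B : V [⋀^Fin 4]→L[ℝ] ℝ) :
    hodgeStarAt (k := 5) 2 g' ν' (A.compContinuousLinearMap P +
        wedgeAt (B.compContinuousLinearMap P) (covector ξ)) =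
      wedgeAt ((f • hodgeStarAt (k := 5) 1 g ν A).compContinuousLinearMap P) (covector ξ) +
        (f⁻¹ • hodgeStarAt (k := 4) 2 g ν B).compContinuousLinearMap P := by
  obtain ⟨D, hD, hg', hν', hvol⟩ := h.warped_frame hE hν hG hV' hf hφ hP
  have h₁ := hodgeStarAt_product (k := 5) (m := 1) hE h.metric hD hg' P
    (warpedCoframe_castSucc e P ξ f) ν ν' (fun v => by rw [hvol]) A
  have h₂ := hodgeStarAt_product (k := 2) (m := 4) hE h.metric hD hg' P
    (warpedCoframe_castSucc e P ξ f) ν ν' (fun v => by rw [hvol])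
    (hodgeStarAt (k := 4) 2 g ν (f⁻¹ • B))
  rw [hodgeStarAt_hodgeStarAt (k := 4) (m := 2) rfl hE h.metric ν ν
    (fun v w => map_append_comm_four_two ν v w) hν] at h₂
  have h₃ : wedgeAt ((f⁻¹ • B).compContinuousLinearMap P)
      (covector (warpedCoframe e P ξ f (Fin.last 6))) =
      wedgeAt (B.compContinuousLinearMap P) (covector ξ) := by
    refine (wedgeAt_comp_smul_covector (f⁻¹ • B)).trans ?_
    rw [smul_smul, mul_inv_cancel₀ hf, one_smul]
  rw [hodgeStarAt_add, ← h₃, ← h₂, h₁]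
  congr 1
  · exact wedgeAt_comp_smul_covector _
  · refine (hodgeStarAt_hodgeStarAt (k := 2) (m := 5) rfl hD hg' ν' ν'
      (fun v w => map_append_comm_two_five ν' v w) hν' _).trans ?_
    rw [hodgeStarAt_smul]

/-- The Hodge star of a warped `G₂` form. -/
theorem IsSU3Coframe.star_warped (h : IsSU3Coframe g ω₀ ψp ψm e)
    {E : Module.Basis (Fin 6) ℝ V} (hE : ∀ v i, E.repr v i = e i v)
    {ν : V [⋀^Fin 6]→L[ℝ] ℝ} (hν : ν E = 1)
    (hG : IsG2Coframe g' ν' φ e') (hV' : Module.finrank ℝ V' = 7) (hf : f ≠ 0)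
    (hφ : φ = wedgeAt ((f • ω₀).compContinuousLinearMap P) (covector ξ) +
      ψp.compContinuousLinearMap P)
    (hP : ∀ v, P v = 0 → ξ v = 0 → v = 0) :
    hodgeStarAt (k := 3) 4 g' ν' φ =
      ((1 / 2 : ℝ) • wedgeAt ω₀ ω₀).compContinuousLinearMap P +
        wedgeAt ((f • ψm).compContinuousLinearMap P) (covector ξ) := by
  obtain ⟨D, hD, hg', hν', hvol⟩ := h.warped_frame hE hν hG hV' hf hφ hP
  have h₁ := hodgeStarAt_product (k := 3) (m := 3) hE h.metric hD hg' P
    (warpedCoframe_castSucc e P ξ f) ν ν' (fun v => by rw [hvol]) ψp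
  rw [h.star_psi_plus hE hν] at h₁
  have h₂ := hodgeStarAt_product (k := 4) (m := 2) hE h.metric hD hg' P
    (warpedCoframe_castSucc e P ξ f) ν ν' (fun v => by rw [hvol])
    ((1 / 2 : ℝ) • wedgeAt ω₀ ω₀)
  rw [h.star_omega_sq hE hν] at h₂
  have h₃ : wedgeAt (ω₀.compContinuousLinearMap P)
      (covector (warpedCoframe e P ξ f (Fin.last 6))) =
      wedgeAt ((f • ω₀).compContinuousLinearMap P) (covector ξ) :=
    wedgeAt_comp_smul_covector ω₀
  rw [hφ, hodgeStarAt_add, h₁, ← h₃, ← h₂]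
  congr 1
  · exact hodgeStarAt_hodgeStarAt (k := 4) (m := 3) rfl hD hg' ν' ν'
      (fun v w => map_append_comm_four_three ν' v w) hν' _
  · exact wedgeAt_comp_smul_covector _

end Warped

section Calculus

open ContinuousAlternatingMap

variable {E : Type*} [NormedAddCommGroup E] [NormedSpace ℝ E]
  {W : Type*} [NormedAddCommGroup W] [NormedSpace ℝ W]

theorem differentiableAt_form_apply {k : ℕ} {a : W → E [⋀^Fin k]→L[ℝ] ℝ} {x : W}
    (ha : DifferentiableAt ℝ a x) (v : Fin k → E) : DifferentiableAt ℝ (fun y => a y v) x :=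
  ((apply ℝ E ℝ v).differentiableAt (x := a x)).comp x ha

theorem fderiv_form_apply {k : ℕ} {a : W → E [⋀^Fin k]→L[ℝ] ℝ} {x : W}
    (ha : DifferentiableAt ℝ a x) (v : Fin k → E) (u : W) :
    fderiv ℝ (fun y => a y v) x u = fderiv ℝ a x u v := by
  have := ((apply ℝ E ℝ v).hasFDerivAt (x := a x)).comp x ha.hasFDerivAt
  exact congrArg (fun L => L u) this.fderiv

/-- A family of forms is differentiable if all its evaluations are. -/
theorem differentiableAt_form_of_apply [FiniteDimensional ℝ E] {k : ℕ}
    {a : W → E [⋀^Fin k]→L[ℝ] ℝ} {x : W}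
    (ha : ∀ v, DifferentiableAt ℝ (fun y => a y v) x) : DifferentiableAt ℝ a x := by
  let b := Module.finBasis ℝ E
  let Φ : E [⋀^Fin k]→L[ℝ] ℝ →ₗ[ℝ] ((Fin k → Fin (Module.finrank ℝ E)) → ℝ) :=
    LinearMap.pi fun q => (apply ℝ E ℝ (b ∘ q) : E [⋀^Fin k]→L[ℝ] ℝ →ₗ[ℝ] ℝ)
  have hΦ : LinearMap.ker Φ = ⊥ := by
    rw [LinearMap.ker_eq_bot]
    intro c d h
    exact ext_strictMono b fun s _ => congrFun h s
  obtain ⟨Ψ, hΨ⟩ := Φ.exists_leftInverse_of_injective hΦ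
  have h₁ : a = fun y => LinearMap.toContinuousLinearMap Ψ (Φ (a y)) :=
    funext fun y => (LinearMap.congr_fun hΨ (a y)).symm
  rw [h₁]
  refine (LinearMap.toContinuousLinearMap Ψ).differentiableAt.comp x ?_
  exact differentiableAt_pi.2 fun q => ha _

variable [FiniteDimensional ℝ E] {k l : ℕ} {a : W → E [⋀^Fin k]→L[ℝ] ℝ} {b : W → E [⋀^Fin l]→L[ℝ] ℝ}
  {x : W}

theorem differentiableAt_wedgeAt (ha : DifferentiableAt ℝ a x) (hb : DifferentiableAt ℝ b x) :
    DifferentiableAt ℝ (fun y => wedgeAt (a y) (b y)) x := by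
  refine differentiableAt_form_of_apply fun v => ?_
  simp only [wedgeAt_apply]
  refine DifferentiableAt.const_mul (DifferentiableAt.fun_sum fun σ _ => ?_) _
  exact ((differentiableAt_form_apply ha _).mul (differentiableAt_form_apply hb _)).const_mul _

theorem fderiv_wedgeAt (ha : DifferentiableAt ℝ a x) (hb : DifferentiableAt ℝ b x) (u : W) :
    fderiv ℝ (fun y => wedgeAt (a y) (b y)) x u =
      wedgeAt (fderiv ℝ a x u) (b x) + wedgeAt (a x) (fderiv ℝ b x u) := by
  ext v
  rw [← fderiv_form_apply (differentiableAt_wedgeAt ha hb), ContinuousAlternatingMap.add_apply]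
  simp only [wedgeAt_apply]
  have h : ∀ σ : Equiv.Perm (Fin (k + l)), HasFDerivAt (fun y => (Equiv.Perm.sign σ : ℝ) *
        (a y (fun i => v (σ (Fin.castAdd l i))) * b y (fun j => v (σ (Fin.natAdd k j))))) _ x :=
    fun σ => ((differentiableAt_form_apply ha _).hasFDerivAt.mul
      (differentiableAt_form_apply hb _).hasFDerivAt).const_mul _
  have h' := (HasFDerivAt.fun_sum (u := Finset.univ) fun σ _ => h σ).const_mul
    ((k.factorial : ℝ) * (l.factorial : ℝ))⁻¹
  rw [h'.fderiv, ← mul_add, ← Finset.sum_add_distrib]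
  simp only [_root_.smul_apply, _root_.sum_apply, _root_.add_apply, smul_eq_mul,
    fderiv_form_apply ha, fderiv_form_apply hb]
  refine congrArg _ (Finset.sum_congr rfl fun σ _ => ?_)
  ring

end Calculus

section Leibniz

open ContinuousAlternatingMap

variable {E : Type*} [NormedAddCommGroup E] [NormedSpace ℝ E]

theorem alternatizeUncurryFin_one (L : E →L[ℝ] E [⋀^Fin 1]→L[ℝ] ℝ) (x₁ x₂ : E) :
    alternatizeUncurryFin L ![x₁, x₂] =
      L x₁ ![x₂] - L x₂ ![x₁] := by
  rw [alternatizeUncurryFin_apply, Fin.sum_univ_two]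
  have h₀ : Fin.removeNth 0 ![x₁, x₂] = ![x₂] := by
    funext i; fin_cases i; rfl
  have h₁ : Fin.removeNth 1 ![x₁, x₂] = ![x₁] := by
    funext i; fin_cases i; rfl
  rw [h₀, h₁]
  simp only [Matrix.cons_val, Fin.val_zero, Fin.val_one, Fin.isValue]
  norm_num [pow_succ, Matrix.cons_val]
  try ring

theorem alternatizeUncurryFin_two (L : E →L[ℝ] E [⋀^Fin 2]→L[ℝ] ℝ) (x₁ x₂ x₃ : E) :
    alternatizeUncurryFin L ![x₁, x₂, x₃] =
      L x₁ ![x₂, x₃] - L x₂ ![x₁, x₃] + L x₃ ![x₁, x₂] := by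
  rw [alternatizeUncurryFin_apply, Fin.sum_univ_three]
  have h₀ : Fin.removeNth 0 ![x₁, x₂, x₃] = ![x₂, x₃] := by
    funext i; fin_cases i <;> rfl
  have h₁ : Fin.removeNth 1 ![x₁, x₂, x₃] = ![x₁, x₃] := by
    funext i; fin_cases i <;> rfl
  have h₂ : Fin.removeNth 2 ![x₁, x₂, x₃] = ![x₁, x₂] := by
    funext i; fin_cases i <;> rfl
  rw [h₀, h₁, h₂]
  simp only [Matrix.cons_val, Fin.val_zero, Fin.val_one, Fin.val_two, Fin.isValue]
  norm_num [pow_succ, Matrix.cons_val]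
  try ring

theorem alternatizeUncurryFin_three (L : E →L[ℝ] E [⋀^Fin 3]→L[ℝ] ℝ) (x₁ x₂ x₃ x₄ : E) :
    alternatizeUncurryFin L ![x₁, x₂, x₃, x₄] =
      L x₁ ![x₂, x₃, x₄] - L x₂ ![x₁, x₃, x₄] + L x₃ ![x₁, x₂, x₄] - L x₄ ![x₁, x₂, x₃] := by
  rw [alternatizeUncurryFin_apply, Fin.sum_univ_four]
  have h₀ : Fin.removeNth 0 ![x₁, x₂, x₃, x₄] = ![x₂, x₃, x₄] := by
    funext i; fin_cases i <;> rfl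
  have h₁ : Fin.removeNth 1 ![x₁, x₂, x₃, x₄] = ![x₁, x₃, x₄] := by
    funext i; fin_cases i <;> rfl
  have h₂ : Fin.removeNth 2 ![x₁, x₂, x₃, x₄] = ![x₁, x₂, x₄] := by
    funext i; fin_cases i <;> rfl
  have h₃ : Fin.removeNth 3 ![x₁, x₂, x₃, x₄] = ![x₁, x₂, x₃] := by
    funext i; fin_cases i <;> rfl
  rw [h₀, h₁, h₂, h₃]
  simp only [Matrix.cons_val, Fin.val_zero, Fin.val_one, Fin.val_two, Fin.isValue]
  norm_num [pow_succ, Matrix.cons_val]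
  try ring

theorem alternatizeUncurryFin_four (L : E →L[ℝ] E [⋀^Fin 4]→L[ℝ] ℝ) (x₁ x₂ x₃ x₄ x₅ : E) :
    alternatizeUncurryFin L ![x₁, x₂, x₃, x₄, x₅] =
      L x₁ ![x₂, x₃, x₄, x₅] - L x₂ ![x₁, x₃, x₄, x₅] + L x₃ ![x₁, x₂, x₄, x₅] - L x₄ ![x₁, x₂, x₃, x₅] + L x₅ ![x₁, x₂, x₃, x₄] := by
  rw [alternatizeUncurryFin_apply, Fin.sum_univ_five]
  have h₀ : Fin.removeNth 0 ![x₁, x₂, x₃, x₄, x₅] = ![x₂, x₃, x₄, x₅] := by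
    funext i; fin_cases i <;> rfl
  have h₁ : Fin.removeNth 1 ![x₁, x₂, x₃, x₄, x₅] = ![x₁, x₃, x₄, x₅] := by
    funext i; fin_cases i <;> rfl
  have h₂ : Fin.removeNth 2 ![x₁, x₂, x₃, x₄, x₅] = ![x₁, x₂, x₄, x₅] := by
    funext i; fin_cases i <;> rfl
  have h₃ : Fin.removeNth 3 ![x₁, x₂, x₃, x₄, x₅] = ![x₁, x₂, x₃, x₅] := by
    funext i; fin_cases i <;> rfl
  have h₄ : Fin.removeNth 4 ![x₁, x₂, x₃, x₄, x₅] = ![x₁, x₂, x₃, x₄] := by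
    funext i; fin_cases i <;> rfl
  rw [h₀, h₁, h₂, h₃, h₄]
  simp only [Matrix.cons_val, Fin.val_zero, Fin.val_one, Fin.val_two, Fin.isValue]
  norm_num [pow_succ, Matrix.cons_val]
  try ring

theorem tuple_eq_two {X : Type*} (v : Fin 2 → X) : v = ![v 0, v 1] := by
  funext i; fin_cases i <;> rfl

theorem tuple_eq_three {X : Type*} (v : Fin 3 → X) : v = ![v 0, v 1, v 2] := by
  funext i; fin_cases i <;> rfl

theorem tuple_eq_four {X : Type*} (v : Fin 4 → X) : v = ![v 0, v 1, v 2, v 3] := by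
  funext i; fin_cases i <;> rfl

theorem tuple_eq_five {X : Type*} (v : Fin 5 → X) : v = ![v 0, v 1, v 2, v 3, v 4] := by
  funext i; fin_cases i <;> rfl

theorem alternatize_wedge_one_one (L : E →L[ℝ] E [⋀^Fin 1]→L[ℝ] ℝ) (b : E [⋀^Fin 1]→L[ℝ] ℝ)
    (M : E →L[ℝ] E [⋀^Fin 2]→L[ℝ] ℝ) (hM : ∀ u, M u = wedgeAt (L u) b) :
    alternatizeUncurryFin M = wedgeAt (alternatizeUncurryFin L) b := by
  ext v
  rw [tuple_eq_three v, wedgeAt_two_one, alternatizeUncurryFin_two]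
  simp only [hM, wedgeAt_one_one, alternatizeUncurryFin_one]
  ring

theorem alternatize_wedge_two_one (L : E →L[ℝ] E [⋀^Fin 2]→L[ℝ] ℝ) (b : E [⋀^Fin 1]→L[ℝ] ℝ)
    (M : E →L[ℝ] E [⋀^Fin 3]→L[ℝ] ℝ) (hM : ∀ u, M u = wedgeAt (L u) b) :
    alternatizeUncurryFin M = wedgeAt (alternatizeUncurryFin L) b := by
  ext v
  rw [tuple_eq_four v, wedgeAt_three_one, alternatizeUncurryFin_three]
  simp only [hM, wedgeAt_two_one, alternatizeUncurryFin_two]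
  ring

theorem alternatize_wedge_three_one (L : E →L[ℝ] E [⋀^Fin 3]→L[ℝ] ℝ) (b : E [⋀^Fin 1]→L[ℝ] ℝ)
    (M : E →L[ℝ] E [⋀^Fin 4]→L[ℝ] ℝ) (hM : ∀ u, M u = wedgeAt (L u) b) :
    alternatizeUncurryFin M = wedgeAt (alternatizeUncurryFin L) b := by
  ext v
  rw [tuple_eq_five v, wedgeAt_four_one, alternatizeUncurryFin_four]
  simp only [hM, wedgeAt_three_one, alternatizeUncurryFin_three]
  ring

theorem alternatize_wedge_two_two (L : E →L[ℝ] E [⋀^Fin 2]→L[ℝ] ℝ) (b : E [⋀^Fin 2]→L[ℝ] ℝ)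
    (M : E →L[ℝ] E [⋀^Fin 4]→L[ℝ] ℝ) (hM : ∀ u, M u = wedgeAt (L u) b) :
    alternatizeUncurryFin M = wedgeAt (alternatizeUncurryFin L) b := by
  ext v
  rw [tuple_eq_five v, wedgeAt_three_two, alternatizeUncurryFin_four]
  simp only [hM, wedgeAt_two_two, alternatizeUncurryFin_two]
  ring

theorem alternatize_smul_one (ξ : E →L[ℝ] ℝ) (b : E [⋀^Fin 1]→L[ℝ] ℝ)
    (M : E →L[ℝ] E [⋀^Fin 1]→L[ℝ] ℝ) (hM : ∀ u, M u = ξ u • b) :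
    alternatizeUncurryFin M = wedgeAt (covector ξ) b := by
  ext v
  rw [tuple_eq_two v, wedgeAt_one_one, alternatizeUncurryFin_one]
  simp only [hM, ContinuousAlternatingMap.smul_apply, smul_eq_mul, covector_apply, Matrix.cons_val]
  try ring

theorem alternatize_smul_two (ξ : E →L[ℝ] ℝ) (b : E [⋀^Fin 2]→L[ℝ] ℝ)
    (M : E →L[ℝ] E [⋀^Fin 2]→L[ℝ] ℝ) (hM : ∀ u, M u = ξ u • b) :
    alternatizeUncurryFin M = wedgeAt (covector ξ) b := by
  ext v
  rw [tuple_eq_three v, wedgeAt_one_two, alternatizeUncurryFin_two]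
  simp only [hM, ContinuousAlternatingMap.smul_apply, smul_eq_mul, covector_apply, Matrix.cons_val]
  try ring

theorem alternatize_smul_three (ξ : E →L[ℝ] ℝ) (b : E [⋀^Fin 3]→L[ℝ] ℝ)
    (M : E →L[ℝ] E [⋀^Fin 3]→L[ℝ] ℝ) (hM : ∀ u, M u = ξ u • b) :
    alternatizeUncurryFin M = wedgeAt (covector ξ) b := by
  ext v
  rw [tuple_eq_four v, wedgeAt_one_three, alternatizeUncurryFin_three]
  simp only [hM, ContinuousAlternatingMap.smul_apply, smul_eq_mul, covector_apply, Matrix.cons_val]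
  try ring

end Leibniz

section Leibniz

open ContinuousAlternatingMap

variable {E : Type*} [NormedAddCommGroup E] [NormedSpace ℝ E]

theorem wedgeAt_comm_two_two (a b : E [⋀^Fin 2]→L[ℝ] ℝ) : wedgeAt a b = wedgeAt b a := by
  ext v
  rw [tuple_eq_four v, wedgeAt_two_two, wedgeAt_two_two]
  ring

theorem wedgeAt_assoc_one_two_two (a : E [⋀^Fin 1]→L[ℝ] ℝ) (b c : E [⋀^Fin 2]→L[ℝ] ℝ) :
    (wedgeAt (wedgeAt a b : E [⋀^Fin 3]→L[ℝ] ℝ) c : E [⋀^Fin 5]→L[ℝ] ℝ) =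
      wedgeAt a (wedgeAt b c : E [⋀^Fin 4]→L[ℝ] ℝ) := by
  ext v
  rw [tuple_eq_five v, wedgeAt_three_two, wedgeAt_one_four]
  simp only [wedgeAt_one_two, wedgeAt_two_two]
  ring

theorem alternatize_wedge_right_one_one (a : E [⋀^Fin 1]→L[ℝ] ℝ) (L : E →L[ℝ] E [⋀^Fin 1]→L[ℝ] ℝ)
    (M : E →L[ℝ] E [⋀^Fin 2]→L[ℝ] ℝ) (hM : ∀ u, M u = wedgeAt a (L u))
    (hL : alternatizeUncurryFin L = 0) :
    alternatizeUncurryFin M = 0 := by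
  have hL' : ∀ x y : E, L x ![y] = L y ![x] := fun x y => by
    have := congrArg (fun c => c ![x, y]) hL
    simp only [alternatizeUncurryFin_one] at this
    simpa [sub_eq_zero] using this
  ext v
  rw [tuple_eq_three v, alternatizeUncurryFin_two]
  simp only [hM, wedgeAt_one_one]
  change _ = (0 : ℝ)
  rw [hL' (v 0) (v 1), hL' (v 0) (v 2), hL' (v 1) (v 2)]
  ring

theorem alternatize_wedge_right_two_one (a : E [⋀^Fin 2]→L[ℝ] ℝ) (L : E →L[ℝ] E [⋀^Fin 1]→L[ℝ] ℝ)
    (M : E →L[ℝ] E [⋀^Fin 3]→L[ℝ] ℝ) (hM : ∀ u, M u = wedgeAt a (L u))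
    (hL : alternatizeUncurryFin L = 0) :
    alternatizeUncurryFin M = 0 := by
  have hL' : ∀ x y : E, L x ![y] = L y ![x] := fun x y => by
    have := congrArg (fun c => c ![x, y]) hL
    simp only [alternatizeUncurryFin_one] at this
    simpa [sub_eq_zero] using this
  ext v
  rw [tuple_eq_four v, alternatizeUncurryFin_three]
  simp only [hM, wedgeAt_two_one]
  change _ = (0 : ℝ)
  rw [hL' (v 0) (v 1), hL' (v 0) (v 2), hL' (v 0) (v 3), hL' (v 1) (v 2), hL' (v 1) (v 3), hL' (v 2) (v 3)]
  ring

theorem alternatize_wedge_right_three_one (a : E [⋀^Fin 3]→L[ℝ] ℝ) (L : E →L[ℝ] E [⋀^Fin 1]→L[ℝ] ℝ)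
    (M : E →L[ℝ] E [⋀^Fin 4]→L[ℝ] ℝ) (hM : ∀ u, M u = wedgeAt a (L u))
    (hL : alternatizeUncurryFin L = 0) :
    alternatizeUncurryFin M = 0 := by
  have hL' : ∀ x y : E, L x ![y] = L y ![x] := fun x y => by
    have := congrArg (fun c => c ![x, y]) hL
    simp only [alternatizeUncurryFin_one] at this
    simpa [sub_eq_zero] using this
  ext v
  rw [tuple_eq_five v, alternatizeUncurryFin_four]
  simp only [hM, wedgeAt_three_one]
  change _ = (0 : ℝ)
  rw [hL' (v 0) (v 1), hL' (v 0) (v 2), hL' (v 0) (v 3), hL' (v 0) (v 4), hL' (v 1) (v 2), hL' (v 1) (v 3), hL' (v 1) (v 4), hL' (v 2) (v 3), hL' (v 2) (v 4), hL' (v 3) (v 4)]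
  ring

theorem extDeriv_smul_one {f : E → ℝ} {b : E → E [⋀^Fin 1]→L[ℝ] ℝ} {x : E}
    (hf : DifferentiableAt ℝ f x) (hb : DifferentiableAt ℝ b x) :
    extDeriv (fun y => f y • b y) x =
      (wedgeAt (covector (fderiv ℝ f x)) (b x) : E [⋀^Fin 2]→L[ℝ] ℝ) + f x • extDeriv b x := by
  rw [extDeriv, fderiv_fun_smul hf hb, alternatizeUncurryFin_add, alternatizeUncurryFin_smul]
  refine (add_comm _ _).trans (congrArg (· + f x • extDeriv b x) ?_)
  exact alternatize_smul_one (fderiv ℝ f x) (b x) _ fun u => rfl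

theorem extDeriv_smul_two {f : E → ℝ} {b : E → E [⋀^Fin 2]→L[ℝ] ℝ} {x : E}
    (hf : DifferentiableAt ℝ f x) (hb : DifferentiableAt ℝ b x) :
    extDeriv (fun y => f y • b y) x =
      (wedgeAt (covector (fderiv ℝ f x)) (b x) : E [⋀^Fin 3]→L[ℝ] ℝ) + f x • extDeriv b x := by
  rw [extDeriv, fderiv_fun_smul hf hb, alternatizeUncurryFin_add, alternatizeUncurryFin_smul]
  refine (add_comm _ _).trans (congrArg (· + f x • extDeriv b x) ?_)
  exact alternatize_smul_two (fderiv ℝ f x) (b x) _ fun u => rfl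

theorem extDeriv_smul_three {f : E → ℝ} {b : E → E [⋀^Fin 3]→L[ℝ] ℝ} {x : E}
    (hf : DifferentiableAt ℝ f x) (hb : DifferentiableAt ℝ b x) :
    extDeriv (fun y => f y • b y) x =
      (wedgeAt (covector (fderiv ℝ f x)) (b x) : E [⋀^Fin 4]→L[ℝ] ℝ) + f x • extDeriv b x := by
  rw [extDeriv, fderiv_fun_smul hf hb, alternatizeUncurryFin_add, alternatizeUncurryFin_smul]
  refine (add_comm _ _).trans (congrArg (· + f x • extDeriv b x) ?_)
  exact alternatize_smul_three (fderiv ℝ f x) (b x) _ fun u => rfl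

theorem extDeriv_wedge_one_one [FiniteDimensional ℝ E] {a : E → E [⋀^Fin 1]→L[ℝ] ℝ}
    {b : E → E [⋀^Fin 1]→L[ℝ] ℝ} {x : E} (ha : DifferentiableAt ℝ a x)
    (hb : DifferentiableAt ℝ b x) (hdb : extDeriv b x = 0) :
    extDeriv (fun y => (wedgeAt (a y) (b y) : E [⋀^Fin 2]→L[ℝ] ℝ)) x =
      wedgeAt (extDeriv a x) (b x) := by
  let M₁ : E →L[ℝ] E [⋀^Fin 2]→L[ℝ] ℝ :=
    fderiv ℝ (fun y => (wedgeAt (a y) (b x) : E [⋀^Fin 2]→L[ℝ] ℝ)) x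
  let M₂ : E →L[ℝ] E [⋀^Fin 2]→L[ℝ] ℝ :=
    fderiv ℝ (fun y => (wedgeAt (a x) (b y) : E [⋀^Fin 2]→L[ℝ] ℝ)) x
  have h₁ : ∀ u, M₁ u = wedgeAt (fderiv ℝ a x u) (b x) := fun u => by
    refine (fderiv_wedgeAt ha (differentiableAt_const _) u).trans ?_
    simp [wedgeAt_zero_right]
  have h₂ : ∀ u, M₂ u = wedgeAt (a x) (fderiv ℝ b x u) := fun u => by
    refine (fderiv_wedgeAt (differentiableAt_const _) hb u).trans ?_
    simp [wedgeAt_zero_left]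
  have h : fderiv ℝ (fun y => (wedgeAt (a y) (b y) : E [⋀^Fin 2]→L[ℝ] ℝ)) x = M₁ + M₂ := by
    ext1 u
    rw [_root_.add_apply, h₁, h₂]
    exact fderiv_wedgeAt ha hb u
  rw [extDeriv, h, alternatizeUncurryFin_add, alternatize_wedge_right_one_one _ _ M₂ h₂ hdb,
    add_zero]
  exact alternatize_wedge_one_one _ _ M₁ h₁

theorem extDeriv_wedge_two_one [FiniteDimensional ℝ E] {a : E → E [⋀^Fin 2]→L[ℝ] ℝ}
    {b : E → E [⋀^Fin 1]→L[ℝ] ℝ} {x : E} (ha : DifferentiableAt ℝ a x)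
    (hb : DifferentiableAt ℝ b x) (hdb : extDeriv b x = 0) :
    extDeriv (fun y => (wedgeAt (a y) (b y) : E [⋀^Fin 3]→L[ℝ] ℝ)) x =
      wedgeAt (extDeriv a x) (b x) := by
  let M₁ : E →L[ℝ] E [⋀^Fin 3]→L[ℝ] ℝ :=
    fderiv ℝ (fun y => (wedgeAt (a y) (b x) : E [⋀^Fin 3]→L[ℝ] ℝ)) x
  let M₂ : E →L[ℝ] E [⋀^Fin 3]→L[ℝ] ℝ :=
    fderiv ℝ (fun y => (wedgeAt (a x) (b y) : E [⋀^Fin 3]→L[ℝ] ℝ)) x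
  have h₁ : ∀ u, M₁ u = wedgeAt (fderiv ℝ a x u) (b x) := fun u => by
    refine (fderiv_wedgeAt ha (differentiableAt_const _) u).trans ?_
    simp [wedgeAt_zero_right]
  have h₂ : ∀ u, M₂ u = wedgeAt (a x) (fderiv ℝ b x u) := fun u => by
    refine (fderiv_wedgeAt (differentiableAt_const _) hb u).trans ?_
    simp [wedgeAt_zero_left]
  have h : fderiv ℝ (fun y => (wedgeAt (a y) (b y) : E [⋀^Fin 3]→L[ℝ] ℝ)) x = M₁ + M₂ := by
    ext1 u
    rw [_root_.add_apply, h₁, h₂]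
    exact fderiv_wedgeAt ha hb u
  rw [extDeriv, h, alternatizeUncurryFin_add, alternatize_wedge_right_two_one _ _ M₂ h₂ hdb,
    add_zero]
  exact alternatize_wedge_two_one _ _ M₁ h₁

theorem extDeriv_wedge_three_one [FiniteDimensional ℝ E] {a : E → E [⋀^Fin 3]→L[ℝ] ℝ}
    {b : E → E [⋀^Fin 1]→L[ℝ] ℝ} {x : E} (ha : DifferentiableAt ℝ a x)
    (hb : DifferentiableAt ℝ b x) (hdb : extDeriv b x = 0) :
    extDeriv (fun y => (wedgeAt (a y) (b y) : E [⋀^Fin 4]→L[ℝ] ℝ)) x =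
      wedgeAt (extDeriv a x) (b x) := by
  let M₁ : E →L[ℝ] E [⋀^Fin 4]→L[ℝ] ℝ :=
    fderiv ℝ (fun y => (wedgeAt (a y) (b x) : E [⋀^Fin 4]→L[ℝ] ℝ)) x
  let M₂ : E →L[ℝ] E [⋀^Fin 4]→L[ℝ] ℝ :=
    fderiv ℝ (fun y => (wedgeAt (a x) (b y) : E [⋀^Fin 4]→L[ℝ] ℝ)) x
  have h₁ : ∀ u, M₁ u = wedgeAt (fderiv ℝ a x u) (b x) := fun u => by
    refine (fderiv_wedgeAt ha (differentiableAt_const _) u).trans ?_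
    simp [wedgeAt_zero_right]
  have h₂ : ∀ u, M₂ u = wedgeAt (a x) (fderiv ℝ b x u) := fun u => by
    refine (fderiv_wedgeAt (differentiableAt_const _) hb u).trans ?_
    simp [wedgeAt_zero_left]
  have h : fderiv ℝ (fun y => (wedgeAt (a y) (b y) : E [⋀^Fin 4]→L[ℝ] ℝ)) x = M₁ + M₂ := by
    ext1 u
    rw [_root_.add_apply, h₁, h₂]
    exact fderiv_wedgeAt ha hb u
  rw [extDeriv, h, alternatizeUncurryFin_add, alternatize_wedge_right_three_one _ _ M₂ h₂ hdb,
    add_zero]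
  exact alternatize_wedge_three_one _ _ M₁ h₁

theorem extDeriv_wedge_self [FiniteDimensional ℝ E] {a : E → E [⋀^Fin 2]→L[ℝ] ℝ} {x : E}
    (ha : DifferentiableAt ℝ a x) :
    extDeriv (fun y => (wedgeAt (a y) (a y) : E [⋀^Fin 4]→L[ℝ] ℝ)) x =
      (2 : ℝ) • (wedgeAt (extDeriv a x) (a x) : E [⋀^Fin 5]→L[ℝ] ℝ) := by
  let M : E →L[ℝ] E [⋀^Fin 4]→L[ℝ] ℝ :=
    fderiv ℝ (fun y => (wedgeAt (a y) (a x) : E [⋀^Fin 4]→L[ℝ] ℝ)) x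
  have hM : ∀ u, M u = wedgeAt (fderiv ℝ a x u) (a x) := fun u => by
    refine (fderiv_wedgeAt ha (differentiableAt_const _) u).trans ?_
    simp [wedgeAt_zero_right]
  have h : fderiv ℝ (fun y => (wedgeAt (a y) (a y) : E [⋀^Fin 4]→L[ℝ] ℝ)) x = (2 : ℝ) • M := by
    ext1 u
    refine (fderiv_wedgeAt ha ha u).trans ?_
    rw [wedgeAt_comm_two_two (a x), _root_.smul_apply, hM]
    exact (two_smul ℝ _).symm
  rw [extDeriv, h, alternatizeUncurryFin_smul]
  congr 1
  exact alternatize_wedge_two_two _ _ M hM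

end Leibniz

section Forms

variable {E : Type*} [NormedAddCommGroup E] [NormedSpace ℝ E]
  {H : Type*} [TopologicalSpace H] {I : ModelWithCorners ℝ E H}
  {M : Type*} [TopologicalSpace M] [ChartedSpace H M] {k l : ℕ}

/-- Differentiability of a form at a point, in the preferred chart. -/
def FormDifferentiableAt (η : DForm I M k) (x : M) : Prop :=
  DifferentiableAt ℝ (inChart x η) (extChartAt I x x)

/-- The differential of a function, as a `1`-form. -/
def differential (I : ModelWithCorners ℝ E H) {M : Type*} [TopologicalSpace M] [ChartedSpace H M]
    (f : M → ℝ) : DForm I M 1 := fun x =>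
  covector (mfderiv I 𝓘(ℝ) f x : TangentSpace I x →L[ℝ] ℝ)

theorem wedgeAt_comp {V V' : Type*} [AddCommGroup V] [Module ℝ V] [TopologicalSpace V]
    [AddCommGroup V'] [Module ℝ V'] [TopologicalSpace V'] (a : V [⋀^Fin k]→L[ℝ] ℝ)
    (b : V [⋀^Fin l]→L[ℝ] ℝ) (P : V' →L[ℝ] V) :
    (wedgeAt a b).compContinuousLinearMap P =
      wedgeAt (a.compContinuousLinearMap P) (b.compContinuousLinearMap P) := by
  ext v
  rw [ContinuousAlternatingMap.compContinuousLinearMap_apply, wedgeAt_apply, wedgeAt_apply]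
  rfl

theorem inChart_wedge (x : M) (η : DForm I M k) (θ : DForm I M l) :
    inChart x (η ⋏ θ) = fun y => wedgeAt (inChart x η y) (inChart x θ y) :=
  funext fun _ => wedgeAt_comp _ _ _

theorem IsSmooth.formDifferentiableAt [I.Boundaryless] {η : DForm I M k} (h : IsSmooth η) (x : M) :
    FormDifferentiableAt η x :=
  ((h x).contDiffAt (extChartAt_target_mem_nhds x)).differentiableAt (by simp)

theorem FormDifferentiableAt.add {η θ : DForm I M k} {x : M} (hη : FormDifferentiableAt η x)
    (hθ : FormDifferentiableAt θ x) : FormDifferentiableAt (η + θ) x :=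
  DifferentiableAt.add hη hθ

theorem FormDifferentiableAt.smul {η : DForm I M k} {x : M} (c : ℝ)
    (hη : FormDifferentiableAt η x) : FormDifferentiableAt (c • η) x :=
  DifferentiableAt.const_smul hη c

theorem FormDifferentiableAt.neg {η : DForm I M k} {x : M}
    (hη : FormDifferentiableAt η x) : FormDifferentiableAt (-η) x :=
  DifferentiableAt.neg hη

theorem FormDifferentiableAt.sub {η θ : DForm I M k} {x : M} (hη : FormDifferentiableAt η x)
    (hθ : FormDifferentiableAt θ x) : FormDifferentiableAt (η - θ) x :=
  DifferentiableAt.sub hη hθ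

theorem FormDifferentiableAt.wedge [FiniteDimensional ℝ E] {η : DForm I M k} {θ : DForm I M l}
    {x : M} (hη : FormDifferentiableAt η x)
    (hθ : FormDifferentiableAt θ x) : FormDifferentiableAt (η ⋏ θ) x := by
  rw [FormDifferentiableAt, inChart_wedge]
  exact differentiableAt_wedgeAt hη hθ

variable [IsManifold I 1 M]

theorem inChart_self (η : DForm I M k) (x : M) :
    inChart x η (extChartAt I x x) = η x := by
  ext v
  have h : ∀ y, y = x → ∀ v : Fin k → E, (η y : E [⋀^Fin k]→L[ℝ] ℝ) v = η x v := by
    rintro _ rfl _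
    rfl
  rw [inChart, mfderivWithin_range_extChartAt_symm]
  exact h _ (extChartAt_to_inv x) v

variable [I.Boundaryless]

theorem extD_eq (η : DForm I M k) (x : M) :
    extD η x = extDeriv (inChart x η) (extChartAt I x x) := by
  rw [extD, I.range_eq_univ, extDerivWithin_univ, mfderiv_extChartAt_self]
  rfl

theorem extD_add {η θ : DForm I M k} {x : M} (hη : FormDifferentiableAt η x)
    (hθ : FormDifferentiableAt θ x) : extD (η + θ) x = extD η x + extD θ x := by
  rw [extD_eq, extD_eq, extD_eq]
  exact extDeriv_add hη hθ

theorem extD_smul (c : ℝ) (η : DForm I M k) (x : M) : extD (c • η) x = c • extD η x := by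
  rw [extD_eq, extD_eq]
  exact extDeriv_smul c (inChart x η)

theorem extD_neg (η : DForm I M k) (x : M) : extD (-η) x = -extD η x := by
  rw [extD_eq, extD_eq]
  change extDeriv (-inChart x η) _ = _
  have h := extDeriv_smul (-1 : ℝ) (inChart x η) (x := extChartAt I x x)
  rw [neg_one_smul, neg_one_smul] at h
  exact h

theorem extD_zero (x : M) : extD (0 : DForm I M k) x = 0 := by
  rw [extD_eq]
  change extDeriv (fun _ : E => (0 : E [⋀^Fin k]→L[ℝ] ℝ)) _ = _
  rw [extDeriv, fderiv_const_apply]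
  ext v
  simp [ContinuousAlternatingMap.alternatizeUncurryFin_apply]
  rfl

theorem extD_sub {η θ : DForm I M k} {x : M} (hη : FormDifferentiableAt η x)
    (hθ : FormDifferentiableAt θ x) : extD (η - θ) x = extD η x - extD θ x := by
  rw [sub_eq_add_neg, extD_add hη hθ.neg, extD_neg, ← sub_eq_add_neg]

omit [IsManifold I 1 M] in
theorem differentiableAt_comp_chart {f : M → ℝ} {x : M} (hf : MDifferentiableAt I 𝓘(ℝ) f x) :
    DifferentiableAt ℝ (fun y => f ((extChartAt I x).symm y)) (extChartAt I x x) := by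
  have := hf.differentiableWithinAt_writtenInExtChartAt
  rw [I.range_eq_univ, differentiableWithinAt_univ] at this
  exact this

omit [IsManifold I 1 M] in
theorem differential_apply {f : M → ℝ} {x : M} (hf : MDifferentiableAt I 𝓘(ℝ) f x) :
    differential I f x =
      covector (fderiv ℝ (fun y => f ((extChartAt I x).symm y)) (extChartAt I x x)) := by
  rw [differential, hf.mfderiv, I.range_eq_univ, fderivWithin_univ]
  rfl

omit [IsManifold I 1 M] in
theorem FormDifferentiableAt.fsmul {f : M → ℝ} {η : DForm I M k} {x : M}
    (hf : MDifferentiableAt I 𝓘(ℝ) f x) (hη : FormDifferentiableAt η x) :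
    FormDifferentiableAt (f •ᶠ η) x :=
  (differentiableAt_comp_chart hf).smul hη

theorem extD_fsmul_one {f : M → ℝ} {η : DForm I M 1} {x : M}
    (hf : MDifferentiableAt I 𝓘(ℝ) f x) (hη : FormDifferentiableAt η x) :
    extD (f •ᶠ η) x =
      (wedgeAt (differential I f x) (η x) : TangentSpace I x [⋀^Fin 2]→L[ℝ] ℝ) + f x • extD η x := by
  rw [extD_eq, extD_eq, differential_apply hf, ← inChart_self η x]
  refine (extDeriv_smul_one (differentiableAt_comp_chart hf) hη).trans ?_
  rw [extChartAt_to_inv x]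
  rfl

theorem extD_fsmul_two {f : M → ℝ} {η : DForm I M 2} {x : M}
    (hf : MDifferentiableAt I 𝓘(ℝ) f x) (hη : FormDifferentiableAt η x) :
    extD (f •ᶠ η) x =
      (wedgeAt (differential I f x) (η x) : TangentSpace I x [⋀^Fin 3]→L[ℝ] ℝ) + f x • extD η x := by
  rw [extD_eq, extD_eq, differential_apply hf, ← inChart_self η x]
  refine (extDeriv_smul_two (differentiableAt_comp_chart hf) hη).trans ?_
  rw [extChartAt_to_inv x]
  rfl

theorem extD_fsmul_three {f : M → ℝ} {η : DForm I M 3} {x : M}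
    (hf : MDifferentiableAt I 𝓘(ℝ) f x) (hη : FormDifferentiableAt η x) :
    extD (f •ᶠ η) x =
      (wedgeAt (differential I f x) (η x) : TangentSpace I x [⋀^Fin 4]→L[ℝ] ℝ) + f x • extD η x := by
  rw [extD_eq, extD_eq, differential_apply hf, ← inChart_self η x]
  refine (extDeriv_smul_three (differentiableAt_comp_chart hf) hη).trans ?_
  rw [extChartAt_to_inv x]
  rfl

set_option maxRecDepth 20000 in
theorem extD_wedge_self [FiniteDimensional ℝ E] {η : DForm I M 2} {x : M}
    (hη : FormDifferentiableAt η x) :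
    extD (η ⋏ η) x =
      (2 : ℝ) • (wedgeAt (extD η x) (η x) : TangentSpace I x [⋀^Fin 5]→L[ℝ] ℝ) := by
  have h₁ : (extD η x : E [⋀^Fin 3]→L[ℝ] ℝ) = extDeriv (inChart x η) (extChartAt I x x) := extD_eq η x
  have h : (inChart x η (extChartAt I x x) : E [⋀^Fin 2]→L[ℝ] ℝ) = η x := inChart_self η x
  rw [extD_eq, inChart_wedge]
  refine (extDeriv_wedge_self hη).trans ?_
  rw [h, ← h₁]
  rfl

end Forms

section Product

variable {E : Type*} [NormedAddCommGroup E] [NormedSpace ℝ E]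
  {H : Type*} [TopologicalSpace H] {I : ModelWithCorners ℝ E H} [I.Boundaryless]
  {M : Type*} [TopologicalSpace M] [ChartedSpace H M] [IsManifold I 1 M]
  {E' : Type*} [NormedAddCommGroup E'] [NormedSpace ℝ E']
  {H' : Type*} [TopologicalSpace H'] {I' : ModelWithCorners ℝ E' H'} [I'.Boundaryless]
  {M' : Type*} [TopologicalSpace M'] [ChartedSpace H' M'] [IsManifold I' 1 M'] {k : ℕ}

theorem mdifferentiableAt_extChartAt_symm {x : M} {y : E} (hy : y ∈ (extChartAt I x).target) :
    MDifferentiableAt 𝓘(ℝ, E) I (extChartAt I x).symm y := by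
  have := mdifferentiableWithinAt_extChartAt_symm hy
  rwa [I.range_eq_univ, mdifferentiableWithinAt_univ] at this

theorem inChart_pullback {N : Type*} [TopologicalSpace N] {F : Type*} [NormedAddCommGroup F]
    [NormedSpace ℝ F] {G : Type*} [TopologicalSpace G] {J : ModelWithCorners ℝ F G}
    [J.Boundaryless] [ChartedSpace G N] [IsManifold J 1 N] {π : N → M} (hπ : MDifferentiable J I π)
    {p : N} {x : M} {L : F →L[ℝ] E}
    (hL : ∀ y, π ((extChartAt J p).symm y) = (extChartAt I x).symm (L y)) (η : DForm I M k) {y : F}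
    (hy : y ∈ (extChartAt J p).target) (hy' : L y ∈ (extChartAt I x).target) :
    inChart p (pullback (I' := J) π η) y = (inChart x η (L y)).compContinuousLinearMap L := by
  have h₁ := mfderiv_comp y (hπ ((extChartAt J p).symm y)) (mdifferentiableAt_extChartAt_symm hy)
  have h₂ := mfderiv_comp y (mdifferentiableAt_extChartAt_symm hy')
    L.differentiableAt.mdifferentiableAt
  have h₃ : π ∘ (extChartAt J p).symm = (extChartAt I x).symm ∘ L := funext hL
  rw [mfderiv_eq_fderiv, L.fderiv] at h₂
  rw [h₃] at h₁
  ext v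
  simp only [inChart, pullback, ContinuousAlternatingMap.compContinuousLinearMap_apply,
    I.range_eq_univ, J.range_eq_univ, mfderivWithin_univ]
  have h₄ : ∀ (z w : M), z = w → ∀ v : Fin k → E, (η z : E [⋀^Fin k]→L[ℝ] ℝ) v =
      (η w : E [⋀^Fin k]→L[ℝ] ℝ) v := by
    rintro _ _ rfl _
    rfl
  refine (h₄ _ _ (hL y) _).trans (congrArg (η _) ?_)
  funext i
  exact (congrArg (fun T : F →L[ℝ] E => T (v i)) (h₁.symm.trans h₂))

/-- Exterior derivative and pullback along a map which is linear in charts. -/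
theorem pullback_calculus {N : Type*} [TopologicalSpace N] {F : Type*} [NormedAddCommGroup F]
    [NormedSpace ℝ F] {G : Type*} [TopologicalSpace G] {J : ModelWithCorners ℝ F G}
    [J.Boundaryless] [ChartedSpace G N] [IsManifold J 1 N] {π : N → M} (hπ : MDifferentiable J I π)
    {p : N} {L : F →L[ℝ] E}
    (hL : ∀ y, π ((extChartAt J p).symm y) = (extChartAt I (π p)).symm (L y))
    (hLp : L (extChartAt J p p) = extChartAt I (π p) (π p)) (hd : mfderiv J I π p = L)
    {η : DForm I M k} (hη : FormDifferentiableAt η (π p)) :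
    FormDifferentiableAt (pullback (I' := J) π η) p ∧
      extD (pullback (I' := J) π η) p = pullback (I' := J) π (extD η) p := by
  have hev : inChart p (pullback (I' := J) π η) =ᶠ[𝓝 (extChartAt J p p)]
      fun y => (inChart (π p) η (L y)).compContinuousLinearMap (fderiv ℝ L y) := by
    have h₁ := extChartAt_target_mem_nhds (I := J) p
    have h₂ : L ⁻¹' (extChartAt I (π p)).target ∈ 𝓝 (extChartAt J p p) :=
      L.continuous.continuousAt (hLp ▸ extChartAt_target_mem_nhds (I := I) (π p))
    filter_upwards [h₁, h₂] with y hy hy'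
    rw [L.fderiv]
    exact inChart_pullback hπ hL η hy hy'
  have hη' : DifferentiableAt ℝ (inChart (π p) η) (L (extChartAt J p p)) := by
    rw [hLp]
    exact hη
  constructor
  · refine DifferentiableAt.congr_of_eventuallyEq ?_ hev
    simp only [L.fderiv]
    exact (ContinuousAlternatingMap.compContinuousLinearMapCLM L).differentiableAt.comp _
      (hη'.comp _ L.differentiableAt)
  · rw [extD_eq, hev.extDeriv_eq, extDeriv_pullback hη' L.contDiff.contDiffAt (r := 2) (by simp),
      L.fderiv, hLp, pullback, hd, extD_eq]
    rfl

theorem pullback_fst_calculus {η : DForm I M k} {p : M × M'} (hη : FormDifferentiableAt η p.1) :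
    FormDifferentiableAt (pullback (I' := I.prod I') (Prod.fst : M × M' → M) η) p ∧
      extD (pullback (I' := I.prod I') (Prod.fst : M × M' → M) η) p =
        pullback (I' := I.prod I') (Prod.fst : M × M' → M) (extD η) p := by
  refine pullback_calculus mdifferentiable_fst (L := ContinuousLinearMap.fst ℝ E E') ?_ ?_ ?_ hη
  · intro y
    rw [extChartAt_prod]
    rfl
  · rw [extChartAt_prod]
    rfl
  · exact mfderiv_fst

theorem pullback_snd_calculus {η : DForm I' M' k} {p : M × M'} (hη : FormDifferentiableAt η p.2) :
    FormDifferentiableAt (pullback (I' := I.prod I') (Prod.snd : M × M' → M') η) p ∧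
      extD (pullback (I' := I.prod I') (Prod.snd : M × M' → M') η) p =
        pullback (I' := I.prod I') (Prod.snd : M × M' → M') (extD η) p := by
  refine pullback_calculus mdifferentiable_snd (L := ContinuousLinearMap.snd ℝ E E') ?_ ?_ ?_ hη
  · intro y
    rw [extChartAt_prod]
    rfl
  · rw [extChartAt_prod]
    rfl
  · exact mfderiv_snd

end Product

section Circle

theorem form_eq_zero_of_finrank_lt {V : Type*} [AddCommGroup V] [Module ℝ V] [TopologicalSpace V]
    [Module.Finite ℝ V] {k : ℕ} (h : Module.finrank ℝ V < k) (a : V [⋀^Fin k]→L[ℝ] ℝ) : a = 0 := by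
  ext v
  refine a.toAlternatingMap.map_linearDependent v fun hv => ?_
  have := hv.fintype_card_le_finrank
  simp only [Fintype.card_fin] at this
  omega

theorem contMDiff_coe_circle : ContMDiff (𝓡 1) 𝓘(ℝ, ℂ) ∞ (fun w : Circle => (w : ℂ)) :=
  haveI : Fact (Module.finrank ℝ ℂ = 1 + 1) := ⟨Complex.finrank_real_complex⟩
  contMDiff_coe_sphere (E := ℂ)

theorem formDifferentiableAt_dθ (z : Circle) : FormDifferentiableAt dθ z := by
  let γ : EuclideanSpace ℝ (Fin 1) → ℂ := fun y => ((extChartAt (𝓡 1) z).symm y : ℂ)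
  have hγ : ContDiffOn ℝ ∞ γ (extChartAt (𝓡 1) z).target :=
    (contMDiff_coe_circle.comp_contMDiffOn (contMDiffOn_extChartAt_symm z)).contDiffOn
  have ht := extChartAt_target_mem_nhds (I := 𝓡 1) z
  have hγ' := hγ.contDiffAt ht
  have hev : inChart z dθ =ᶠ[𝓝 (extChartAt (𝓡 1) z z)] fun y =>
      covector ((Complex.imCLM ∘L ContinuousLinearMap.mul ℝ ℂ (starRingEnd ℂ (γ y))) ∘L
        fderiv ℝ γ y) := by
    filter_upwards [ht] with y hy
    have h₁ := mfderiv_comp y (contMDiff_coe_circle.mdifferentiable (by simp) _)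
      (mdifferentiableAt_extChartAt_symm hy)
    have h₂ : (fun w : Circle => (w : ℂ)) ∘ (extChartAt (𝓡 1) z).symm = γ := rfl
    rw [h₂, mfderiv_eq_fderiv] at h₁
    rw [h₁, inChart, (𝓡 1).range_eq_univ, mfderivWithin_univ]
    rfl
  refine DifferentiableAt.congr_of_eventuallyEq ?_ hev
  refine differentiableAt_form_of_apply fun v => ?_
  have h₁ : DifferentiableAt ℝ γ (extChartAt (𝓡 1) z z) := hγ'.differentiableAt (by simp)
  have h₂ : DifferentiableAt ℝ (fun y => fderiv ℝ γ y (v 0)) (extChartAt (𝓡 1) z z) :=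
    ((hγ'.fderiv_right (m := 1) (by norm_cast)).differentiableAt (by simp)).clm_apply
      (differentiableAt_const _)
  have h₃ : DifferentiableAt ℝ (fun y => starRingEnd ℂ (γ y)) (extChartAt (𝓡 1) z z) :=
    Complex.conjCLE.differentiableAt.comp _ h₁
  exact Complex.imCLM.differentiableAt.comp _ (h₃.mul h₂)

theorem extD_dθ (z : Circle) : extD dθ z = 0 := by
  rw [extD_eq]
  exact form_eq_zero_of_finrank_lt (by simp) _

variable {M : Type*} [TopologicalSpace M] [ChartedSpace (EuclideanSpace ℝ (Fin 6)) M]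
  [IsManifold (𝓡 6) 1 M] {k : ℕ} (p : M × Circle)

theorem formDifferentiableAt_ds : FormDifferentiableAt (ds M) p :=
  (pullback_snd_calculus (formDifferentiableAt_dθ p.2)).1

theorem extD_ds : extD (ds M) p = 0 := by
  refine (pullback_snd_calculus (formDifferentiableAt_dθ p.2)).2.trans ?_
  rw [pullback, extD_dθ]
  rfl

variable {p}

theorem FormDifferentiableAt.lift {η : DForm (𝓡 6) M k} (hη : FormDifferentiableAt η p.1) :
    FormDifferentiableAt (lift η) p :=
  (pullback_fst_calculus hη).1

theorem extD_lift {η : DForm (𝓡 6) M k} (hη : FormDifferentiableAt η p.1) :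
    extD (lift η) p = lift (extD η) p :=
  (pullback_fst_calculus hη).2

theorem extD_lift_wedge_ds_one {η : DForm (𝓡 6) M 1} (hη : FormDifferentiableAt η p.1) :
    extD (WarpedG2.lift η ⋏ ds M) p = wedgeAt (WarpedG2.lift (extD η) p) (ds M p) := by
  have h₁ := (extD_eq (ds M) p).symm.trans (extD_ds p)
  have h₂ := extDeriv_wedge_one_one hη.lift (formDifferentiableAt_ds p) h₁
  have h₃ : (inChart p (ds M) (extChartAt ((𝓡 6).prod (𝓡 1)) p p) : _ [⋀^Fin 1]→L[ℝ] ℝ) = ds M p :=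
    inChart_self _ p
  have h₄ := (extD_eq (WarpedG2.lift η) p).symm.trans (extD_lift hη)
  rw [extD_eq, inChart_wedge]
  refine h₂.trans ?_
  rw [h₃, h₄]
  rfl

theorem extD_lift_wedge_ds_two {η : DForm (𝓡 6) M 2} (hη : FormDifferentiableAt η p.1) :
    extD (WarpedG2.lift η ⋏ ds M) p = wedgeAt (WarpedG2.lift (extD η) p) (ds M p) := by
  have h₁ := (extD_eq (ds M) p).symm.trans (extD_ds p)
  have h₂ := extDeriv_wedge_two_one hη.lift (formDifferentiableAt_ds p) h₁
  have h₃ : (inChart p (ds M) (extChartAt ((𝓡 6).prod (𝓡 1)) p p) : _ [⋀^Fin 1]→L[ℝ] ℝ) = ds M p :=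
    inChart_self _ p
  have h₄ := (extD_eq (WarpedG2.lift η) p).symm.trans (extD_lift hη)
  rw [extD_eq, inChart_wedge]
  refine h₂.trans ?_
  rw [h₃, h₄]
  rfl

theorem extD_lift_wedge_ds_three {η : DForm (𝓡 6) M 3} (hη : FormDifferentiableAt η p.1) :
    extD (WarpedG2.lift η ⋏ ds M) p = wedgeAt (WarpedG2.lift (extD η) p) (ds M p) := by
  have h₁ := (extD_eq (ds M) p).symm.trans (extD_ds p)
  have h₂ := extDeriv_wedge_three_one hη.lift (formDifferentiableAt_ds p) h₁
  have h₃ : (inChart p (ds M) (extChartAt ((𝓡 6).prod (𝓡 1)) p p) : _ [⋀^Fin 1]→L[ℝ] ℝ) = ds M p :=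
    inChart_self _ p
  have h₄ := (extD_eq (WarpedG2.lift η) p).symm.trans (extD_lift hη)
  rw [extD_eq, inChart_wedge]
  refine h₂.trans ?_
  rw [h₃, h₄]
  rfl

end Circle

section Calculus

variable {W : Type*} [NormedAddCommGroup W] [NormedSpace ℝ W] {x : W}

theorem differentiableAt_det {ι : Type*} [Fintype ι] [DecidableEq ι] {A : W → Matrix ι ι ℝ}
    (hA : ∀ i j, DifferentiableAt ℝ (fun y => A y i j) x) :
    DifferentiableAt ℝ (fun y => (A y).det) x := by
  simp only [Matrix.det_apply]
  exact DifferentiableAt.fun_sum fun σ _ =>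
    DifferentiableAt.const_smul (HasFDerivAt.finsetProd fun i _ =>
      (hA (σ i) i).hasFDerivAt).differentiableAt _

theorem differentiableAt_matrix_inv {ι : Type*} [Fintype ι] [DecidableEq ι] {A : W → Matrix ι ι ℝ}
    (hA : ∀ i j, DifferentiableAt ℝ (fun y => A y i j) x) (hx : (A x).det ≠ 0) (i j : ι) :
    DifferentiableAt ℝ (fun y => (A y)⁻¹ i j) x := by
  simp only [Matrix.inv_def, Ring.inverse_eq_inv', Matrix.smul_apply, smul_eq_mul,
    Matrix.adjugate_apply]
  refine ((differentiableAt_det hA).inv hx).mul (differentiableAt_det fun i' j' => ?_)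
  simp only [Matrix.updateRow_apply]
  split_ifs
  · exact differentiableAt_const _
  · exact hA _ _

theorem gram_det_ne_zero {V : Type*} [AddCommGroup V] [Module ℝ V] [TopologicalSpace V]
    {ι : Type*} [Fintype ι] [DecidableEq ι] (b : Module.Basis ι ℝ V) {g : V →L[ℝ] V →L[ℝ] ℝ}
    (hg : ∀ v, v ≠ 0 → 0 < g v v) : (Matrix.of fun p q => g (b p) (b q)).det ≠ 0 := by
  rw [Ne, ← Matrix.exists_mulVec_eq_zero_iff]
  rintro ⟨c, hc, h⟩
  have hv : ∑ i, c i • b i ≠ 0 := fun h0 =>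
    hc (funext fun i => Fintype.linearIndependent_iff.1 b.linearIndependent c h0 i)
  refine (hg _ hv).ne' ?_
  have hp : ∀ p, g (b p) (∑ i, c i • b i) = 0 := fun p => by
    have := congrFun h p
    rw [map_sum]
    simpa [Matrix.mulVec, dotProduct, mul_comm] using this
  have : ∀ w, g (∑ i, c i • b i) w = ∑ i, c i * g (b i) w := fun w => by simp
  rw [this]
  simp [hp]

/-- Differentiability of the Hodge star in its arguments. -/
theorem differentiableAt_hodgeStarAt {E : Type*} [NormedAddCommGroup E] [NormedSpace ℝ E]
    [FiniteDimensional ℝ E] {k m : ℕ} {g : W → E →L[ℝ] E →L[ℝ] ℝ}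
    {ν : W → E [⋀^Fin (k + m)]→L[ℝ] ℝ} {a : W → E [⋀^Fin k]→L[ℝ] ℝ}
    (hg : ∀ u v, DifferentiableAt ℝ (fun y => g y u v) x) (hν : DifferentiableAt ℝ ν x)
    (ha : DifferentiableAt ℝ a x) (hx : ∀ v, v ≠ 0 → 0 < g x v v) :
    DifferentiableAt ℝ (fun y => hodgeStarAt m (g y) (ν y) (a y)) x := by
  refine differentiableAt_form_of_apply fun v => ?_
  have h : ∀ y, hodgeStarAt m (g y) (ν y) (a y) v = (k.factorial : ℝ)⁻¹ *
      ∑ i : Fin k → Fin (Module.finrank ℝ E), a y (fun p => Module.finBasis ℝ E (i p)) *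
        ∑ r : Fin k → Fin (Module.finrank ℝ E),
          (∏ p, (Matrix.of fun p q => g y (Module.finBasis ℝ E p) (Module.finBasis ℝ E q))⁻¹
            (i p) (r p)) * ν y (Fin.append (Module.finBasis ℝ E ∘ r) v) := by
    intro y
    simp only [hodgeStarAt, ContinuousAlternatingMap.smul_apply, smul_eq_mul,
      ContinuousAlternatingMap.sum_apply, insertFirst_apply, metricDual, sum_append_multilinear]
  simp only [h]
  refine DifferentiableAt.const_mul (DifferentiableAt.fun_sum fun i _ =>
    (differentiableAt_form_apply ha _).mul (DifferentiableAt.fun_sum fun r _ =>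
    DifferentiableAt.mul (HasFDerivAt.finsetProd fun p _ => DifferentiableAt.hasFDerivAt
      ?_).differentiableAt (differentiableAt_form_apply hν _))) _
  exact differentiableAt_matrix_inv (fun i j => hg _ _) (gram_det_ne_zero _ hx) _ _

end Calculus

section Naturality

variable {V : Type*} [AddCommGroup V] [Module ℝ V] [TopologicalSpace V] [Module.Finite ℝ V]
  {V' : Type*} [AddCommGroup V'] [Module ℝ V'] [TopologicalSpace V'] [Module.Finite ℝ V']

/-- Naturality of the Hodge star under linear isomorphisms. -/
theorem hodgeStarAt_comp {n k m : ℕ} {g : V →L[ℝ] V →L[ℝ] ℝ} {e : Fin n → V →L[ℝ] ℝ}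
    {E : Module.Basis (Fin n) ℝ V} (hE : ∀ v i, E.repr v i = e i v)
    (hg : ∀ v w, g v w = ∑ i, e i v * e i w) {g' : V' →L[ℝ] V' →L[ℝ] ℝ}
    (A : V' →L[ℝ] V) (hA : Function.Bijective A) (hg' : ∀ v w, g' v w = g (A v) (A w))
    (ν : V [⋀^Fin (k + m)]→L[ℝ] ℝ) (a : V [⋀^Fin k]→L[ℝ] ℝ) :
    (hodgeStarAt m g ν a).compContinuousLinearMap A =
      hodgeStarAt m g' (ν.compContinuousLinearMap A) (a.compContinuousLinearMap A) := by
  let A' : V' ≃ₗ[ℝ] V := LinearEquiv.ofBijective (A : V' →ₗ[ℝ] V) hA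
  have hE' : ∀ v i, (E.map A'.symm).repr v i = (e i ∘L A) v := fun v i => by
    rw [ContinuousLinearMap.comp_apply, ← hE]
    rfl
  have hAE : ∀ i, A ((E.map A'.symm) i) = E i := fun i => by
    rw [Module.Basis.map_apply]
    exact A'.apply_symm_apply (E i)
  have hmetric : ∀ v w, g' v w = ∑ i, (e i ∘L A) v * (e i ∘L A) w := fun v w => by
    rw [hg', hg]
    rfl
  ext v
  rw [ContinuousAlternatingMap.compContinuousLinearMap_apply, hodgeStarAt_frame hE hg,
    hodgeStarAt_frame hE' hmetric]
  refine congrArg _ (Finset.sum_congr rfl fun q _ => ?_)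
  rw [ContinuousAlternatingMap.compContinuousLinearMap_apply,
    ContinuousAlternatingMap.compContinuousLinearMap_apply]
  have h₁ : A ∘ (E.map A'.symm) ∘ q = E ∘ q := funext fun i => hAE (q i)
  have h₂ : A ∘ Fin.append ((E.map A'.symm) ∘ q) v = Fin.append (E ∘ q) (A ∘ v) := by
    funext j
    refine Fin.addCases (fun j => ?_) (fun j => ?_) j
    · simp only [Function.comp_apply, Fin.append_left]
      exact hAE _
    · simp only [Function.comp_apply, Fin.append_right]
  rw [h₁, h₂]

end Naturality

section Metric

variable {E : Type*} [NormedAddCommGroup E] [NormedSpace ℝ E] [FiniteDimensional ℝ E]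
  {H : Type*} [TopologicalSpace H] {I : ModelWithCorners ℝ E H} [I.Boundaryless]
  {M : Type*} [TopologicalSpace M] [ChartedSpace H M] [IsManifold I ∞ M]

omit [FiniteDimensional ℝ E] [I.Boundaryless] in
theorem contMDiffOn_coordinate_field (x : M) (u : E) :
    ContMDiffOn 𝓘(ℝ, E) (I.prod 𝓘(ℝ, E)) 1
      (fun y => Bundle.TotalSpace.mk' E (E := TangentSpace I) ((extChartAt I x).symm y)
        (mfderivWithin 𝓘(ℝ, E) I (extChartAt I x).symm (Set.range I) y u))
      (extChartAt I x).target := by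
  let T := trivializationAt E (TangentSpace I) x
  have hmem : ∀ y ∈ (extChartAt I x).target,
      (extChartAt I x).symm y ∈ (chartAt H x).source := fun y hy => by
    rw [← extChartAt_source I]
    exact (extChartAt I x).map_target hy
  have h₁ : ContMDiffOn (I.prod 𝓘(ℝ, E)) (I.prod 𝓘(ℝ, E)) 1 T.toOpenPartialHomeomorph.symm T.target :=
    T.contMDiffOn_symm
  have h₂ : ContMDiffOn 𝓘(ℝ, E) (I.prod 𝓘(ℝ, E)) 1
      (fun y => ((extChartAt I x).symm y, u)) (extChartAt I x).target :=
    (contMDiffOn_extChartAt_symm x).prodMk contMDiffOn_const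
  refine (h₁.comp h₂ fun y hy => ?_).congr fun y hy => ?_
  · rw [Set.mem_preimage, T.target_eq]
    exact ⟨by simpa [T] using hmem y hy, trivial⟩
  · have hb : (extChartAt I x).symm y ∈ T.baseSet := by simpa [T] using hmem y hy
    rw [Function.comp_apply, ← T.mk_symm hb]
    have h₃ := TangentBundle.symmL_trivializationAt (I := I) (hmem y hy)
    rw [(extChartAt I x).right_inv hy] at h₃
    rw [← h₃, ← T.symmL_apply (R := ℝ) hb]
    rfl

omit [FiniteDimensional ℝ E] in
theorem differentiableAt_metric (g : Metric I M) (x : M) (u v : E) :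
    DifferentiableAt ℝ (fun y => g.inner ((extChartAt I x).symm y)
      (mfderivWithin 𝓘(ℝ, E) I (extChartAt I x).symm (Set.range I) y u)
      (mfderivWithin 𝓘(ℝ, E) I (extChartAt I x).symm (Set.range I) y v)) (extChartAt I x x) := by
  have ht := extChartAt_target_mem_nhds (I := I) x
  have h : ContMDiffAt 𝓘(ℝ, E) (I.prod 𝓘(ℝ)) 1
      (fun y => Bundle.TotalSpace.mk' ℝ (E := Bundle.Trivial M ℝ) ((extChartAt I x).symm y)
        (g.inner ((extChartAt I x).symm y)
      (mfderivWithin 𝓘(ℝ, E) I (extChartAt I x).symm (Set.range I) y u)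
      (mfderivWithin 𝓘(ℝ, E) I (extChartAt I x).symm (Set.range I) y v))) (extChartAt I x x) := by
    apply ContMDiffAt.clm_bundle_apply₂ (F₁ := E) (F₂ := E)
    · exact ((g.contMDiff.of_le (by norm_cast)).contMDiffAt).comp _
        ((contMDiffOn_extChartAt_symm x).contMDiffAt ht)
    · exact (contMDiffOn_coordinate_field x u).contMDiffAt ht
    · exact (contMDiffOn_coordinate_field x v).contMDiffAt ht
  rw [Bundle.contMDiffAt_totalSpace] at h
  exact h.2.contDiffAt.differentiableAt one_ne_zero

/-- The metric in the preferred chart at `x`. -/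
def metricInChart (g : Metric I M) (x : M) (y : E) : E →L[ℝ] E →L[ℝ] ℝ :=
  let B : E →L[ℝ] E →L[ℝ] ℝ := g.inner ((extChartAt I x).symm y)
  let A : E →L[ℝ] E := mfderivWithin 𝓘(ℝ, E) I (extChartAt I x).symm (Set.range I) y
  B.bilinearComp A A

omit [FiniteDimensional ℝ E] [I.Boundaryless] in
theorem metricInChart_apply (g : Metric I M) (x : M) (y u v : E) :
    metricInChart g x y u v = g.inner ((extChartAt I x).symm y)
      (mfderivWithin 𝓘(ℝ, E) I (extChartAt I x).symm (Set.range I) y u)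
      (mfderivWithin 𝓘(ℝ, E) I (extChartAt I x).symm (Set.range I) y v) := rfl

omit [FiniteDimensional ℝ E] [I.Boundaryless] in
theorem bijective_mfderivWithin_extChartAt_symm {x : M} {y : E}
    (hy : y ∈ (extChartAt I x).target) : Function.Bijective
      (mfderivWithin 𝓘(ℝ, E) I (extChartAt I x).symm (Set.range I) y) :=
  (isInvertible_mfderivWithin_extChartAt_symm hy).bijective

omit [I.Boundaryless] in
theorem inChart_hodgeStar {k m n : ℕ} (g : Metric I M) {ν : DForm I M (k + m)} {x : M} {y : E}
    (hy : y ∈ (extChartAt I x).target)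
    {e : Fin n → TangentSpace I ((extChartAt I x).symm y) →L[ℝ] ℝ}
    {B : Module.Basis (Fin n) ℝ (TangentSpace I ((extChartAt I x).symm y))}
    (hB : ∀ v i, B.repr v i = e i v)
    (hg : ∀ v w, g.inner ((extChartAt I x).symm y) v w = ∑ i, e i v * e i w) (η : DForm I M k) :
    inChart x (hodgeStar m (fun x => g.inner x) ν η) y =
      hodgeStarAt m (metricInChart g x y) (inChart x ν y) (inChart x η y) :=
  @hodgeStarAt_comp (TangentSpace I ((extChartAt I x).symm y)) _ _ _
    (inferInstanceAs (Module.Finite ℝ E)) E NormedAddCommGroup.toAddCommGroup NormedSpace.toModule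
    _ ‹FiniteDimensional ℝ E› n k m _ e B hB hg (metricInChart g x y)
    (mfderivWithin 𝓘(ℝ, E) I (extChartAt I x).symm (Set.range I) y)
    (bijective_mfderivWithin_extChartAt_symm hy) (metricInChart_apply g x y)
    (ν ((extChartAt I x).symm y)) (η ((extChartAt I x).symm y))

/-- The Hodge star of a differentiable form is differentiable. -/
theorem FormDifferentiableAt.hodgeStar {k m n : ℕ} (g : Metric I M) {ν : DForm I M (k + m)}
    (hframe : ∀ x, ∃ (e : Fin n → TangentSpace I x →L[ℝ] ℝ)
      (B : Module.Basis (Fin n) ℝ (TangentSpace I x)), (∀ v i, B.repr v i = e i v) ∧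
      ∀ v w, g.inner x v w = ∑ i, e i v * e i w)
    {η : DForm I M k} {x : M} (hν : FormDifferentiableAt ν x) (hη : FormDifferentiableAt η x) :
    FormDifferentiableAt (WarpedG2.hodgeStar m (fun x => g.inner x) ν η) x := by
  have hev : inChart x (WarpedG2.hodgeStar m (fun x => g.inner x) ν η) =ᶠ[𝓝 (extChartAt I x x)]
      fun y => hodgeStarAt m (metricInChart g x y) (inChart x ν y) (inChart x η y) := by
    filter_upwards [extChartAt_target_mem_nhds (I := I) x] with y hy
    obtain ⟨e, B, hB, hgB⟩ := hframe ((extChartAt I x).symm y)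
    exact inChart_hodgeStar g hy hB hgB η
  refine DifferentiableAt.congr_of_eventuallyEq ?_ hev
  refine differentiableAt_hodgeStarAt (fun u v => differentiableAt_metric g x u v) hν hη ?_
  intro v hv
  rw [metricInChart_apply]
  refine g.pos _ _ fun h => hv ?_
  exact (bijective_mfderivWithin_extChartAt_symm (mem_extChartAt_target x)).1
    (h.trans (map_zero _).symm)

end Metric

section Pointwise

variable {V : Type*} [AddCommGroup V] [Module ℝ V] [TopologicalSpace V]
  {V' : Type*} [AddCommGroup V'] [Module ℝ V'] [TopologicalSpace V'] [Module.Finite ℝ V']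

/-- A `G₂` form is nondegenerate. -/
theorem IsG2Coframe.eq_zero_of_interior_eq_zero {g : V' →L[ℝ] V' →L[ℝ] ℝ}
    {ν : V' [⋀^Fin 7]→L[ℝ] ℝ} {φ : V' [⋀^Fin 3]→L[ℝ] ℝ} {e : Fin 7 → V' →L[ℝ] ℝ}
    (h : IsG2Coframe g ν φ e) (hV : Module.finrank ℝ V' = 7) {v : V'}
    (hv : ∀ x y, φ ![v, x, y] = 0) : v = 0 := by
  obtain ⟨E, hE⟩ := exists_dual_basis e h.indep hV
  have hEe := dual_basis_apply hE
  have hφ : φ = g2Form e := h.form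
  have key : ∀ i j, g2Form e ![v, E i, E j] = 0 := fun i j => hφ ▸ hv (E i) (E j)
  have k0 := key 1 6
  have k1 := key 0 6
  have k2 := key 3 6
  have k3 := key 2 6
  have k4 := key 5 6
  have k5 := key 4 6
  have k6 := key 0 1
  rw [g2Form_apply] at k0 k1 k2 k3 k4 k5 k6
  simp [mono₃_apply, hEe] at k0 k1 k2 k3 k4 k5 k6
  apply E.repr.injective
  ext i
  rw [hE, map_zero, Finsupp.zero_apply]
  fin_cases i <;> assumption

/-- The kernels of the two projections of a warped `G₂` form meet in `0`. -/
theorem IsG2Coframe.projections_injective {g : V' →L[ℝ] V' →L[ℝ] ℝ}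
    {ν : V' [⋀^Fin 7]→L[ℝ] ℝ} {φ : V' [⋀^Fin 3]→L[ℝ] ℝ} {e : Fin 7 → V' →L[ℝ] ℝ}
    (h : IsG2Coframe g ν φ e) (hV : Module.finrank ℝ V' = 7) {P : V' →L[ℝ] V} {ξ : V' →L[ℝ] ℝ}
    {a : V [⋀^Fin 2]→L[ℝ] ℝ} {b : V [⋀^Fin 3]→L[ℝ] ℝ}
    (hφ : φ = wedgeAt (a.compContinuousLinearMap P) (covector ξ) + b.compContinuousLinearMap P)
    (v : V') (hP : P v = 0) (hξ : ξ v = 0) : v = 0 := by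
  refine h.eq_zero_of_interior_eq_zero hV fun x y => ?_
  have h₁ : ∀ w, a.compContinuousLinearMap P ![v, w] = 0 := fun w => by
    rw [ContinuousAlternatingMap.compContinuousLinearMap_apply]
    exact a.map_coord_zero 0 (by simp [hP])
  have h₂ : b.compContinuousLinearMap P ![v, x, y] = 0 := by
    rw [ContinuousAlternatingMap.compContinuousLinearMap_apply]
    exact b.map_coord_zero 0 (by simp [hP])
  rw [hφ, ContinuousAlternatingMap.add_apply, wedgeAt_two_one, h₁, h₁, h₂, covector_apply]
  simp [hξ]

omit [Module.Finite ℝ V'] in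
/-- The two components of a form on a product with a line are determined by it. -/
theorem components_eq_zero {P : V' →L[ℝ] V} {ξ : V' →L[ℝ] ℝ} {s : V → V'} (hs : ∀ v, P (s v) = v)
    (hξ : ∀ v, ξ (s v) = 0) {t : V'} (ht : ξ t ≠ 0)
    {a : V [⋀^Fin 3]→L[ℝ] ℝ} {b : V [⋀^Fin 4]→L[ℝ] ℝ}
    (h : (wedgeAt (a.compContinuousLinearMap P) (covector ξ) : V' [⋀^Fin 4]→L[ℝ] ℝ) +
      b.compContinuousLinearMap P = 0) : a = 0 ∧ b = 0 := by
  have hb : b = 0 := by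
    ext v
    rw [tuple_eq_four v]
    have h₁ := congrArg (fun c => c ![s (v 0), s (v 1), s (v 2), s (v 3)]) h
    have h₂ : P ∘ ![s (v 0), s (v 1), s (v 2), s (v 3)] = ![v 0, v 1, v 2, v 3] := by
      funext i
      fin_cases i <;> exact hs _
    simp only [ContinuousAlternatingMap.add_apply, wedgeAt_three_one, covector_apply,
      ContinuousAlternatingMap.compContinuousLinearMap_apply, h₂] at h₁
    simpa [hξ] using h₁
  refine ⟨?_, hb⟩
  subst hb
  ext v
  rw [tuple_eq_three v]
  have h₁ := congrArg (fun c => c ![s (v 0), s (v 1), s (v 2), t]) h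
  have h₂ : P ∘ ![s (v 0), s (v 1), s (v 2)] = ![v 0, v 1, v 2] := by
    funext i
    fin_cases i <;> exact hs _
  simp only [ContinuousAlternatingMap.add_apply, wedgeAt_three_one, covector_apply,
    ContinuousAlternatingMap.compContinuousLinearMap_apply, h₂] at h₁
  simp [hξ] at h₁
  exact h₁.resolve_right ht

end Pointwise

section Tangent

instance {E : Type*} [NormedAddCommGroup E] [NormedSpace ℝ E] [FiniteDimensional ℝ E]
    {H : Type*} [TopologicalSpace H] {I : ModelWithCorners ℝ E H} {M : Type*} [TopologicalSpace M]
    [ChartedSpace H M] (x : M) : Module.Finite ℝ (TangentSpace I x) :=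
  inferInstanceAs (Module.Finite ℝ E)

variable {M : Type*} [TopologicalSpace M] [ChartedSpace (EuclideanSpace ℝ (Fin 6)) M]

theorem finrank_tangent_product (p : M × Circle) :
    Module.finrank ℝ (TangentSpace ((𝓡 6).prod (𝓡 1)) p) = 7 := by
  change Module.finrank ℝ (EuclideanSpace ℝ (Fin 6) × EuclideanSpace ℝ (Fin 1)) = 7
  simp

/-- The projection of the tangent space of `M × S¹` to that of `M`. -/
def horizontal (p : M × Circle) : TangentSpace ((𝓡 6).prod (𝓡 1)) p →L[ℝ] TangentSpace (𝓡 6) p.1 :=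
  mfderiv ((𝓡 6).prod (𝓡 1)) (𝓡 6) Prod.fst p

/-- The covector `ds` on the tangent space of `M × S¹`. -/
def angular (p : M × Circle) : TangentSpace ((𝓡 6).prod (𝓡 1)) p →L[ℝ] ℝ :=
  ((Complex.imCLM ∘L ContinuousLinearMap.mul ℝ ℂ (starRingEnd ℂ (p.2 : ℂ))) ∘L
    (mfderiv (𝓡 1) 𝓘(ℝ, ℂ) (fun w : Circle => (w : ℂ)) p.2)) ∘L
    mfderiv ((𝓡 6).prod (𝓡 1)) (𝓡 1) Prod.snd p

theorem exists_horizontal_section (p : M × Circle) :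
    ∃ s : TangentSpace (𝓡 6) p.1 → TangentSpace ((𝓡 6).prod (𝓡 1)) p,
      (∀ v, horizontal p (s v) = v) ∧ ∀ v, angular p (s v) = 0 := by
  refine ⟨fun v => (ContinuousLinearMap.inl ℝ (EuclideanSpace ℝ (Fin 6))
    (EuclideanSpace ℝ (Fin 1)) v), fun v => ?_, fun v => ?_⟩
  · rw [horizontal, mfderiv_fst]
    rfl
  · rw [angular, mfderiv_snd]
    exact ((Complex.imCLM ∘L ContinuousLinearMap.mul ℝ ℂ (starRingEnd ℂ (p.2 : ℂ))) ∘L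
      (mfderiv (𝓡 1) 𝓘(ℝ, ℂ) (fun w : Circle => (w : ℂ)) p.2)).map_zero

theorem exists_vertical (p : M × Circle) :
    ∃ t : TangentSpace ((𝓡 6).prod (𝓡 1)) p, t ≠ 0 ∧ horizontal p t = 0 := by
  refine ⟨(ContinuousLinearMap.inr ℝ (EuclideanSpace ℝ (Fin 6))
    (EuclideanSpace ℝ (Fin 1)) (EuclideanSpace.single 0 1)), fun h => ?_, ?_⟩
  · have : (EuclideanSpace.single 0 1 : EuclideanSpace ℝ (Fin 1)) = 0 := congrArg Prod.snd h
    simp at this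
  · rw [horizontal, mfderiv_fst]
    rfl

end Tangent

section SU3

variable {M : Type*} [TopologicalSpace M] [ChartedSpace (EuclideanSpace ℝ (Fin 6)) M]
    [IsManifold (𝓡 6) ∞ M] (S : SU3Structure M)

set_option maxRecDepth 20000 in
/-- Adapted frames of an `SU(3)`-structure. -/
theorem SU3Structure.exists_frame (x : M) :
    ∃ (e : Fin 6 → TangentSpace (𝓡 6) x →L[ℝ] ℝ)
      (B : Module.Basis (Fin 6) ℝ (TangentSpace (𝓡 6) x)),
      IsSU3Coframe (S.g.inner x) (S.omega x) (S.ψp x) (S.ψm x) e ∧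
      (∀ v i, B.repr v i = e i v) ∧ S.vol x B = 1 := by
  obtain ⟨e, he⟩ := S.exists_coframe x
  obtain ⟨B, hB⟩ := exists_dual_basis e he.indep (finrank_euclideanSpace_fin (𝕜 := ℝ) (n := 6))
  exact ⟨e, B, he, hB, he.volume (dual_basis_apply hB)⟩

theorem SU3Structure.formDifferentiableAt_vol (x : M) : FormDifferentiableAt S.vol x :=
  have h := S.smooth_omega.formDifferentiableAt x
  ((h.wedge h).wedge h).smul _

theorem FormDifferentiableAt.star₄ {η : DForm (𝓡 6) M 4} {x : M} (h : FormDifferentiableAt η x) :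
    FormDifferentiableAt (S.star₄ η) x := by
  refine FormDifferentiableAt.hodgeStar S.g (n := 6) (fun x => ?_) (S.formDifferentiableAt_vol x) h
  obtain ⟨e, B, he, hB, -⟩ := S.exists_frame x
  exact ⟨e, B, hB, he.metric⟩

theorem FormDifferentiableAt.star₅ {η : DForm (𝓡 6) M 5} {x : M} (h : FormDifferentiableAt η x) :
    FormDifferentiableAt (S.star₅ η) x := by
  refine FormDifferentiableAt.hodgeStar S.g (n := 6) (fun x => ?_) (S.formDifferentiableAt_vol x) h
  obtain ⟨e, B, he, hB, -⟩ := S.exists_frame x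
  exact ⟨e, B, hB, he.metric⟩

/-- The `SU(3)`-structure with `ψ₊ + i ψ₋` multiplied by the phase `α + i β`. -/
def SU3Structure.rotate {α β : ℝ} (hαβ : α ^ 2 + β ^ 2 = 1) : SU3Structure M where
  g := S.g
  J := S.J
  omega := S.omega
  ψp := α • S.ψp - β • S.ψm
  ψm := α • S.ψm + β • S.ψp
  smooth_omega := S.smooth_omega
  smooth_ψp x := ((S.smooth_ψp x).const_smul α).sub ((S.smooth_ψm x).const_smul β)
  smooth_ψm x := ((S.smooth_ψm x).const_smul α).add ((S.smooth_ψp x).const_smul β)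
  kaehler := S.kaehler
  exists_coframe x := by
    obtain ⟨e, he⟩ := S.exists_coframe x
    exact ⟨_, he.rotate hαβ⟩

end SU3

section Pointwise

variable {V : Type*} [AddCommGroup V] [Module ℝ V] [TopologicalSpace V]

theorem wedgeAt_neg_left {k l : ℕ} (a : V [⋀^Fin k]→L[ℝ] ℝ) (c : V [⋀^Fin l]→L[ℝ] ℝ) :
    wedgeAt (-a) c = -wedgeAt a c := by
  ext v
  simp [wedgeAt_apply]

theorem wedgeAt_neg_smul_add {k l : ℕ} (r : ℝ) (a : V [⋀^Fin k]→L[ℝ] ℝ) (c : V [⋀^Fin l]→L[ℝ] ℝ)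
    (d : V [⋀^Fin (k + l)]→L[ℝ] ℝ) :
    wedgeAt (-(r • a)) c + r • -d = -(r • (wedgeAt a c + d)) := by
  rw [wedgeAt_neg_left, wedgeAt_smul_left, smul_add, smul_neg, neg_add]

theorem half_smul_two_smul {k : ℕ} (a : V [⋀^Fin k]→L[ℝ] ℝ) : (1 / 2 : ℝ) • (2 : ℝ) • a = a := by
  rw [smul_smul]
  norm_num

end Pointwise

section Warped

variable {M : Type*} [TopologicalSpace M] [ChartedSpace (EuclideanSpace ℝ (Fin 6)) M]
  [IsManifold (𝓡 6) ∞ M] {S : SU3Structure M} {f : M → ℝ}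
  {G : G2Structure ((𝓡 6).prod (𝓡 1)) (M × Circle)}

/-- The components of a closed warped `G₂` form are closed. -/
theorem closed_components (hf : ContMDiff (𝓡 6) 𝓘(ℝ) ∞ f)
    (hG : G.φ = lift (f •ᶠ S.omega) ⋏ ds M + lift S.ψp) (hclosed : extD G.φ = 0) (x : M) :
    extD (f •ᶠ S.omega) x = 0 ∧ extD S.ψp x = 0 := by
  let p : M × Circle := (x, 1)
  have hω := (S.smooth_omega.formDifferentiableAt x).fsmul (hf.mdifferentiableAt (by simp))
  have hψ := S.smooth_ψp.formDifferentiableAt x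
  have h₁ : extD G.φ p = wedgeAt (lift (extD (f •ᶠ S.omega)) p) (ds M p) + lift (extD S.ψp) p := by
    rw [hG]
    refine (extD_add ((hω.lift (p := p)).wedge (formDifferentiableAt_ds p))
      (hψ.lift (p := p))).trans ?_
    rw [extD_lift_wedge_ds_two (p := p) hω, extD_lift (p := p) hψ]
  obtain ⟨e, he⟩ := G.exists_coframe p
  obtain ⟨s, hs, hξ⟩ := exists_horizontal_section p
  obtain ⟨t, ht, htP⟩ := exists_vertical p
  have hinj := he.projections_injective (finrank_tangent_product p) (P := horizontal p)
    (ξ := angular p) (a := (f •ᶠ S.omega) x) (b := S.ψp x) (congrFun hG p)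
  have h₂ : angular p t ≠ 0 := fun h => ht (hinj t htP h)
  rw [hclosed] at h₁
  exact components_eq_zero hs hξ h₂ h₁.symm

/-- The consequences of closedness for `dω`. -/
theorem torsion_omega (hf : ContMDiff (𝓡 6) 𝓘(ℝ) ∞ f) (hf0 : ∀ x, f x ≠ 0)
    {a b : M → ℝ} {ν₁ : DForm (𝓡 6) M 1} {ν₃ : DForm (𝓡 6) M 3} (hν₃ : S.MemΩ312 ν₃)
    (hω : extD S.omega = a •ᶠ S.ψp + b •ᶠ S.ψm + ν₁ ⋏ S.omega + ν₃) {x : M}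
    (hd : extD (f •ᶠ S.omega) x = 0) :
    a x = 0 ∧ b x = 0 ∧ differential (𝓡 6) f x = -(f x • ν₁ x) ∧
      extD S.omega x = wedgeAt (ν₁ x) (S.omega x) := by
  obtain ⟨e, B, he, hB, -⟩ := S.exists_frame x
  obtain ⟨-, h₁, h₂, h₃⟩ := hν₃
  have hωx : extD S.omega x =
    a x • S.ψp x + b x • S.ψm x + wedgeAt (ν₁ x) (S.omega x) + ν₃ x := congrFun hω x
  have hd' := extD_fsmul_two (hf.mdifferentiableAt (by simp)) (S.smooth_omega.formDifferentiableAt x)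
  rw [hd, hωx] at hd'
  have heq : (f x * a x) • S.ψp x + (f x * b x) • S.ψm x +
      wedgeAt (differential (𝓡 6) f x + f x • ν₁ x) (S.omega x) + f x • ν₃ x = 0 := by
    rw [wedgeAt_add_left, wedgeAt_smul_left]
    refine Eq.trans ?_ hd'.symm
    simp only [smul_add, mul_smul]
    abel
  have hw : ∀ {l : ℕ} {c : TangentSpace (𝓡 6) x [⋀^Fin l]→L[ℝ] ℝ}, wedgeAt (ν₃ x) c = 0 →
      wedgeAt (f x • ν₃ x) c = 0 := fun h => by
    rw [wedgeAt_smul_left, h, smul_zero]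
  obtain ⟨ha, hb, hν⟩ := he.three_form_components_eq_zero hB (hw (congrFun h₁ x))
    (hw (congrFun h₂ x)) (hw (congrFun h₃ x)) heq
  have hν₃x : ν₃ x = 0 := by
    have h₄ : (wedgeAt (0 : TangentSpace (𝓡 6) x [⋀^Fin 1]→L[ℝ] ℝ) (S.omega x) :
        TangentSpace (𝓡 6) x [⋀^Fin 3]→L[ℝ] ℝ) = 0 := wedgeAt_zero_left _
    rw [ha, hb, hν, zero_smul, zero_smul, h₄, zero_add, zero_add, zero_add] at heq
    exact (smul_eq_zero.1 heq).resolve_left (hf0 x)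
  have ha' : a x = 0 := (mul_eq_zero.1 ha).resolve_left (hf0 x)
  have hb' : b x = 0 := (mul_eq_zero.1 hb).resolve_left (hf0 x)
  refine ⟨ha', hb', eq_neg_of_add_eq_zero_left hν, ?_⟩
  rw [hωx, ha', hb', hν₃x]
  simp

/-- The Hodge star of the warped `G₂` form. -/
theorem star_warped (hf0 : ∀ x, f x ≠ 0)
    (hG : G.φ = lift (f •ᶠ S.omega) ⋏ ds M + lift S.ψp) :
    G.star₃ G.φ = lift ((1 / 2 : ℝ) • (S.omega ⋏ S.omega)) + lift (f •ᶠ S.ψm) ⋏ ds M := by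
  funext p
  obtain ⟨e, B, he, hB, hν⟩ := S.exists_frame p.1
  obtain ⟨e', he'⟩ := G.exists_coframe p
  have hφ : G.φ p = wedgeAt ((f p.1 • S.omega p.1).compContinuousLinearMap (horizontal p))
    (covector (angular p)) + (S.ψp p.1).compContinuousLinearMap (horizontal p) := congrFun hG p
  have hinj := he'.projections_injective (finrank_tangent_product p) hφ
  have h := he.star_warped hB hν he' (finrank_tangent_product p) (hf0 p.1) hφ hinj
  have h' : G.star₃ G.φ p = hodgeStarAt (k := 3) 4 (G.g.inner p) (G.vol p) (G.φ p) := rfl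
  refine h'.trans (h.trans ?_)
  have h₁ : ((1 / 2 : ℝ) • wedgeAt (S.omega p.1) (S.omega p.1)).compContinuousLinearMap (horizontal p) = lift ((1 / 2 : ℝ) • (S.omega ⋏ S.omega)) p := rfl
  have h₂ : wedgeAt ((f p.1 • S.ψm p.1).compContinuousLinearMap (horizontal p))
    (covector (angular p)) = (lift (f •ᶠ S.ψm) ⋏ ds M) p := rfl
  exact congrArg₂ (fun a b : TangentSpace ((𝓡 6).prod (𝓡 1)) p [⋀^Fin 4]→L[ℝ] ℝ => a + b) h₁ h₂

set_option maxRecDepth 20000 in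
/-- The Hodge star of the warped `G₂`-structure on `5`-forms. -/
theorem star_five_warped (hf0 : ∀ x, f x ≠ 0)
    (hG : G.φ = lift (f •ᶠ S.omega) ⋏ ds M + lift S.ψp) (a : DForm (𝓡 6) M 5)
    (b : DForm (𝓡 6) M 4) :
    G.star₅ (lift a + lift b ⋏ ds M) =
      lift (f •ᶠ S.star₅ a) ⋏ ds M + lift ((fun x => (f x)⁻¹) •ᶠ S.star₄ b) := by
  funext p
  obtain ⟨e, B, he, hB, hν⟩ := S.exists_frame p.1
  obtain ⟨e', he'⟩ := G.exists_coframe p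
  have hφ : G.φ p = wedgeAt ((f p.1 • S.omega p.1).compContinuousLinearMap (horizontal p))
    (covector (angular p)) + (S.ψp p.1).compContinuousLinearMap (horizontal p) := congrFun hG p
  have hinj := he'.projections_injective (finrank_tangent_product p) hφ
  have h := he.star_five_warped hB hν he' (finrank_tangent_product p) (hf0 p.1) hφ hinj
    (a p.1) (b p.1)
  have h₁ : (lift a + lift b ⋏ ds M) p = (a p.1).compContinuousLinearMap (horizontal p) +
      wedgeAt ((b p.1).compContinuousLinearMap (horizontal p)) (covector (angular p)) := rfl
  have h₂ : G.star₅ (lift a + lift b ⋏ ds M) p =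
    hodgeStarAt (k := 5) 2 (G.g.inner p) (G.vol p) ((lift a + lift b ⋏ ds M) p) := rfl
  rw [h₂, h₁]
  refine h.trans ?_
  have h₃ : S.star₅ a p.1 = hodgeStarAt (k := 5) 1 (S.g.inner p.1) (S.vol p.1) (a p.1) := rfl
  have h₄ : S.star₄ b p.1 = hodgeStarAt (k := 4) 2 (S.g.inner p.1) (S.vol p.1) (b p.1) := rfl
  rw [← h₃, ← h₄]
  have h₅ : wedgeAt ((f p.1 • S.star₅ a p.1).compContinuousLinearMap (horizontal p))
      (covector (angular p)) = (lift (f •ᶠ S.star₅ a) ⋏ ds M) p := rfl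
  have h₆ : ((f p.1)⁻¹ • S.star₄ b p.1).compContinuousLinearMap (horizontal p) =
      lift ((fun x => (f x)⁻¹) •ᶠ S.star₄ b) p := rfl
  exact congrArg₂ (fun a b : TangentSpace ((𝓡 6).prod (𝓡 1)) p [⋀^Fin 2]→L[ℝ] ℝ => a + b) h₅ h₆

/-- The consequences of closedness for `dψ₊`. -/
theorem torsion_psi {b : M → ℝ} {π₁ : DForm (𝓡 6) M 1} {σ : DForm (𝓡 6) M 2}
    (hσ : S.star₄ (σ ⋏ S.omega) = -σ)
    (hψ : extD S.ψp = b •ᶠ (S.omega ⋏ S.omega) + π₁ ⋏ S.ψp - σ ⋏ S.omega) {x : M}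
    (hd : extD S.ψp x = 0) : π₁ x = 0 ∧ σ x = 0 := by
  obtain ⟨e, B, he, hB, hν⟩ := S.exists_frame x
  exact he.four_form_components_eq_zero hB hν (congrFun hσ x) ((congrFun hψ x).symm.trans hd)

theorem star_wedge_omega {σ : DForm (𝓡 6) M 2} (hσ : S.MemΩ28 σ) :
    S.star₄ (σ ⋏ S.omega) = -σ := by
  funext x
  obtain ⟨e, B, he, hB, hν⟩ := S.exists_frame x
  exact he.star_wedge_omega hB hν (S.kaehler x) (congrFun hσ.2.1 x) (congrFun hσ.2.2 x)

set_option maxRecDepth 20000 in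
/-- `d⋆φ` for a closed warped `G₂` form. -/
theorem extD_star_warped (hf : ContMDiff (𝓡 6) 𝓘(ℝ) ∞ f) {ν₁ : DForm (𝓡 6) M 1}
    {σ : DForm (𝓡 6) M 2} (hdf : differential (𝓡 6) f = -(f •ᶠ ν₁))
    (hω : extD S.omega = ν₁ ⋏ S.omega) (hψ : extD S.ψm = -(σ ⋏ S.omega)) :
    extD (lift ((1 / 2 : ℝ) • (S.omega ⋏ S.omega)) + lift (f •ᶠ S.ψm) ⋏ ds M) =
      lift (ν₁ ⋏ (S.omega ⋏ S.omega)) + lift (-(f •ᶠ (ν₁ ⋏ S.ψm + σ ⋏ S.omega))) ⋏ ds M := by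
  funext p
  have hω' := S.smooth_omega.formDifferentiableAt p.1
  have hψ' := S.smooth_ψm.formDifferentiableAt p.1
  have hωω := (hω'.wedge hω').smul (1 / 2 : ℝ)
  have hfψ := hψ'.fsmul (hf.mdifferentiableAt (by simp))
  have h₁ : extD ((1 / 2 : ℝ) • (S.omega ⋏ S.omega)) p.1 = (ν₁ ⋏ (S.omega ⋏ S.omega)) p.1 := by
    have h := extD_wedge_self hω'
    rw [hω] at h
    have h' := wedgeAt_assoc_one_two_two (E := EuclideanSpace ℝ (Fin 6)) (ν₁ p.1) (S.omega p.1) (S.omega p.1)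
    rw [extD_smul, h]
    exact (half_smul_two_smul _).trans h'
  have h₂ : extD (f •ᶠ S.ψm) p.1 = (-(f •ᶠ (ν₁ ⋏ S.ψm + σ ⋏ S.omega))) p.1 := by
    rw [extD_fsmul_three (hf.mdifferentiableAt (by simp)) hψ', hdf, hψ]
    exact wedgeAt_neg_smul_add (f p.1) (ν₁ p.1) (S.ψm p.1)
      (wedgeAt (σ p.1) (S.omega p.1) : TangentSpace (𝓡 6) p.1 [⋀^Fin 4]→L[ℝ] ℝ)
  have h₃ := extD_lift (p := p) hωω
  have h₄ := extD_lift_wedge_ds_three (p := p) hfψ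
  have h₅ : lift (extD ((1 / 2 : ℝ) • (S.omega ⋏ S.omega))) p =
      lift (ν₁ ⋏ (S.omega ⋏ S.omega)) p :=
    congrArg (fun a => ContinuousAlternatingMap.compContinuousLinearMap a (horizontal p)) h₁
  have h₆ : lift (extD (f •ᶠ S.ψm)) p = lift (-(f •ᶠ (ν₁ ⋏ S.ψm + σ ⋏ S.omega))) p :=
    congrArg (fun a => ContinuousAlternatingMap.compContinuousLinearMap a (horizontal p)) h₂
  have h₇ := h₄.trans (congrArg (fun a => wedgeAt a (ds M p)) h₆)
  exact (extD_add (hωω.lift (p := p)) ((hfψ.lift (p := p)).wedge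
    (formDifferentiableAt_ds p))).trans (congrArg₂
      (fun a b : TangentSpace ((𝓡 6).prod (𝓡 1)) p [⋀^Fin 5]→L[ℝ] ℝ => a + b) (h₃.trans h₅) h₇)

end Warped

section Pointwise

variable {V : Type*} [AddCommGroup V] [Module ℝ V] [TopologicalSpace V]

theorem inv_smul_hodgeStarAt [Module.Finite ℝ V] {k m : ℕ} (g : V →L[ℝ] V →L[ℝ] ℝ)
    (ν : V [⋀^Fin (k + m)]→L[ℝ] ℝ) {a b : V [⋀^Fin k]→L[ℝ] ℝ} {c : V [⋀^Fin m]→L[ℝ] ℝ}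
    (hb : hodgeStarAt m g ν b = -c) {r : ℝ} (hr : r ≠ 0) :
    r⁻¹ • hodgeStarAt m g ν (-(r • (a + b))) = c - hodgeStarAt m g ν a := by
  have h : -(r • (a + b)) = (-r) • (a + b) := by
    ext v
    simp
    ring
  rw [h, hodgeStarAt_smul, hodgeStarAt_add, hb, smul_smul, mul_neg, inv_mul_cancel₀ hr]
  ext v
  simp
  ring

end Pointwise

section Warped

variable {M : Type*} [TopologicalSpace M] [ChartedSpace (EuclideanSpace ℝ (Fin 6)) M]
  [IsManifold (𝓡 6) ∞ M] {S : SU3Structure M} {f : M → ℝ}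
  {G : G2Structure ((𝓡 6).prod (𝓡 1)) (M × Circle)}

set_option maxRecDepth 20000 in
theorem inv_fsmul_star₄ (hf0 : ∀ x, f x ≠ 0) {σ : DForm (𝓡 6) M 2}
    (hσ : S.star₄ (σ ⋏ S.omega) = -σ) (a : DForm (𝓡 6) M 4) :
    (fun x => (f x)⁻¹) •ᶠ S.star₄ (-(f •ᶠ (a + σ ⋏ S.omega))) = σ - S.star₄ a := by
  funext x
  let b : TangentSpace (𝓡 6) x [⋀^Fin 4]→L[ℝ] ℝ := wedgeAt (σ x) (S.omega x)
  have h : hodgeStarAt (k := 4) 2 (S.g.inner x) (S.vol x) b = -σ x := congrFun hσ x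
  have h₁ := inv_smul_hodgeStarAt (k := 4) (m := 2) (a := a x) (S.g.inner x) (S.vol x) h (hf0 x)
  have h₂ : -(f x • (a x + b)) = (-(f •ᶠ (a + σ ⋏ S.omega))) x := rfl
  have h₃ : ∀ η : DForm (𝓡 6) M 4,
    hodgeStarAt (k := 4) 2 (S.g.inner x) (S.vol x) (η x) = S.star₄ η x := fun _ => rfl
  rw [h₂, h₃, h₃] at h₁
  exact h₁

/-- The negative of the exterior derivative of a `2`-form on `M × S¹`. -/
theorem neg_extD_warped (hf : ContMDiff (𝓡 6) 𝓘(ℝ) ∞ f) {ν₁ a : DForm (𝓡 6) M 1}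
    {b c : DForm (𝓡 6) M 2} (hdf : differential (𝓡 6) f = -(f •ᶠ ν₁))
    (ha : ∀ x, FormDifferentiableAt a x) (hb : ∀ x, FormDifferentiableAt b x)
    (hc : ∀ x, FormDifferentiableAt c x) :
    -extD (lift (f •ᶠ a) ⋏ ds M + lift (b - c)) =
      lift (-extD b + extD c) + lift (f •ᶠ (ν₁ ⋏ a - extD a)) ⋏ ds M := by
  funext p
  have hfa := (ha p.1).fsmul (hf.mdifferentiableAt (x := p.1) (by simp))
  have hbc := (hb p.1).sub (hc p.1)
  have h₁ : extD (f •ᶠ a) p.1 = -(f •ᶠ (ν₁ ⋏ a - extD a)) p.1 := by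
    rw [extD_fsmul_one (hf.mdifferentiableAt (by simp)) (ha p.1), hdf]
    refine Eq.trans ?_ ((wedgeAt_neg_smul_add (f p.1) (ν₁ p.1) (a p.1)
      (-(extD a p.1) : TangentSpace (𝓡 6) p.1 [⋀^Fin 2]→L[ℝ] ℝ)).trans ?_)
    · rw [neg_neg]
      rfl
    · rw [← sub_eq_add_neg]
      rfl
  have h₂ : lift (extD (f •ᶠ a)) p = -lift (f •ᶠ (ν₁ ⋏ a - extD a)) p :=
    congrArg (fun a => ContinuousAlternatingMap.compContinuousLinearMap a (horizontal p)) h₁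
  have h₃ := (extD_lift_wedge_ds_one (p := p) hfa).trans
    ((congrArg (fun a => wedgeAt a (ds M p)) h₂).trans (wedgeAt_neg_left _ _))
  have h₄ : extD (b - c) p.1 = -(-extD b + extD c) p.1 := by
    rw [extD_sub (hb p.1) (hc p.1)]
    change _ = -(-extD b p.1 + extD c p.1)
    abel
  have h₅ : lift (extD (b - c)) p = -lift (-extD b + extD c) p :=
    congrArg (fun a => ContinuousAlternatingMap.compContinuousLinearMap a (horizontal p)) h₄
  have h₆ := (extD_lift (p := p) hbc).trans h₅
  have h₇ := (extD_add ((hfa.lift (p := p)).wedge (formDifferentiableAt_ds p))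
    (hbc.lift (p := p))).trans (congrArg₂
      (fun a b : TangentSpace ((𝓡 6).prod (𝓡 1)) p [⋀^Fin 3]→L[ℝ] ℝ => a + b) h₃ h₆)
  refine (congrArg (fun a : TangentSpace ((𝓡 6).prod (𝓡 1)) p [⋀^Fin 3]→L[ℝ] ℝ => -a) h₇).trans ?_
  change -(-_ + -_) = _
  rw [neg_add, neg_neg, neg_neg, add_comm]
  rfl

theorem G2Structure.star₄_zero (G : G2Structure ((𝓡 6).prod (𝓡 1)) (M × Circle)) :
    G.star₄ 0 = 0 :=
  funext fun _ => hodgeStarAt_zero _ _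

theorem SU3Structure.star₄_zero (S : SU3Structure M) : S.star₄ 0 = 0 :=
  funext fun _ => hodgeStarAt_zero _ _

theorem SU3Structure.star₅_zero (S : SU3Structure M) : S.star₅ 0 = 0 :=
  funext fun _ => hodgeStarAt_zero _ _

theorem laplacian_of_closed (hclosed : extD G.φ = 0) :
    G.laplacian G.φ = -extD (G.star₅ (extD (G.star₃ G.φ))) := by
  have h : extD (0 : DForm ((𝓡 6).prod (𝓡 1)) (M × Circle) 3) = 0 := funext fun p => extD_zero p
  have h₁ : G.star₄ (extD (G.star₄ (extD G.φ))) = 0 := by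
    rw [hclosed, G.star₄_zero, h, G.star₄_zero]
  exact (congrArg (fun a => a - extD (G.star₅ (extD (G.star₃ G.φ)))) h₁).trans (zero_sub _)

/-- The Hodge Laplacian of a closed warped `G₂` form. -/
theorem laplacian_warped (hf : ContMDiff (𝓡 6) 𝓘(ℝ) ∞ f) (hf0 : ∀ x, f x ≠ 0)
    (hG : G.φ = lift (f •ᶠ S.omega) ⋏ ds M + lift S.ψp) (hclosed : extD G.φ = 0)
    {a b c d : M → ℝ} {π₁ ν₁ : DForm (𝓡 6) M 1} {τ σ : DForm (𝓡 6) M 2}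
    {ν₃ : DForm (𝓡 6) M 3} (hν₁ : IsSmooth ν₁) (hν₃ : S.MemΩ312 ν₃)
    (hσ' : ∀ x, FormDifferentiableAt σ x)
    (hτ : S.star₄ (τ ⋏ S.omega) = -τ) (hσ : S.star₄ (σ ⋏ S.omega) = -σ)
    (hω : extD S.omega = a •ᶠ S.ψp + b •ᶠ S.ψm + ν₁ ⋏ S.omega + ν₃)
    (hψp : extD S.ψp = c •ᶠ (S.omega ⋏ S.omega) + π₁ ⋏ S.ψp - τ ⋏ S.omega)
    (hψm : extD S.ψm = d •ᶠ (S.omega ⋏ S.omega) + π₁ ⋏ S.ψm - σ ⋏ S.omega)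
    (had : ∀ x, a x = 0 → d x = 0) :
    τ = 0 ∧ differential (𝓡 6) f = -(f •ᶠ ν₁) ∧
    G.laplacian G.φ = lift (-extD σ + extD (S.star₄ (ν₁ ⋏ S.ψm))) +
      lift (f •ᶠ (ν₁ ⋏ S.star₅ (ν₁ ⋏ (S.omega ⋏ S.omega)) -
        extD (S.star₅ (ν₁ ⋏ (S.omega ⋏ S.omega))))) ⋏ ds M := by
  have hcl := closed_components hf hG hclosed
  have hto := fun x => torsion_omega hf hf0 hν₃ hω (hcl x).1
  have htp := fun x => torsion_psi hτ hψp (hcl x).2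
  have hdf : differential (𝓡 6) f = -(f •ᶠ ν₁) := funext fun x => (hto x).2.2.1
  have hdω : extD S.omega = ν₁ ⋏ S.omega := funext fun x => (hto x).2.2.2
  have hdψ : extD S.ψm = -(σ ⋏ S.omega) := by
    funext x
    have h : extD S.ψm x = d x • wedgeAt (S.omega x) (S.omega x) + wedgeAt (π₁ x) (S.ψm x) -
      wedgeAt (σ x) (S.omega x) := congrFun hψm x
    have h₁ : (wedgeAt (0 : TangentSpace (𝓡 6) x [⋀^Fin 1]→L[ℝ] ℝ) (S.ψm x) :
        TangentSpace (𝓡 6) x [⋀^Fin 4]→L[ℝ] ℝ) = 0 := wedgeAt_zero_left _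
    rw [had x (hto x).1, (htp x).1, zero_smul, h₁, zero_add, zero_sub] at h
    exact h
  refine ⟨funext fun x => (htp x).2, hdf, ?_⟩
  have hω' := fun x => S.smooth_omega.formDifferentiableAt x
  have hν' := fun x => hν₁.formDifferentiableAt x
  have hψ' := fun x => S.smooth_ψm.formDifferentiableAt x
  rw [laplacian_of_closed hclosed, star_warped hf0 hG, extD_star_warped hf hdf hdω hdψ,
    star_five_warped hf0 hG, inv_fsmul_star₄ hf0 hσ]
  exact neg_extD_warped hf hdf
    (fun x => FormDifferentiableAt.star₅ S ((hν' x).wedge ((hω' x).wedge (hω' x)))) hσ'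
    (fun x => FormDifferentiableAt.star₄ S ((hν' x).wedge (hψ' x)))

end Warped

section Pointwise

variable {V : Type*} [AddCommGroup V] [Module ℝ V] [TopologicalSpace V]

theorem wedgeAt_combination_left {k l : ℕ} (α β : ℝ) (a b : V [⋀^Fin k]→L[ℝ] ℝ)
    (c : V [⋀^Fin l]→L[ℝ] ℝ) :
    wedgeAt (α • a + β • b) c = α • wedgeAt a c + β • wedgeAt b c := by
  rw [wedgeAt_add_left, wedgeAt_smul_left, wedgeAt_smul_left]

theorem wedgeAt_combination_right {k l : ℕ} (α β : ℝ) (a : V [⋀^Fin k]→L[ℝ] ℝ)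
    (b c : V [⋀^Fin l]→L[ℝ] ℝ) :
    wedgeAt a (α • b + β • c) = α • wedgeAt a b + β • wedgeAt a c := by
  rw [wedgeAt_add_right, wedgeAt_smul_right, wedgeAt_smul_right]

theorem rotation_identity {k : ℕ} {α β : ℝ} (hαβ : α ^ 2 + β ^ 2 = 1) (s t : ℝ)
    (p m n ν : V [⋀^Fin k]→L[ℝ] ℝ) :
    (-3 / 2 : ℝ) • (s • p) + (3 / 2 : ℝ) • (t • m) + n + ν =
      (-3 / 2 * (α * s + β * t)) • (α • p - β • m) +
        (3 / 2 * (α * t - β * s)) • (α • m + β • p) + n + ν := by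
  ext v
  simp only [ContinuousAlternatingMap.add_apply, ContinuousAlternatingMap.sub_apply,
    ContinuousAlternatingMap.smul_apply, smul_eq_mul]
  linear_combination (3 / 2 * s * p v - 3 / 2 * t * m v) * hαβ

end Pointwise

section Forms

variable {E : Type*} [NormedAddCommGroup E] [NormedSpace ℝ E] {H : Type*} [TopologicalSpace H]
  {I : ModelWithCorners ℝ E H} {M : Type*} [TopologicalSpace M] [ChartedSpace H M]

theorem combination_wedge {k l : ℕ} (α β : ℝ) (a b : DForm I M k) (c : DForm I M l) :
    (α • a + β • b) ⋏ c = α • (a ⋏ c) + β • (b ⋏ c) :=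
  funext fun _ => wedgeAt_combination_left _ _ _ _ _

theorem wedge_combination {k l : ℕ} (α β : ℝ) (a : DForm I M k) (b c : DForm I M l) :
    a ⋏ (α • b + β • c) = α • (a ⋏ b) + β • (a ⋏ c) :=
  funext fun _ => wedgeAt_combination_right _ _ _ _ _

theorem combination_fsmul {k : ℕ} (α β : ℝ) (u v : M → ℝ) (a : DForm I M k) :
    (fun x => α * u x + β * v x) •ᶠ a = α • (u •ᶠ a) + β • (v •ᶠ a) := by
  funext x
  change (α * u x + β * v x) • a x = α • u x • a x + β • v x • a x
  rw [add_smul, mul_smul, mul_smul]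

theorem sub_smul_eq {k : ℕ} (α β : ℝ) (a b : DForm I M k) :
    α • a - β • b = α • a + (-β) • b := by
  funext x
  ext v
  change α * a x v - β * b x v = α * a x v + -β * b x v
  ring

theorem extD_combination [I.Boundaryless] [IsManifold I 1 M] {k : ℕ} (α β : ℝ) {a b : DForm I M k}
    (ha : ∀ x, FormDifferentiableAt a x) (hb : ∀ x, FormDifferentiableAt b x) :
    extD (α • a + β • b) = α • extD a + β • extD b := by
  funext x
  rw [extD_add ((ha x).smul α) ((hb x).smul β), extD_smul, extD_smul]
  rfl

end Forms

section Rotation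

variable {M : Type*} [TopologicalSpace M] [ChartedSpace (EuclideanSpace ℝ (Fin 6)) M]
  [IsManifold (𝓡 6) ∞ M] {S : SU3Structure M}

theorem SU3Structure.star₄_combination (S : SU3Structure M) (α β : ℝ) (a b : DForm (𝓡 6) M 4) :
    S.star₄ (α • a + β • b) = α • S.star₄ a + β • S.star₄ b := by
  funext x
  have h₁ : ∀ η : DForm (𝓡 6) M 4,
    S.star₄ η x = hodgeStarAt (k := 4) 2 (S.g.inner x) (S.vol x) (η x) := fun _ => rfl
  have h₂ : (α • a + β • b) x = α • a x + β • b x := rfl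
  have h₃ : (α • S.star₄ a + β • S.star₄ b) x = α • S.star₄ a x + β • S.star₄ b x := rfl
  rw [h₁, h₂, h₃, h₁, h₁, hodgeStarAt_add, hodgeStarAt_smul, hodgeStarAt_smul]

theorem star_combination_wedge_omega (α β : ℝ) {σ τ : DForm (𝓡 6) M 2} (hσ : S.MemΩ28 σ)
    (hτ : S.MemΩ28 τ) : S.star₄ ((α • σ + β • τ) ⋏ S.omega) = -(α • σ + β • τ) := by
  rw [combination_wedge, S.star₄_combination, star_wedge_omega hσ, star_wedge_omega hτ, smul_neg,
    smul_neg, neg_add]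

theorem SU3Structure.rotate_omega {α β : ℝ} (hαβ : α ^ 2 + β ^ 2 = 1) :
    (S.rotate hαβ).omega = S.omega := rfl

theorem SU3Structure.rotate_vol {α β : ℝ} (hαβ : α ^ 2 + β ^ 2 = 1) :
    (S.rotate hαβ).vol = S.vol := by
  rw [vol, vol, rotate_omega]

theorem SU3Structure.rotate_g {α β : ℝ} (hαβ : α ^ 2 + β ^ 2 = 1) :
    (S.rotate hαβ).g = S.g := rfl

theorem SU3Structure.rotate_ψm {α β : ℝ} (hαβ : α ^ 2 + β ^ 2 = 1) :
    (S.rotate hαβ).ψm = α • S.ψm + β • S.ψp := rfl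

theorem SU3Structure.rotate_star₄ {α β : ℝ} (hαβ : α ^ 2 + β ^ 2 = 1) (η : DForm (𝓡 6) M 4) :
    (S.rotate hαβ).star₄ η = S.star₄ η := by
  rw [star₄, star₄, rotate_vol, rotate_g]

theorem SU3Structure.rotate_star₅ {α β : ℝ} (hαβ : α ^ 2 + β ^ 2 = 1) (η : DForm (𝓡 6) M 5) :
    (S.rotate hαβ).star₅ η = S.star₅ η := by
  rw [star₅, star₅, rotate_vol, rotate_g]

theorem SU3Structure.MemΩ312.rotate {α β : ℝ} (hαβ : α ^ 2 + β ^ 2 = 1) {ν : DForm (𝓡 6) M 3}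
    (h : S.MemΩ312 ν) : (S.rotate hαβ).MemΩ312 ν := by
  obtain ⟨h₀, h₁, h₂, h₃⟩ := h
  refine ⟨h₀, h₁, ?_, ?_⟩
  · change ν ⋏ (α • S.ψp - β • S.ψm) = 0
    rw [sub_smul_eq, wedge_combination, h₂, h₃, smul_zero, smul_zero, add_zero]
  · change ν ⋏ (α • S.ψm + β • S.ψp) = 0
    rw [wedge_combination, h₂, h₃, smul_zero, smul_zero, add_zero]

/-- The exterior derivative of a combination of `ψ₊` and `ψ₋`. -/
theorem extD_rotate (α β : ℝ) {ψ ψ' : DForm (𝓡 6) M 3} (hψ : IsSmooth ψ) (hψ' : IsSmooth ψ')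
    {u v : M → ℝ} {W : DForm (𝓡 6) M 4} {π : DForm (𝓡 6) M 1} {σ τ : DForm (𝓡 6) M 2}
    (h : extD ψ = u •ᶠ W + π ⋏ ψ - σ ⋏ S.omega) (h' : extD ψ' = v •ᶠ W + π ⋏ ψ' - τ ⋏ S.omega) :
    extD (α • ψ + β • ψ') =
      (fun x => α * u x + β * v x) •ᶠ W + π ⋏ (α • ψ + β • ψ') - (α • σ + β • τ) ⋏ S.omega := by
  rw [extD_combination α β (fun x => hψ.formDifferentiableAt x)
    (fun x => hψ'.formDifferentiableAt x), h, h', combination_fsmul, wedge_combination,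
    combination_wedge, smul_sub, smul_sub, smul_add, smul_add]
  abel

theorem SU3Structure.TorsionForms.d_omega_rotate (T : S.TorsionForms) {α β : ℝ}
    (hαβ : α ^ 2 + β ^ 2 = 1) : extD S.omega =
      (fun x => -3 / 2 * (α * T.σ₀ x + β * T.π₀ x)) •ᶠ (α • S.ψp - β • S.ψm) +
      (fun x => 3 / 2 * (α * T.π₀ x - β * T.σ₀ x)) •ᶠ (α • S.ψm + β • S.ψp) +
      T.ν₁ ⋏ S.omega + T.ν₃ := by
  rw [T.d_omega]
  funext x
  exact rotation_identity hαβ (T.σ₀ x) (T.π₀ x) (S.ψp x) (S.ψm x)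
    (wedgeAt (T.ν₁ x) (S.omega x)) (T.ν₃ x)

omit [IsManifold (𝓡 6) ∞ M] in
theorem nu_eq_zero {f : M → ℝ} (hf0 : ∀ x, f x ≠ 0) {ν : DForm (𝓡 6) M 1}
    (h : differential (𝓡 6) f = -(f •ᶠ ν)) (hdf : ∀ x, mfderiv (𝓡 6) 𝓘(ℝ) f x = 0) : ν = 0 := by
  funext x
  have h₁ : differential (𝓡 6) f x = 0 := by
    ext v
    change mfderiv (𝓡 6) 𝓘(ℝ) f x (v 0) = 0
    rw [hdf x]
    rfl
  have h₂ : differential (𝓡 6) f x = -(f x • ν x) := congrFun h x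
  exact (smul_eq_zero.1 (neg_eq_zero.1 (h₂.symm.trans h₁))).resolve_left (hf0 x)

omit [IsManifold (𝓡 6) ∞ M] in
theorem zero_wedge {k l : ℕ} (a : DForm (𝓡 6) M l) : (0 : DForm (𝓡 6) M k) ⋏ a = 0 :=
  funext fun _ => wedgeAt_zero_left _

theorem laplacian_formula_zero (S : SU3Structure M) (f : M → ℝ) (a : DForm (𝓡 6) M 3)
    (ψ : DForm (𝓡 6) M 3) :
    lift (-a + extD (S.star₄ ((0 : DForm (𝓡 6) M 1) ⋏ ψ))) +
      lift (f •ᶠ ((0 : DForm (𝓡 6) M 1) ⋏ S.star₅ ((0 : DForm (𝓡 6) M 1) ⋏ (S.omega ⋏ S.omega)) -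
        extD (S.star₅ ((0 : DForm (𝓡 6) M 1) ⋏ (S.omega ⋏ S.omega))))) ⋏ ds M = lift (-a) := by
  have h₁ : S.star₄ ((0 : DForm (𝓡 6) M 1) ⋏ ψ) = 0 :=
    (congrArg S.star₄ (zero_wedge ψ)).trans S.star₄_zero
  have h₂ : S.star₅ ((0 : DForm (𝓡 6) M 1) ⋏ (S.omega ⋏ S.omega)) = 0 :=
    (congrArg S.star₅ (zero_wedge _)).trans S.star₅_zero
  have h₃ : extD (0 : DForm (𝓡 6) M 2) = 0 := funext extD_zero
  have h₄ : extD (0 : DForm (𝓡 6) M 1) = 0 := funext extD_zero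
  have h₅ : (0 : DForm (𝓡 6) M 1) ⋏ (0 : DForm (𝓡 6) M 1) = 0 := zero_wedge _
  have h₆ : f •ᶠ (0 : DForm (𝓡 6) M 2) = 0 := funext fun x => smul_zero (f x)
  have h₇ : lift (0 : DForm (𝓡 6) M 2) = 0 := by
    funext p
    ext v
    rfl
  have h₈ : (0 : DForm ((𝓡 6).prod (𝓡 1)) (M × Circle) 2) ⋏ ds M = 0 :=
    funext fun _ => wedgeAt_zero_left _
  rw [h₁, h₂, h₃, h₄, h₅, add_zero, sub_zero, h₆, h₇, h₈]
  exact add_zero _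

end Rotation

end WarpedG2

end

open WarpedG2 in
theorem mainTheorem3 {M : Type*} [TopologicalSpace M]
    [ChartedSpace (EuclideanSpace ℝ (Fin 6)) M] [IsManifold (𝓡 6) ∞ M]
    (S : SU3Structure M) (T : S.TorsionForms)
    (f : M → ℝ) (hf : ContMDiff (𝓡 6) 𝓘(ℝ) ∞ f) (hf0 : ∀ x, f x ≠ 0)
    (α β : ℝ) (hαβ : α ^ 2 + β ^ 2 = 1)
    (G : G2Structure ((𝓡 6).prod (𝓡 1)) (M × Circle))
    (hG : G.φ = warpedForm S f α β)
    (hclosed : extD G.φ = 0) :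
    α • T.π₂ - β • T.σ₂ = 0 ∧
    G.laplacian G.φ =
      lift (-extD (α • T.σ₂ + β • T.π₂) +
        extD (S.star₄ (T.ν₁ ⋏ (α • S.ψm + β • S.ψp)))) +
      lift (f •ᶠ (T.ν₁ ⋏ S.star₅ (T.ν₁ ⋏ (S.omega ⋏ S.omega)) -
        extD (S.star₅ (T.ν₁ ⋏ (S.omega ⋏ S.omega))))) ⋏ ds M ∧
    ((∀ x, mfderiv (𝓡 6) 𝓘(ℝ) f x = 0) →
      G.laplacian G.φ = lift (-extD (α • T.σ₂ + β • T.π₂))) := by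
  have hG' : G.φ = lift (f •ᶠ (S.rotate hαβ).omega) ⋏ ds M + lift (S.rotate hαβ).ψp := hG
  have hω := T.d_omega_rotate hαβ
  have hψp := extD_rotate α (-β) S.smooth_ψp S.smooth_ψm T.d_ψp T.d_ψm
  have hψm := extD_rotate α β S.smooth_ψm S.smooth_ψp T.d_ψm T.d_ψp
  have hτ : (S.rotate hαβ).star₄ ((α • T.π₂ + (-β) • T.σ₂) ⋏ (S.rotate hαβ).omega) =
      -(α • T.π₂ + (-β) • T.σ₂) := by
    rw [SU3Structure.rotate_star₄, SU3Structure.rotate_omega]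
    exact star_combination_wedge_omega α (-β) T.mem_π₂ T.mem_σ₂
  have hσ : (S.rotate hαβ).star₄ ((α • T.σ₂ + β • T.π₂) ⋏ (S.rotate hαβ).omega) =
      -(α • T.σ₂ + β • T.π₂) := by
    rw [SU3Structure.rotate_star₄, SU3Structure.rotate_omega]
    exact star_combination_wedge_omega α β T.mem_σ₂ T.mem_π₂
  rw [← sub_smul_eq α β S.ψp S.ψm] at hψp
  obtain ⟨h₁, h₂, h₃⟩ := laplacian_warped (S := S.rotate hαβ) hf hf0 hG' hclosed T.smooth_ν₁
    (T.mem_ν₃.rotate hαβ)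
    (fun x => ((T.mem_σ₂.1.formDifferentiableAt x).smul α).add
      ((T.mem_π₂.1.formDifferentiableAt x).smul β)) hτ hσ hω hψp hψm
    (fun x hx => by linarith)
  rw [SU3Structure.rotate_star₄, SU3Structure.rotate_star₅, SU3Structure.rotate_omega,
    SU3Structure.rotate_ψm] at h₃
  refine ⟨(sub_smul_eq α β T.π₂ T.σ₂).trans h₁, h₃, fun hdf => ?_⟩
  rw [nu_eq_zero hf0 h₂ hdf] at h₃
  exact h₃.trans (laplacian_formula_zero S f _ _)
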